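/- Let $k\ge 1$ and let $0<t_0<t_1<\dots<t_{k-1}$ be fixed integers. A nonempty family $S$ of $k$-subsets of $[n]$ is \emph{extremal} if its lower shadow $\Delta S$ attains the Kruskal--Katona bound: $|\Delta S|=\sum_{i=0}^{r}\binom{a_i}{k-i-1}$, where $|S|=\sum_{i=0}^{r}\binom{a_i}{k-i}$, $a_0>\dots>a_r\ge k-r\ge 1$, is the $k$-binomial decomposition of $|S|$. Families are counted as labelled: different families are different even if they are isomorphic. Initial segments of the colex order on the $k$-subsets of $[n]$ are taken up to a permutation of $[n]$. The hypergraph of $S$ has as edges the inclusion-minimal sets among the nonempty sets $e\subseteq[n]$ with $|e|\le k$ and $e\notin\Delta^{k-|e|}(S)$. Let $\mathcal E_n=\mathcal E(t_0,\dots,t_{k-1})$ be the set of extremal families $S$ of $k$-subsets of $[n]$ for which $|S|$ has the $k$-binomial decomposition $$\sum_{i=0}^{k-2}\binom{n-t_i-(i+1)}{k-i}+\binom{n-t_{k-1}-(k-1)}{1}.$$ Let $\mathcal E_{0,n}$ be the set of those $S\in\mathcal E_n$ that are obtained from an initial segment of the colex order by removing some edges of size $k$, that is, $S=I\setminus J$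 where $I$ is an initial segment of the colex order on the $k$-sets and every member of $J$ is an edge of the hypergraph of $S$. Then $$\lim_{n\to\infty}\frac{|\mathcal E_n|}{|\mathcal E_{0,n}|}=1 .$$ -/

import Mathlib

open Filter Topology
open scoped FinsetFamily

/-- `a` (of length `ℓ`) is the `k`-binomial decomposition of `m`:
`m = C(a 0, k) + C(a 1, k-1) + ⋯ + C(a (ℓ-1), k-ℓ+1)` with
`a 0 > a 1 > ⋯ > a (ℓ-1) ≥ k-ℓ+1 ≥ 1`.  As `a` is strictly decreasing, the last inequality is the
same as `a i ≥ k - i` for all `i`.  Such a sequence exists and is unique for `m, k ≥ 1`. -/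
def IsBinomialDecomposition (k m ℓ : ℕ) (a : Fin ℓ → ℕ) : Prop :=
  1 ≤ ℓ ∧ ℓ ≤ k ∧ StrictAnti a ∧ (∀ i : Fin ℓ, k - (i : ℕ) ≤ a i) ∧
    m = ∑ i : Fin ℓ, (a i).choose (k - (i : ℕ))

/-- A nonempty family of `k`-subsets of an `n`-element set is extremal when its lower shadow
attains the Kruskal-Katona lower bound given by the `k`-binomial decomposition of its size. -/
def IsExtremal (n k : ℕ) (S : Finset (Finset (Fin n))) : Prop :=
  S.Nonempty ∧ (S : Set (Finset (Fin n))).Sized k ∧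
    ∃ (ℓ : ℕ) (a : Fin ℓ → ℕ), IsBinomialDecomposition k S.card ℓ a ∧
      (∂ S).card = ∑ i : Fin ℓ, (a i).choose (k - (i : ℕ) - 1)

/-- An initial segment of the colex order on the `k`-subsets, up to a permutation of the
ground set. -/
def IsColexSegment (n k : ℕ) (I : Finset (Finset (Fin n))) : Prop :=
  ∃ σ : Equiv.Perm (Fin n),
    Finset.Colex.IsInitSeg (I.image (fun s => s.image σ)) k

/-- `e` is a nonempty set of size at most `k` that lies outside the iterated shadow of `S`
in its size. -/
def IsNonFace (n k : ℕ) (S : Finset (Finset (Fin n))) (e : Finset (Fin n)) : Prop :=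
  1 ≤ e.card ∧ e.card ≤ k ∧ e ∉ ∂^[k - e.card] S

/-- The edges of the hypergraph of a family `S` of `k`-sets: the inclusion-minimal nonfaces. -/
def IsHyperedge (n k : ℕ) (S : Finset (Finset (Fin n))) (e : Finset (Fin n)) : Prop :=
  Minimal (IsNonFace n k S) e

/-- `S` is obtained from an initial segment of the colex order by removing edges of size `k`:
every removed `k`-set is an edge of the hypergraph of `S`. -/
def IsColexMinusEdges (n k : ℕ) (S : Finset (Finset (Fin n))) : Prop :=
  ∃ I : Finset (Finset (Fin n)), IsColexSegment n k I ∧ S ⊆ I ∧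
    ∀ x ∈ I \ S, IsHyperedge n k S x

/-- The prescribed coefficients: `n - t i - (i+1)` for `i < k-1` and `n - t (k-1) - (k-1)` for the
last one. -/
def prescribedCoeff (n k : ℕ) (t : Fin k → ℕ) (i : Fin k) : ℕ :=
  if (i : ℕ) + 1 < k then n - t i - ((i : ℕ) + 1) else n - t i - (k - 1)

/-- The (labelled) extremal families of `k`-subsets of an `n`-set whose size has the prescribed
`k`-binomial decomposition. -/
def extremalFamilies (n k : ℕ) (t : Fin k → ℕ) : Set (Finset (Finset (Fin n))) :=
  {S | IsExtremal n k S ∧ IsBinomialDecomposition k S.card k (prescribedCoeff n k t)}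

/-- Those obtained from an initial segment of the colex order by removing edges of size `k`. -/
def extremalFamiliesFromColex (n k : ℕ) (t : Fin k → ℕ) : Set (Finset (Finset (Fin n))) :=
  {S | S ∈ extremalFamilies n k t ∧ IsColexMinusEdges n k S}

/-!
The faces of an extremal family `S` of `k`-sets (the subsets of its members) form a simplicial
complex, whose minimal nonfaces are the edges of the hypergraph of `S`.  Extend `t` to a strictly
increasing sequence `τ`, and write `d j = τ j - τ (j - 1)`.

**All levels are extremal.**  If `|S|` has the prescribed decomposition and `n` is large, then for
every `j ≤ k` the number of `j`-faces is the truncated cascade `faceCount τ n j`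
(`card_faces_eq_faceCount`).  It is enough to find the size of the second shadow.  Compress `S`
towards a vertex `v`: once `S` is stable, the link of `v` is extremal with `n` and `k` lowered by
one, and induction and Pascal's rule apply.  Undoing a compression does not enlarge the second
shadow, because in an extremal family any two members of the shadow have a common extension point
(`exists_common_extension`, `card_shadow_shadow_le_of_compression`).

**Counting edges.**  Comparing the number of `(j + 1)`-faces with the Kruskal-Katona bound for the
sets all of whose `j`-subsets are faces shows that there are at most `d (j - 1)` edges of size `j`.
A finer count (`exists_overlap_deficit`, `IsFaceExtremal.card_lowVertices_le`) bounds the number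
`w` of vertices covered by the edges of size less than `k`.  With `h` the number of edges of size
`k`, the conclusion is `w + k * h ≤ X`, where `X = τ (k - 2) + (k - 2) + k * d (k - 1)`.  Equality
holds only if the edges of each size `j < k` share `j - 1` points that form a chain in `j`
(`IsSpine`), and then the `k`-sets containing no edge of size less than `k` form a colex segment
(`isColexSegment_cliques`), so that `S` is this segment minus its edges of size `k`.

**The ratio.**  A family is determined by its edges, so there are at most a constant times
`n ^ (w + k * h)` families with given `w` and `h`.  Those not obtained from a colex segment
therefore number `O(n ^ (X - 1))` (`mul_ncard_not_isColexMinusEdges_le`).  On the other hand, take a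
standard colex segment, move its top `τ (k - 2) + k - 2` points to any set of that size, and delete
any `d (k - 1)` members: each choice gives a different family in the smaller class, which therefore
has at least a constant times `n ^ X` members (`exists_pow_le_mul_ncard`).  For `k = 1` the two
classes coincide.
-/

/-! ### A numerical form of the Kruskal-Katona theorem -/

/-- The size `1 + ∑_{i < k} C(c i, k - i)` of the colex initial segment of `k`-sets whose last
member is `{c 0 > c 1 > ⋯ > c (k-1)}`; the sequence `c` is only read below `k`. -/
def cascade (c : ℕ → ℕ) (k : ℕ) : ℕ := ∑ i ∈ Finset.range k, (c i).choose (k - i) + 1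

lemma cascade_succ' (c : ℕ → ℕ) (k : ℕ) :
    cascade c (k + 1) = (c 0).choose (k + 1) + cascade (fun i => c (i + 1)) k := by
  unfold cascade
  rw [Finset.sum_range_succ']
  simp only [Nat.add_sub_add_right, Nat.sub_zero]
  ring

lemma card_filter_toColex_le (k : ℕ) (c : ℕ → ℕ) (M : ℕ) (hM : ∀ i < k, c i < M)
    (hc : ∀ i j, i < j → j < k → c j < c i) :
    (((Finset.range M).powersetCard k).filter
      (fun t => toColex t ≤ toColex ((Finset.range k).image c))).card = cascade c k := by
  induction k generalizing c M with
  | zero =>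
    have : (((Finset.range M).powersetCard 0).filter
        (fun t => toColex t ≤ toColex ((Finset.range 0).image c))) = {∅} := by
      ext t
      simp only [Finset.powersetCard_zero, Finset.mem_filter, Finset.mem_singleton]
      constructor
      · exact fun h => h.1
      · rintro rfl
        simp
    rw [this]
    simp [cascade]
  | succ k ih =>
    set s' := (Finset.range k).image (fun i => c (i + 1)) with hs'
    have hs : (Finset.range (k + 1)).image c = insert (c 0) s' := by
      ext x
      simp only [hs', Finset.mem_image, Finset.mem_range, Finset.mem_insert]
      constructor
      · rintro ⟨i, hi, rfl⟩
        rcases i with _ | i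
        · exact Or.inl rfl
        · exact Or.inr ⟨i, by omega, rfl⟩
      · rintro (rfl | ⟨i, hi, rfl⟩)
        · exact ⟨0, by omega, rfl⟩
        · exact ⟨i + 1, by omega, rfl⟩
    have hlt : ∀ x ∈ s', x < c 0 := by
      intro x hx
      simp only [hs', Finset.mem_image, Finset.mem_range] at hx
      obtain ⟨i, hi, rfl⟩ := hx
      exact hc 0 (i + 1) (by omega) (by omega)
    have hins : ∀ t' : Finset ℕ, c 0 ∉ t' →
        (toColex (insert (c 0) t') ≤ toColex (insert (c 0) s') ↔ toColex t' ≤ toColex s') := by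
      intro t' ht'
      rw [← Finset.Colex.toColex_sdiff_le_toColex_sdiff (u := {c 0})
        (s := insert (c 0) t') (t := insert (c 0) s') (by simp) (by simp)]
      rw [Finset.insert_sdiff_of_mem _ (by simp), Finset.insert_sdiff_of_mem _ (by simp),
        Finset.sdiff_singleton_eq_erase, Finset.sdiff_singleton_eq_erase,
        Finset.erase_eq_of_notMem ht', Finset.erase_eq_of_notMem (fun h => lt_irrefl _ (hlt _ h))]
    have key : (((Finset.range M).powersetCard (k + 1)).filter
        (fun t => toColex t ≤ toColex ((Finset.range (k + 1)).image c))) =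
        (Finset.range (c 0)).powersetCard (k + 1) ∪
        ((((Finset.range (c 0)).powersetCard k).filter (fun t => toColex t ≤ toColex s')).image
          (insert (c 0))) := by
      ext t
      rw [hs]
      simp only [Finset.mem_filter, Finset.mem_powersetCard, Finset.mem_union, Finset.mem_image]
      constructor
      · rintro ⟨⟨htM, htk⟩, hle⟩
        have hb : ∀ b ∈ t, b ≤ c 0 := Finset.Colex.forall_le_mono hle (by
          intro b hb
          rcases Finset.mem_insert.1 hb with rfl | hb
          · exact le_rfl
          · exact (hlt b hb).le)
        by_cases h0 : c 0 ∈ t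
        · right
          refine ⟨t.erase (c 0), ⟨⟨?_, ?_⟩, ?_⟩, Finset.insert_erase h0⟩
          · intro x hx
            rw [Finset.mem_erase] at hx
            exact Finset.mem_range.2 (lt_of_le_of_ne (hb x hx.2) hx.1)
          · rw [Finset.card_erase_of_mem h0, htk]
            rfl
          · rw [← hins _ (Finset.notMem_erase _ _), Finset.insert_erase h0]
            exact hle
        · left
          refine ⟨?_, htk⟩
          intro x hx
          exact Finset.mem_range.2
            (lt_of_le_of_ne (hb x hx) (fun h => h0 (h ▸ hx)))
      · rintro (⟨ht, htk⟩ | ⟨t', ⟨⟨ht', htk'⟩, hle⟩, rfl⟩)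
        · refine ⟨⟨ht.trans ?_, htk⟩, ?_⟩
          · intro x hx
            exact Finset.mem_range.2 ((Finset.mem_range.1 hx).trans (hM 0 (by omega)))
          · refine (Finset.Colex.toColex_lt_toColex_iff_exists_forall_lt.2
              ⟨c 0, by simp, fun h => ?_, fun b hb _ => Finset.mem_range.1 (ht hb)⟩).le
            exact absurd (Finset.mem_range.1 (ht h)) (lt_irrefl _)
        · have h0 : c 0 ∉ t' := fun h => absurd (Finset.mem_range.1 (ht' h)) (lt_irrefl _)
          refine ⟨⟨?_, by rw [Finset.card_insert_of_notMem h0, htk']⟩, (hins _ h0).2 hle⟩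
          intro x hx
          rcases Finset.mem_insert.1 hx with rfl | hx
          · exact Finset.mem_range.2 (hM 0 (by omega))
          · exact Finset.mem_range.2 ((Finset.mem_range.1 (ht' hx)).trans (hM 0 (by omega)))
    rw [key, Finset.card_union_of_disjoint, Finset.card_powersetCard, Finset.card_range,
      Finset.card_image_of_injOn, ih (fun i => c (i + 1)) (c 0), cascade_succ']
    · exact fun i hi => hc 0 (i + 1) (by omega) (by omega)
    · exact fun i j hij hj => hc (i + 1) (j + 1) (by omega) (by omega)
    · intro a ha b hb hab
      have h0 : ∀ t ∈ ((Finset.range (c 0)).powersetCard k).filter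
          (fun t => toColex t ≤ toColex s'), c 0 ∉ t := by
        intro t ht h
        have := (Finset.mem_powersetCard.1 (Finset.mem_filter.1 ht).1).1 h
        exact absurd (Finset.mem_range.1 this) (lt_irrefl _)
      have := congrArg (fun t => Finset.erase t (c 0)) hab
      simpa [Finset.erase_insert (h0 a (by simpa using ha)),
        Finset.erase_insert (h0 b (by simpa using hb))] using this
    · rw [Finset.disjoint_left]
      rintro t ht ht'
      obtain ⟨t', -, rfl⟩ := Finset.mem_image.1 ht'
      have := (Finset.mem_powersetCard.1 ht).1 (Finset.mem_insert_self _ _)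
      exact absurd (Finset.mem_range.1 this) (lt_irrefl _)

/-- The set `{c 0, …, c (k-1)}` as a set of elements of `Fin M`. -/
def cascadeSet (M : ℕ) (c : ℕ → ℕ) (k : ℕ) : Finset (Fin M) :=
  Finset.univ.filter (fun x => ∃ i < k, c i = (x : ℕ))

lemma mem_cascadeSet {M k : ℕ} {c : ℕ → ℕ} {x : Fin M} :
    x ∈ cascadeSet M c k ↔ ∃ i < k, c i = (x : ℕ) := by
  simp [cascadeSet]

lemma image_val_cascadeSet {M k : ℕ} {c : ℕ → ℕ} (hM : ∀ i < k, c i < M) :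
    (cascadeSet M c k).image (fun x : Fin M => (x : ℕ)) = (Finset.range k).image c := by
  ext x
  simp only [Finset.mem_image, mem_cascadeSet, Finset.mem_range]
  constructor
  · rintro ⟨y, ⟨i, hi, h⟩, rfl⟩
    exact ⟨i, hi, h⟩
  · rintro ⟨i, hi, rfl⟩
    exact ⟨⟨c i, hM i hi⟩, ⟨i, hi, rfl⟩, rfl⟩

lemma card_cascadeSet {M k : ℕ} {c : ℕ → ℕ} (hM : ∀ i < k, c i < M)
    (hc : ∀ i j, i < j → j < k → c j < c i) : (cascadeSet M c k).card = k := by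
  rw [← Finset.card_image_of_injective _ Fin.val_injective, image_val_cascadeSet hM,
    Finset.card_image_of_injOn, Finset.card_range]
  intro i hi j hj hij
  simp only [Finset.coe_range, Set.mem_Iio] at hi hj
  rcases lt_trichotomy i j with h | h | h
  · exact absurd hij (hc i j h hj).ne'
  · exact h
  · exact absurd hij (hc j i h hi).ne

lemma card_initSeg_cascadeSet {M k : ℕ} {c : ℕ → ℕ} (hM : ∀ i < k, c i < M)
    (hc : ∀ i j, i < j → j < k → c j < c i) :
    (Finset.Colex.initSeg (cascadeSet M c k)).card = cascade c k := by
  rw [← card_filter_toColex_le k c M hM hc, ← image_val_cascadeSet hM]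
  refine Finset.card_bij (fun t _ => t.image (fun x : Fin M => (x : ℕ))) ?_ ?_ ?_
  · intro t ht
    rw [Finset.Colex.mem_initSeg, card_cascadeSet hM hc] at ht
    simp only [Finset.mem_filter, Finset.mem_powersetCard]
    refine ⟨⟨?_, ?_⟩, ?_⟩
    · intro x hx
      obtain ⟨y, -, rfl⟩ := Finset.mem_image.1 hx
      exact Finset.mem_range.2 y.2
    · rw [Finset.card_image_of_injective _ Fin.val_injective, ht.1]
    · exact (Finset.Colex.toColex_image_le_toColex_image Fin.val_strictMono).2 ht.2
  · intro a _ b _ h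
    exact Finset.image_injective Fin.val_injective h
  · intro t ht
    simp only [Finset.mem_filter, Finset.mem_powersetCard] at ht
    have himg : (Finset.univ.filter (fun x : Fin M => (x : ℕ) ∈ t)).image
        (fun x : Fin M => (x : ℕ)) = t := by
      ext x
      simp only [Finset.mem_image, Finset.mem_filter, Finset.mem_univ, true_and]
      constructor
      · rintro ⟨y, hy, rfl⟩
        exact hy
      · exact fun hx => ⟨⟨x, Finset.mem_range.1 (ht.1.1 hx)⟩, hx, rfl⟩
    refine ⟨Finset.univ.filter (fun x : Fin M => (x : ℕ) ∈ t), ?_, himg⟩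
    rw [Finset.Colex.mem_initSeg, card_cascadeSet hM hc]
    constructor
    · rw [← Finset.card_image_of_injective _ Fin.val_injective, himg, ht.1.2]
    · rw [← Finset.Colex.toColex_image_le_toColex_image (f := fun x : Fin M => (x : ℕ))
        Fin.val_strictMono, himg]
      exact ht.2

lemma shadow_initSeg_cascadeSet {M k : ℕ} {c : ℕ → ℕ} (hM : ∀ i < k + 1, c i < M)
    (hc : ∀ i j, i < j → j < k + 1 → c j < c i) :
    ∂ (Finset.Colex.initSeg (cascadeSet M c (k + 1))) =
      Finset.Colex.initSeg (cascadeSet M c k) := by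
  have hk : (⟨c k, hM k (by omega)⟩ : Fin M) ∈ cascadeSet M c (k + 1) :=
    mem_cascadeSet.2 ⟨k, by omega, rfl⟩
  have hmin : (cascadeSet M c (k + 1)).min' ⟨_, hk⟩ = ⟨c k, hM k (by omega)⟩ := by
    refine le_antisymm (Finset.min'_le _ _ hk) (Finset.le_min' _ _ _ ?_)
    intro y hy
    obtain ⟨i, hi, h⟩ := mem_cascadeSet.1 hy
    rw [Fin.le_def, ← h]
    rcases Nat.lt_or_ge i k with h' | h'
    · exact (hc i k h' (by omega)).le
    · rw [show i = k by omega]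
  rw [Finset.Colex.shadow_initSeg ⟨_, hk⟩, hmin]
  congr 1
  ext x
  simp only [Finset.mem_erase, mem_cascadeSet]
  constructor
  · rintro ⟨hne, i, hi, h⟩
    refine ⟨i, lt_of_le_of_ne (by omega) ?_, h⟩
    rintro rfl
    exact hne (Fin.ext h.symm)
  · rintro ⟨i, hi, h⟩
    refine ⟨fun hx => ?_, i, by omega, h⟩
    rw [hx] at h
    exact absurd h (hc i k hi (by omega)).ne'

lemma shadow_image_image {α β : Type*} [DecidableEq α] [DecidableEq β] {f : α → β}
    (hf : Function.Injective f) (S : Finset (Finset α)) :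
    ∂ (S.image (fun s => s.image f)) = (∂ S).image (fun s => s.image f) := by
  ext t
  simp only [Finset.mem_shadow_iff, Finset.mem_image]
  constructor
  · rintro ⟨_, ⟨s, hs, rfl⟩, x, hx, rfl⟩
    obtain ⟨a, ha, rfl⟩ := Finset.mem_image.1 hx
    exact ⟨s.erase a, ⟨s, hs, a, ha, rfl⟩, Finset.image_erase hf _ _⟩
  · rintro ⟨_, ⟨s, hs, a, ha, rfl⟩, rfl⟩
    exact ⟨_, ⟨s, hs, rfl⟩, f a, Finset.mem_image_of_mem f ha, (Finset.image_erase hf _ _).symm⟩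

/-- The **Kruskal-Katona theorem** in numerical form, over an arbitrary ground set. -/
theorem cascade_le_card_shadow {α : Type*} [DecidableEq α] [Fintype α] {k : ℕ}
    {S : Finset (Finset α)} (hS : (S : Set (Finset α)).Sized (k + 1)) {c : ℕ → ℕ}
    (hc : ∀ i j, i < j → j < k + 1 → c j < c i) (h : cascade c (k + 1) ≤ S.card) :
    cascade c k ≤ (∂ S).card := by
  -- A ground set large enough to contain both `α` and the values of `c`.
  set M := max (Fintype.card α) (c 0 + 1) with hMdef
  have hM : ∀ i < k + 1, c i < M := by
    intro i hi
    have : c i ≤ c 0 := by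
      rcases Nat.eq_zero_or_pos i with rfl | h0
      · exact le_rfl
      · exact (hc 0 i h0 hi).le
    omega
  let f : α → Fin M := fun a => Fin.castLE (le_max_left _ _) (Fintype.equivFin α a)
  have hf : Function.Injective f := fun a b hab =>
    (Fintype.equivFin α).injective (Fin.castLE_injective _ hab)
  have hinj : Function.Injective (fun s : Finset α => s.image f) := Finset.image_injective hf
  have h1 : ((S.image (fun s => s.image f) : Finset (Finset (Fin M))) :
      Set (Finset (Fin M))).Sized (k + 1) := by
    intro t ht
    obtain ⟨s, hs, rfl⟩ := Finset.mem_image.1 (Finset.mem_coe.1 ht)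
    rw [Finset.card_image_of_injective _ hf]
    exact hS hs
  have hseg := Finset.Colex.isInitSeg_initSeg (s := cascadeSet M c (k + 1))
  rw [card_cascadeSet hM hc] at hseg
  have h2 := Finset.kruskal_katona h1 (𝒞 := Finset.Colex.initSeg (cascadeSet M c (k + 1)))
    (by rw [card_initSeg_cascadeSet hM hc, Finset.card_image_of_injective _ hinj]; exact h) hseg
  rw [shadow_image_image hf, Finset.card_image_of_injective _ hinj,
    shadow_initSeg_cascadeSet hM hc, card_initSeg_cascadeSet (fun i hi => hM i (by omega))
      (fun i j hij hj => hc i j hij (by omega))] at h2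
  exact h2

/-! ### Faces, cliques and minimal nonfaces of a family -/

section Faces

/-- `e` is a face of the simplicial complex generated by the family `S`. -/
def IsFace {α : Type*} (S : Finset (Finset α)) (e : Finset α) : Prop := ∃ s ∈ S, e ⊆ s

lemma IsFace.mono {α : Type*} {S : Finset (Finset α)} {e e' : Finset α} (h : IsFace S e)
    (h' : e' ⊆ e) :
    IsFace S e' := by
  obtain ⟨s, hs, hes⟩ := h
  exact ⟨s, hs, h'.trans hes⟩

variable {α : Type*} [DecidableEq α]

instance (S : Finset (Finset α)) (e : Finset α) : Decidable (IsFace S e) :=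
  inferInstanceAs (Decidable (∃ s ∈ S, e ⊆ s))

lemma mem_shadow_of_subset {S : Finset (Finset α)} {r : ℕ}
    (hS : (S : Set (Finset α)).Sized (r + 1)) {A t : Finset α} (hA : A ∈ S) (ht : t ⊆ A)
    (hr : t.card = r) : t ∈ ∂ S := by
  rw [Finset.mem_shadow_iff_exists_mem_card_add_one]
  exact ⟨A, hA, ht, by rw [hS hA, hr]⟩

lemma isFace_shadow_iff {S : Finset (Finset α)} {k : ℕ}
    (hS : (S : Set (Finset α)).Sized (k + 1)) {e : Finset α} (he : e.card ≤ k) :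
    IsFace (∂ S) e ↔ IsFace S e := by
  constructor
  · rintro ⟨t, ht, het⟩
    obtain ⟨s, hs, hts⟩ := Finset.exists_subset_of_mem_shadow ht
    exact ⟨s, hs, het.trans hts⟩
  · rintro ⟨s, hs, hes⟩
    obtain ⟨t, het, hts, htk⟩ := Finset.exists_subsuperset_card_eq hes he
      (by rw [hS hs]; exact Nat.le_succ k)
    exact ⟨t, mem_shadow_of_subset hS hs hts htk, het⟩

/-- Distinct points `y` need distinct sets `g` with `g \ e = {y}`. -/
lemma card_le_card_filter_sdiff {B : Finset α} {R : Finset (Finset α)} {e : Finset α}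
    (h : ∀ y ∈ B, ∃ g ∈ R, g \ e = {y}) :
    B.card ≤ (R.filter (fun g => (g \ e).card = 1)).card := by
  choose! φ hφ hφ' using h
  refine Finset.card_le_card_of_injOn φ ?_ ?_
  · intro y hy
    simp [hφ y hy, hφ' y hy]
  · intro y hy z hz hyz
    have h1 := hφ' y hy
    rw [hyz, hφ' z hz] at h1
    exact (Finset.singleton_injective h1).symm

variable [Fintype α]

/-- The faces of size `j`. -/
def faces (S : Finset (Finset α)) (j : ℕ) : Finset (Finset α) :=
  Finset.univ.filter (fun e => e.card = j ∧ IsFace S e)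

/-- The sets of size `j` all of whose subsets of size `j - 1` are faces. -/
def cliques (S : Finset (Finset α)) (j : ℕ) : Finset (Finset α) :=
  Finset.univ.filter (fun e => e.card = j ∧ ∀ x ∈ e, IsFace S (e.erase x))

/-- The minimal nonfaces of size `j`; for `1 ≤ j ≤ k` these are the hyperedges of size `j` of a
family of `k`-sets. -/
def minNonfaces (S : Finset (Finset α)) (j : ℕ) : Finset (Finset α) :=
  (cliques S j).filter (fun e => ¬ IsFace S e)

lemma mem_faces {S : Finset (Finset α)} {j : ℕ} {e : Finset α} :
    e ∈ faces S j ↔ e.card = j ∧ IsFace S e := by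
  simp [faces]

lemma mem_cliques {S : Finset (Finset α)} {j : ℕ} {e : Finset α} :
    e ∈ cliques S j ↔ e.card = j ∧ ∀ x ∈ e, IsFace S (e.erase x) := by
  simp [cliques]

lemma mem_minNonfaces {S : Finset (Finset α)} {j : ℕ} {e : Finset α} :
    e ∈ minNonfaces S j ↔
      e.card = j ∧ (∀ x ∈ e, IsFace S (e.erase x)) ∧ ¬ IsFace S e := by
  simp [minNonfaces, mem_cliques, and_assoc]

lemma sized_cliques (S : Finset (Finset α)) (j : ℕ) :
    (cliques S j : Set (Finset α)).Sized j := fun _ he => (mem_cliques.1 he).1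

lemma card_faces_add_card_minNonfaces (S : Finset (Finset α)) (j : ℕ) :
    (faces S j).card + (minNonfaces S j).card = (cliques S j).card := by
  rw [minNonfaces, ← Finset.card_filter_add_card_filter_not (s := cliques S j) (IsFace S)]
  congr 2
  ext e
  simp only [mem_faces, Finset.mem_filter, mem_cliques]
  exact ⟨fun h => ⟨⟨h.1, fun x _ => h.2.mono (Finset.erase_subset _ _)⟩, h.2⟩,
    fun h => ⟨h.1.1, h.2⟩⟩

lemma faces_of_sized {S : Finset (Finset α)} {k : ℕ} (hS : (S : Set (Finset α)).Sized k) :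
    faces S k = S := by
  ext e
  rw [mem_faces]
  constructor
  · rintro ⟨hc, s, hs, hes⟩
    rwa [Finset.eq_of_subset_of_card_le hes (by rw [hS hs, hc])]
  · exact fun he => ⟨hS he, e, he, Finset.Subset.rfl⟩

lemma faces_shadow {S : Finset (Finset α)} {k : ℕ} (hS : (S : Set (Finset α)).Sized (k + 1))
    {j : ℕ} (hj : j ≤ k) : faces (∂ S) j = faces S j := by
  ext e
  simp only [mem_faces]
  constructor
  · rintro ⟨h, h'⟩
    exact ⟨h, (isFace_shadow_iff hS (by omega)).1 h'⟩
  · rintro ⟨h, h'⟩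
    exact ⟨h, (isFace_shadow_iff hS (by omega)).2 h'⟩

lemma faces_eq_shadow {S : Finset (Finset α)} {k : ℕ} (hS : (S : Set (Finset α)).Sized (k + 1)) :
    faces S k = ∂ S := by
  rw [← faces_shadow hS le_rfl]
  exact faces_of_sized hS.shadow

lemma shadow_cliques_subset (S : Finset (Finset α)) (j : ℕ) :
    ∂ (cliques S (j + 1)) ⊆ faces S j := by
  intro t ht
  obtain ⟨e, he, x, hx, rfl⟩ := Finset.mem_shadow_iff.1 ht
  rw [mem_cliques] at he
  exact mem_faces.2 ⟨by rw [Finset.card_erase_of_mem hx, he.1]; rfl, he.2 x hx⟩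

lemma isFace_of_ssubset_minNonface {S : Finset (Finset α)} {j : ℕ} {e e' : Finset α}
    (he : e ∈ minNonfaces S j) (h : e' ⊂ e) : IsFace S e' := by
  obtain ⟨x, hx, hx'⟩ := Finset.exists_of_ssubset h
  refine ((mem_minNonfaces.1 he).2.1 x hx).mono ?_
  exact fun y hy => Finset.mem_erase.2 ⟨fun h' => hx' (h' ▸ hy), h.1 hy⟩

lemma exists_minNonface_subset {S : Finset (Finset α)} {e : Finset α} (he : ¬ IsFace S e) :
    ∃ g ⊆ e, g ∈ minNonfaces S g.card := by
  induction e using Finset.strongInduction with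
  | H e ih =>
    by_cases h : ∀ x ∈ e, IsFace S (e.erase x)
    · exact ⟨e, Finset.Subset.rfl, mem_minNonfaces.2 ⟨rfl, h, he⟩⟩
    · push Not at h
      obtain ⟨x, hx, hx'⟩ := h
      obtain ⟨g, hg, hg'⟩ := ih _ (Finset.erase_ssubset hx) hx'
      exact ⟨g, hg.trans (Finset.erase_subset _ _), hg'⟩

/-- If a face `e` becomes a nonface on adding `y`, some minimal nonface meets the complement of `e`
exactly in `y`. -/
lemma exists_minNonface_sdiff_eq {S : Finset (Finset α)} {e : Finset α} {y : α}
    (he : IsFace S e) (hy : y ∉ e) (h : ¬ IsFace S (insert y e)) :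
    ∃ g ⊆ insert y e, g ∈ minNonfaces S g.card ∧ g \ e = {y} := by
  obtain ⟨g, hg, hg'⟩ := exists_minNonface_subset h
  refine ⟨g, hg, hg', ?_⟩
  have hyg : y ∈ g := by
    by_contra hyg
    refine (mem_minNonfaces.1 hg').2.2 (he.mono fun x hx => ?_)
    exact Finset.mem_of_mem_insert_of_ne (hg hx) (fun hxy => hyg (hxy ▸ hx))
  ext x
  simp only [Finset.mem_sdiff, Finset.mem_singleton]
  constructor
  · rintro ⟨hx, hx'⟩
    exact (Finset.mem_insert.1 (hg hx)).resolve_right hx'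
  · rintro rfl
    exact ⟨hyg, hy⟩

end Faces

/-! ### The prescribed sizes -/

lemma succ_choose_two (m : ℕ) : (m + 1).choose 2 = m + m.choose 2 := by
  rw [Nat.choose_succ_succ' m 1, Nat.choose_one_right]

/-- The coefficients `n - τ i - (i + 1)` of the prescribed decomposition. -/
def coeff (τ : ℕ → ℕ) (n i : ℕ) : ℕ := n - τ i - (i + 1)

/-- The number of faces of size `j` in the complex of an extremal family of the prescribed size. -/
def faceCount (τ : ℕ → ℕ) (n j : ℕ) : ℕ := cascade (coeff τ n) j

lemma coeff_lt_coeff {τ : ℕ → ℕ} (hτ : StrictMono τ) {n i j : ℕ} (hij : i < j)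
    (hn : τ j + j + 1 ≤ n) : coeff τ n j + 1 < coeff τ n i := by
  have := hτ hij
  unfold coeff
  omega

lemma faceCount_zero (τ : ℕ → ℕ) (n : ℕ) : faceCount τ n 0 = 1 := by
  simp [faceCount, cascade]

lemma faceCount_one {τ : ℕ → ℕ} {n : ℕ} (hn : τ 0 + 1 ≤ n) : faceCount τ n 1 = n - τ 0 := by
  simp [faceCount, cascade, coeff]
  omega

lemma faceCount_pos (τ : ℕ → ℕ) (n j : ℕ) : 0 < faceCount τ n j := by
  simp [faceCount, cascade]

lemma faceCount_pascal {τ : ℕ → ℕ} (hτ : StrictMono τ) {n j : ℕ} (hn : τ j + j + 1 ≤ n) :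
    faceCount τ (n + 1) (j + 1) = faceCount τ n (j + 1) + faceCount τ n j := by
  unfold faceCount cascade
  have h1 : ∑ i ∈ Finset.range (j + 1), (coeff τ (n + 1) i).choose (j + 1 - i) =
      ∑ i ∈ Finset.range (j + 1),
        ((coeff τ n i).choose (j - i) + (coeff τ n i).choose (j + 1 - i)) := by
    refine Finset.sum_congr rfl fun i hi => ?_
    have hi' : i ≤ j := by
      have := Finset.mem_range.1 hi
      omega
    have h2 : coeff τ (n + 1) i = coeff τ n i + 1 := by
      have := hτ.monotone hi'
      unfold coeff
      omega
    rw [h2, show j + 1 - i = (j - i) + 1 by omega, Nat.choose_succ_succ]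
  rw [h1, Finset.sum_add_distrib, Finset.sum_range_succ (fun i => (coeff τ n i).choose (j - i))]
  simp
  ring

section MinNonfaceBound

variable {α : Type*} [DecidableEq α] [Fintype α]

lemma card_minNonfaces_le {τ : ℕ → ℕ} (hτ : StrictMono τ) {n i : ℕ}
    (hn : τ (i + 1) + i + 2 ≤ n) {S : Finset (Finset α)}
    (h1 : (faces S (i + 1)).card = faceCount τ n (i + 1))
    (h2 : (faces S (i + 2)).card = faceCount τ n (i + 2)) :
    (minNonfaces S (i + 2)).card + τ i ≤ τ (i + 1) := by
  -- The first colex segment whose shadow exceeds `faceCount τ n (i + 1)`.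
  let c : ℕ → ℕ := fun r => if r < i then coeff τ n r else if r = i then coeff τ n i + 1 else 0
  have hc : ∀ r s, r < s → s < i + 1 + 1 → c s < c r := by
    intro r s hrs hs
    have hlt : ∀ a b, a < b → b ≤ i → coeff τ n b + 1 < coeff τ n a := fun a b hab hb =>
      coeff_lt_coeff hτ hab (by have := hτ.monotone (show b ≤ i + 1 by omega); omega)
    rcases Nat.lt_trichotomy s i with h | rfl | h
    · simp only [c, h, hrs.trans h, if_true]
      have := hlt r s hrs h.le
      omega
    · simp only [c, hrs, if_true, lt_irrefl, if_false]
      exact hlt r s hrs le_rfl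
    · simp only [c, show ¬ s < i by omega, show s ≠ i by omega, if_false]
      split_ifs with h3 h4
      · have := hlt r i h3 le_rfl
        omega
      · omega
      · omega
  have hsum : ∀ m, ∑ r ∈ Finset.range i, (c r).choose (m - r) =
      ∑ r ∈ Finset.range i, (coeff τ n r).choose (m - r) := fun m =>
    Finset.sum_congr rfl fun r hr => by simp [c, Finset.mem_range.1 hr]
  have hT : (cliques S (i + 2)).card < cascade c (i + 2) := by
    by_contra! hcon
    have h3 := (cascade_le_card_shadow (sized_cliques S (i + 1 + 1)) hc hcon).trans
      (Finset.card_le_card (shadow_cliques_subset S (i + 1)))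
    rw [h1, faceCount, cascade, cascade, Finset.sum_range_succ, Finset.sum_range_succ, hsum] at h3
    simp [c] at h3
  have h4 := card_faces_add_card_minNonfaces S (i + 2)
  rw [h2, faceCount, cascade, Finset.sum_range_succ, Finset.sum_range_succ] at h4
  rw [cascade, Finset.sum_range_succ, Finset.sum_range_succ, hsum] at hT
  have hchoose := succ_choose_two (coeff τ n i)
  simp [c, hchoose, show i + 2 - i = 2 by omega, show i + 2 - (i + 1) = 1 by omega] at hT h4
  have := hτ (show i < i + 1 by omega)
  have h5 : coeff τ n i + τ i = coeff τ n (i + 1) + τ (i + 1) + 1 := by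
    unfold coeff
    omega
  omega

/-- All hyperedges of sizes between `2` and `m` together. -/
lemma sum_card_minNonfaces_le {τ : ℕ → ℕ} (hτ : StrictMono τ) {n m : ℕ}
    (hn : τ m + m + 1 ≤ n) {S : Finset (Finset α)}
    (h : ∀ j ≤ m + 1, (faces S j).card = faceCount τ n j) :
    ∑ i ∈ Finset.range m, (minNonfaces S (i + 2)).card + τ 0 ≤ τ m := by
  induction m with
  | zero => simp
  | succ m ih =>
    have h1 := hτ (show m < m + 1 by omega)
    have := ih (by omega) (fun j hj => h j (by omega))
    have := card_minNonfaces_le hτ (n := n) (i := m) (by omega) (h _ (by omega)) (h _ (by omega))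
    rw [Finset.sum_range_succ]
    omega

end MinNonfaceBound

/-! ### Iterated shadows of extremal families are extremal -/

section Compression

variable {α : Type*} [DecidableEq α]

lemma compress_singleton_of_mem {v w : α} (hvw : v ≠ w) {A : Finset α} (hv : v ∉ A)
    (hw : w ∈ A) : UV.compress {v} {w} A = insert v (A.erase w) := by
  rw [UV.compress, if_pos ⟨by simpa using hv, by simpa using hw⟩]
  ext x
  simp only [Finset.sup_eq_union, Finset.mem_sdiff, Finset.mem_union, Finset.mem_singleton,
    Finset.mem_insert, Finset.mem_erase]
  grind

lemma compress_singleton_of_mem_left {v w : α} {A : Finset α} (hv : v ∈ A) :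
    UV.compress {v} {w} A = A := by
  rw [UV.compress, if_neg]
  simp [hv]

lemma compress_singleton_of_notMem {v w : α} {A : Finset α} (hw : w ∉ A) :
    UV.compress {v} {w} A = A := by
  rw [UV.compress, if_neg]
  simp [hw]

lemma mem_compression_of_compress_eq {v w : α} {S : Finset (Finset α)} {A : Finset α}
    (hA : A ∈ S) (h : UV.compress {v} {w} A = A) : A ∈ UV.compression {v} {w} S := by
  rw [UV.mem_compression]
  exact Or.inl ⟨hA, by rwa [h]⟩

lemma card_shadow_compression_singleton_le (v w : α) (S : Finset (Finset α)) :
    (∂ (UV.compression {v} {w} S)).card ≤ (∂ S).card := by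
  refine UV.card_shadow_compression_le _ _ ?_
  intro x hx
  refine ⟨w, by simp, ?_⟩
  rw [Finset.mem_singleton.1 hx]
  simpa using UV.isCompressed_self ∅ S

lemma shadow_compression_singleton_subset (v w : α) (S : Finset (Finset α)) :
    ∂ (UV.compression {v} {w} S) ⊆ UV.compression {v} {w} (∂ S) := by
  refine UV.shadow_compression_subset_compression_shadow _ _ ?_
  intro x hx
  refine ⟨w, by simp, ?_⟩
  rw [Finset.mem_singleton.1 hx]
  simpa using UV.isCompressed_self ∅ S

/-- A proper compression towards `v` increases the degree of `v`. -/
lemma card_memberSubfamily_lt_of_compression_ne {v w : α} (hvw : v ≠ w) {S : Finset (Finset α)}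
    (h : UV.compression {v} {w} S ≠ S) :
    (S.memberSubfamily v).card < ((UV.compression {v} {w} S).memberSubfamily v).card := by
  refine Finset.card_lt_card (Finset.ssubset_iff_subset_ne.2 ⟨?_, ?_⟩)
  · intro t ht
    rw [Finset.mem_memberSubfamily] at ht ⊢
    exact ⟨mem_compression_of_compress_eq ht.1
      (compress_singleton_of_mem_left (Finset.mem_insert_self _ _)), ht.2⟩
  · intro heq
    apply h
    have hsub : UV.compression {v} {w} S ⊆ S := by
      intro A hA
      rw [UV.mem_compression] at hA
      rcases hA with hA | ⟨hA, B, hB, rfl⟩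
      · exact hA.1
      · by_cases hv : v ∈ B
        · rwa [compress_singleton_of_mem_left hv]
        by_cases hw : w ∈ B
        · have hcm := UV.compress_mem_compression (u := {v}) (v := {w}) hB
          rw [compress_singleton_of_mem hvw hv hw] at hcm ⊢
          have : B.erase w ∈ (UV.compression {v} {w} S).memberSubfamily v :=
            Finset.mem_memberSubfamily.2 ⟨hcm, fun h => hv (Finset.mem_of_mem_erase h)⟩
          rw [← heq] at this
          exact (Finset.mem_memberSubfamily.1 this).1
        · rwa [compress_singleton_of_notMem hw]
    exact Finset.eq_of_subset_of_card_le hsub (by rw [UV.card_compression])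

lemma memberSubfamily_shadow (v : α) (G : Finset (Finset α)) :
    (∂ G).memberSubfamily v = ∂ (G.memberSubfamily v) := by
  ext t
  simp only [Finset.mem_memberSubfamily, Finset.mem_shadow_iff_insert_mem]
  constructor
  · rintro ⟨⟨a, ha, haG⟩, hv⟩
    rw [Finset.mem_insert, not_or] at ha
    refine ⟨a, ha.2, by rwa [Finset.insert_comm], ?_⟩
    simp [hv, Ne.symm ha.1]
  · rintro ⟨a, ha, haG, hv⟩
    rw [Finset.mem_insert, not_or] at hv
    refine ⟨⟨a, ?_, by rwa [Finset.insert_comm]⟩, hv.2⟩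
    simp [ha, Ne.symm hv.1]

/-- The family `G` contains every `A - x + v` with `x ∈ A ∈ G` and `v ∉ A`. -/
def IsShiftedTo (v : α) (G : Finset (Finset α)) : Prop :=
  ∂ (G.nonMemberSubfamily v) ⊆ G.memberSubfamily v

lemma nonMemberSubfamily_shadow {v : α} {G : Finset (Finset α)} (h : IsShiftedTo v G) :
    (∂ G).nonMemberSubfamily v = G.memberSubfamily v := by
  ext t
  simp only [Finset.mem_nonMemberSubfamily, Finset.mem_memberSubfamily]
  constructor
  · rintro ⟨ht, hv⟩
    obtain ⟨a, ha, haG⟩ := Finset.mem_shadow_iff_insert_mem.1 ht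
    by_cases hav : a = v
    · exact ⟨hav ▸ haG, hv⟩
    · refine Finset.mem_memberSubfamily.1 (h ?_)
      refine Finset.mem_shadow_iff_insert_mem.2 ⟨a, ha, ?_⟩
      rw [Finset.mem_nonMemberSubfamily]
      exact ⟨haG, by simp [hv, Ne.symm hav]⟩
  · rintro ⟨h', hv⟩
    exact ⟨Finset.mem_shadow_iff_insert_mem.2 ⟨v, hv, h'⟩, hv⟩

lemma IsShiftedTo.shadow {v : α} {G : Finset (Finset α)} (h : IsShiftedTo v G) :
    IsShiftedTo v (∂ G) := by
  unfold IsShiftedTo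
  rw [nonMemberSubfamily_shadow h, memberSubfamily_shadow]

lemma IsShiftedTo.card_shadow {v : α} {G : Finset (Finset α)} (h : IsShiftedTo v G) :
    (∂ G).card = (∂ (G.memberSubfamily v)).card + (G.memberSubfamily v).card := by
  rw [← Finset.card_memberSubfamily_add_card_nonMemberSubfamily v (∂ G),
    memberSubfamily_shadow, nonMemberSubfamily_shadow h]

lemma isShiftedTo_of_compression_eq {v : α} {S : Finset (Finset α)}
    (h : ∀ w, w ≠ v → UV.compression {v} {w} S = S) : IsShiftedTo v S := by
  intro t ht
  obtain ⟨a, ha, haS⟩ := Finset.mem_shadow_iff_insert_mem.1 ht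
  rw [Finset.mem_nonMemberSubfamily, Finset.mem_insert, not_or] at haS
  have hcm := UV.compress_mem_compression (u := {v}) (v := {a}) haS.1
  rw [h a (Ne.symm haS.2.1), compress_singleton_of_mem haS.2.1 (by simp [haS.2])
    (Finset.mem_insert_self _ _), Finset.erase_insert ha] at hcm
  exact Finset.mem_memberSubfamily.2 ⟨hcm, haS.2.2⟩

/-- If the compressed family `S'` has the same shadow size as `S` and any two `(k+2)`-faces of `S'`
have a common extension point, then compression does not shrink the second shadow. -/
lemma card_shadow_shadow_le_of_compression {v w : α} (hvw : v ≠ w) {S : Finset (Finset α)} {k : ℕ}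
    (hS : (S : Set (Finset α)).Sized (k + 3))
    (hcard : (∂ S).card ≤ (∂ (UV.compression {v} {w} S)).card)
    (hext : ∀ f ∈ ∂ (UV.compression {v} {w} S), ∀ f' ∈ ∂ (UV.compression {v} {w} S),
      ∃ z, z ∉ f ∧ z ∉ f' ∧ insert z f ∈ UV.compression {v} {w} S ∧
        insert z f' ∈ UV.compression {v} {w} S) :
    (∂ (∂ S)).card ≤ (∂ (∂ (UV.compression {v} {w} S))).card := by
  set S' := UV.compression {v} {w} S with hS'
  have hS'k : (S' : Set (Finset α)).Sized (k + 3) := hS.uvCompression (by simp)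
  have hshadow : ∂ S' = UV.compression {v} {w} (∂ S) :=
    Finset.eq_of_subset_of_card_le (shadow_compression_singleton_subset v w S)
      (by rw [UV.card_compression]; exact hcard)
  have hmemv : ∀ A ∈ S, v ∈ A → A ∈ S' := fun A hA hv =>
    mem_compression_of_compress_eq hA (compress_singleton_of_mem_left hv)
  have hmemw : ∀ A ∈ S, w ∉ A → A ∈ S' := fun A hA hw =>
    mem_compression_of_compress_eq hA (compress_singleton_of_notMem hw)
  have hcomp : ∀ A ∈ S, v ∉ A → w ∈ A → insert v (A.erase w) ∈ S' := by
    intro A hA hv hw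
    rw [← compress_singleton_of_mem hvw hv hw]
    exact UV.compress_mem_compression hA
  have hsub : ∀ {D q : Finset α}, D ∈ S' → q ⊆ D → q.card = k + 1 → q ∈ ∂ (∂ S') := by
    intro D q hD hq hqc
    have h2 : (∂ S' : Set (Finset α)).Sized (k + 1 + 1) := hS'k.shadow
    obtain ⟨f, hqf, hfD, hfc⟩ := Finset.exists_subsuperset_card_eq hq
      (show q.card ≤ k + 2 by omega) (by rw [hS'k hD]; omega)
    exact mem_shadow_of_subset h2 (mem_shadow_of_subset (r := k + 2) hS'k hD hfD hfc) hqf hqc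
  have hsup : ∀ {q : Finset α}, q ∈ ∂ (∂ S) → q.card = k + 1 ∧ ∃ A ∈ S, q ⊆ A := by
    intro q hq
    have h2 : (∂ (∂ S) : Set (Finset α)).Sized (k + 1) := hS.shadow.shadow
    obtain ⟨f, hf, hqf⟩ := Finset.exists_subset_of_mem_shadow hq
    obtain ⟨A, hA, hfA⟩ := Finset.exists_subset_of_mem_shadow hf
    exact ⟨h2 hq, A, hA, hqf.trans hfA⟩
  rw [← UV.card_compression {v} {w} (∂ (∂ S))]
  refine Finset.card_le_card ?_
  intro q hq
  rw [UV.mem_compression] at hq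
  rcases hq with ⟨hq, hq'⟩ | ⟨hq, q₀, hq₀, rfl⟩
  · obtain ⟨hqc, A, hA, hqA⟩ := hsup hq
    by_cases hvq : v ∈ q
    · exact hsub (hmemv A hA (hqA hvq)) hqA hqc
    by_cases hwq : w ∈ q
    swap
    · by_cases hAv : v ∈ A
      · exact hsub (hmemv A hA hAv) hqA hqc
      by_cases hAw : w ∈ A
      · refine hsub (hcomp A hA hAv hAw) (fun x hx => ?_) hqc
        exact Finset.mem_insert_of_mem (Finset.mem_erase.2 ⟨fun h => hwq (h ▸ hx), hqA hx⟩)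
      · exact hsub (hmemw A hA hAw) hqA hqc
    -- The remaining case: `q = p ∪ {w}` and `p ∪ {v}` both lie in the second shadow of `S`.
    rw [compress_singleton_of_mem hvw hvq hwq] at hq'
    obtain ⟨hrc, B, hB, hrB⟩ := hsup hq'
    by_contra hcon
    have hno : ∀ D ∈ S', ¬ q ⊆ D := fun D hD h => hcon (hsub hD h hqc)
    set r := insert v (q.erase w) with hr
    have hvr : v ∈ r := Finset.mem_insert_self _ _
    have hqr : ∀ {D : Finset α}, r ⊆ D → w ∈ D → q ⊆ D := by
      intro D hD hw x hx
      by_cases hxw : x = w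
      · exact hxw ▸ hw
      · exact hD (Finset.mem_insert_of_mem (Finset.mem_erase.2 ⟨hxw, hx⟩))
    have hAv : v ∉ A := fun h => hno A (hmemv A hA h) hqA
    have hBS' : B ∈ S' := hmemv B hB (hrB hvr)
    have hBw : w ∉ B := fun h => hno B hBS' (hqr hrB h)
    -- No point extends both `p ∪ {v}` and `p ∪ {w}` to members of `∂ S`, as otherwise the latter
    -- extension would survive the compression of `∂ S`.
    have hx : ∀ x, x ≠ v → x ≠ w → insert x q ∈ ∂ S → insert x r ∈ ∂ S → False := by
      intro x hxv hxw h1 h2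
      have h3 : insert x q ∈ ∂ S' := by
        rw [hshadow, UV.mem_compression]
        refine Or.inl ⟨h1, ?_⟩
        rw [compress_singleton_of_mem hvw (by simp [hvq, Ne.symm hxv]) (by simp [hwq]),
          Finset.erase_insert_of_ne hxw, Finset.insert_comm]
        exact h2
      obtain ⟨D, hD, hD'⟩ := Finset.exists_subset_of_mem_shadow h3
      exact hno D hD ((Finset.subset_insert _ _).trans hD')
    have hface : ∀ {x : α} {u D : Finset α}, D ∈ S → u.card = k + 1 → x ∉ u → x ∈ D → u ⊆ D →
        insert x u ∈ ∂ S := by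
      intro x u D hD huc hxu hxD huD
      exact mem_shadow_of_subset (r := k + 2) hS hD (Finset.insert_subset hxD huD)
        (by rw [Finset.card_insert_of_notMem hxu, huc])
    have hface' : ∀ {x : α} {u D : Finset α}, D ∈ S' → u.card = k + 1 → x ∉ u → x ∈ D → u ⊆ D →
        insert x u ∈ ∂ S' := by
      intro x u D hD huc hxu hxD huD
      exact mem_shadow_of_subset (r := k + 2) hS'k hD (Finset.insert_subset hxD huD)
        (by rw [Finset.card_insert_of_notMem hxu, huc])
    obtain ⟨x, hxA, hxq⟩ := Finset.exists_mem_notMem_of_card_lt_card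
      (show q.card < A.card by rw [hqc, hS hA]; omega)
    obtain ⟨y, hyB, hyr⟩ := Finset.exists_mem_notMem_of_card_lt_card
      (show r.card < B.card by rw [hrc, hS hB]; omega)
    have hxv : x ≠ v := fun h => hAv (h ▸ hxA)
    have hxw : x ≠ w := fun h => hxq (h ▸ hwq)
    have hyv : y ≠ v := fun h => hyr (h ▸ hvr)
    have hyw : y ≠ w := fun h => hBw (h ▸ hyB)
    have hmemr : ∀ {z : α}, z ≠ v → z ≠ w → (z ∈ r ↔ z ∈ q) := by
      intro z hzv hzw
      simp [hr, hzv, hzw]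
    have hxr : x ∉ r := fun h => hxq ((hmemr hxv hxw).1 h)
    have hyq : y ∉ q := fun h => hyr ((hmemr hyv hyw).2 h)
    have hxqS : insert x q ∈ ∂ S := hface hA hqc hxq hxA hqA
    have hyrS : insert y r ∈ ∂ S := hface hB hrc hyr hyB hrB
    have hAw : w ∈ A := hqA hwq
    have hfx : insert x r ∈ ∂ S' := by
      refine hface' (hcomp A hA hAv hAw) hrc hxr ?_ ?_
      · exact Finset.mem_insert_of_mem (Finset.mem_erase.2 ⟨hxw, hxA⟩)
      · exact Finset.insert_subset_insert _ (Finset.erase_subset_erase _ hqA)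
    have hfy : insert y r ∈ ∂ S' := hface' hBS' hrc hyr hyB hrB
    obtain ⟨z, hzx, hzy, hD1, hD2⟩ := hext _ hfx _ hfy
    simp only [Finset.mem_insert, not_or] at hzx hzy
    have hzv : z ≠ v := fun h => hzx.2 (h ▸ hvr)
    have hrD : ∀ a, r ⊆ insert z (insert a r) := fun a =>
      (Finset.subset_insert _ _).trans (Finset.subset_insert _ _)
    have hwD : ∀ a, insert z (insert a r) ∈ S' → w ∉ insert z (insert a r) :=
      fun a ha h => hno _ ha (hqr (hrD a) h)
    have hzw : z ≠ w := fun h => hwD x hD1 (by simp [h])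
    have hzq : z ∉ q := fun h => hzx.2 ((hmemr hzv hzw).2 h)
    -- A member of `S'` over `r` lies in `S` or comes from one of `S` over `q`.
    have hcase : ∀ a, insert z (insert a r) ∈ S' → insert z (insert a r) ∈ S ∨
        ∃ b ∈ S, q ⊆ b ∧ ∀ c, c ∈ insert z (insert a r) → c ≠ v → c ∈ b := by
      intro a ha
      rcases UV.mem_compression.1 ha with h | ⟨h, b, hb, hbe⟩
      · exact Or.inl h.1
      · right
        have hne : UV.compress {v} {w} b ≠ b := fun h' => h (by rw [← hbe, h']; exact hb)
        have hvb : v ∉ b := fun h' => hne (compress_singleton_of_mem_left h')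
        have hwb : w ∈ b := by
          by_contra h'
          exact hne (compress_singleton_of_notMem h')
        rw [compress_singleton_of_mem hvw hvb hwb] at hbe
        have hc : ∀ c, c ∈ insert z (insert a r) → c ≠ v → c ∈ b := by
          intro c hc hcv
          rw [← hbe] at hc
          exact Finset.mem_of_mem_erase ((Finset.mem_insert.1 hc).resolve_left hcv)
        refine ⟨b, hb, fun c hcq => ?_, hc⟩
        by_cases hcw : c = w
        · exact hcw ▸ hwb
        have hcv : c ≠ v := fun h => hvq (h ▸ hcq)
        exact hc c (hrD a ((hmemr hcv hcw).2 hcq)) hcv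
    rcases hcase x hD1 with h1 | ⟨b, hb, hqb, hb'⟩
    · exact hx x hxv hxw hxqS (hface h1 hrc hxr (by simp) (hrD x))
    rcases hcase y hD2 with h2 | ⟨b', hb'', hqb', hb'''⟩
    · exact hx z hzv hzw (hface hb hqc hzq (hb' z (by simp) hzv) hqb)
        (hface h2 hrc hzx.2 (by simp) (hrD y))
    · exact hx y hyv hyw (hface hb'' hqc hyq (hb''' y (by simp) hyv) hqb') hyrS
  · obtain ⟨hqc, A, hA, hqA⟩ := hsup hq₀
    have hne : UV.compress {v} {w} q₀ ≠ q₀ := fun h' => hq (by rw [h']; exact hq₀)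
    have hvq : v ∉ q₀ := fun h' => hne (compress_singleton_of_mem_left h')
    have hwq : w ∈ q₀ := by
      by_contra h'
      exact hne (compress_singleton_of_notMem h')
    rw [compress_singleton_of_mem hvw hvq hwq] at hq ⊢
    have hc : (insert v (q₀.erase w)).card = k + 1 := by
      rw [Finset.card_insert_of_notMem (fun h => hvq (Finset.mem_of_mem_erase h)),
        Finset.card_erase_of_mem hwq, hqc]
      rfl
    by_cases hAv : v ∈ A
    · exact hsub (hmemv A hA hAv)
        (Finset.insert_subset hAv ((Finset.erase_subset _ _).trans hqA)) hc
    · exact hsub (hcomp A hA hAv (hqA hwq))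
        (Finset.insert_subset_insert _ (Finset.erase_subset_erase _ hqA)) hc

lemma Set.Sized.memberSubfamily {S : Finset (Finset α)} {k : ℕ}
    (hS : (S : Set (Finset α)).Sized (k + 1)) (v : α) :
    (S.memberSubfamily v : Set (Finset α)).Sized k := by
  intro t ht
  obtain ⟨h1, h2⟩ := Finset.mem_memberSubfamily.1 (Finset.mem_coe.1 ht)
  have := hS h1
  rw [Finset.card_insert_of_notMem h2] at this
  omega

end Compression

section IteratedShadow

variable {α : Type*} [DecidableEq α] [Fintype α]

/-- Kruskal-Katona for the prescribed sizes. -/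
lemma faceCount_le_card_shadow {τ : ℕ → ℕ} (hτ : StrictMono τ) {n k : ℕ} (hn : τ k + k + 1 ≤ n)
    {S : Finset (Finset α)} (hS : (S : Set (Finset α)).Sized (k + 1))
    (h : faceCount τ n (k + 1) ≤ S.card) : faceCount τ n k ≤ (∂ S).card := by
  refine cascade_le_card_shadow hS (c := coeff τ n) (fun i j hij hj => ?_) h
  have := hτ.monotone (show j ≤ k by omega)
  have := coeff_lt_coeff hτ hij (n := n) (by omega)
  omega

/-- A family all of whose faces have the prescribed number has few hyperedges, so that every face
of size `k` has all but a bounded number of possible extensions; two of them share one. -/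
lemma exists_common_extension {τ : ℕ → ℕ} (hτ : StrictMono τ) {n k : ℕ}
    (hn : 2 * τ k + 2 * k + 1 ≤ n) {S : Finset (Finset α)}
    (hS : (S : Set (Finset α)).Sized (k + 1))
    (h : ∀ j ≤ k + 1, (faces S j).card = faceCount τ n j) {f f' : Finset α} (hf : f ∈ ∂ S)
    (hf' : f' ∈ ∂ S) : ∃ z, z ∉ f ∧ z ∉ f' ∧ insert z f ∈ S ∧ insert z f' ∈ S := by
  have hτ0 := hτ.monotone (Nat.zero_le k)
  set V : Finset α := Finset.univ.filter (fun y => IsFace S {y}) with hV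
  have hVcard : V.card = n - τ 0 := by
    rw [← faceCount_one (τ := τ) (n := n) (by omega), ← h 1 (by omega),
      ← Finset.card_image_of_injective V Finset.singleton_injective]
    congr 1
    ext e
    simp only [hV, Finset.mem_image, Finset.mem_filter, Finset.mem_univ, true_and, mem_faces,
      Finset.card_eq_one]
    constructor
    · rintro ⟨y, hy, rfl⟩
      exact ⟨⟨y, rfl⟩, hy⟩
    · rintro ⟨⟨y, rfl⟩, hy⟩
      exact ⟨y, hy, rfl⟩
  have hsum := sum_card_minNonfaces_le hτ (n := n) (m := k) (by omega) h
  set R : Finset (Finset α) := (Finset.range k).biUnion (fun i => minNonfaces S (i + 2)) with hR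
  have hRcard : R.card ≤ τ k - τ 0 := by
    have : R.card ≤ ∑ i ∈ Finset.range k, (minNonfaces S (i + 2)).card := Finset.card_biUnion_le
    omega
  -- At most `|R|` points are lost to hyperedges, and `k` to the face itself.
  have key : ∀ g ∈ ∂ S,
      (V.filter (fun z => ¬ (z ∉ g ∧ insert z g ∈ S))).card ≤ k + (τ k - τ 0) := by
    intro g hg
    have hgk : g.card = k := hS.shadow hg
    have hgF : IsFace S g := by
      obtain ⟨s, hs, hgs⟩ := Finset.exists_subset_of_mem_shadow hg
      exact ⟨s, hs, hgs⟩
    set B := V.filter (fun z => z ∉ g ∧ insert z g ∉ S) with hB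
    have hBcard : B.card ≤ R.card := by
      refine (card_le_card_filter_sdiff (R := R) (e := g) ?_).trans (Finset.card_filter_le _ _)
      intro y hy
      simp only [hB, hV, Finset.mem_filter, Finset.mem_univ, true_and] at hy
      obtain ⟨hyF, hyg, hyS⟩ := hy
      have hc : (insert y g).card = k + 1 := by rw [Finset.card_insert_of_notMem hyg, hgk]
      obtain ⟨e, heg, he, hey⟩ := exists_minNonface_sdiff_eq hgF hyg
        (fun ⟨s, hs, hsub⟩ => hyS (by
          rwa [Finset.eq_of_subset_of_card_le hsub (by rw [hS hs, hc])]))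
      refine ⟨e, ?_, hey⟩
      have hle : e.card ≤ k + 1 := hc ▸ Finset.card_le_card heg
      have hye : {y} ⊆ e := by
        rw [← hey]
        exact Finset.sdiff_subset
      have h1 : 1 ≤ e.card := Finset.card_le_card hye
      have h2 : e.card ≠ 1 := by
        intro h2
        have : {y} = e := Finset.eq_of_subset_of_card_le hye (by simp [h2])
        exact (mem_minNonfaces.1 he).2.2 (this ▸ hyF)
      exact Finset.mem_biUnion.2 ⟨e.card - 2, Finset.mem_range.2 (by omega),
        by rwa [show e.card - 2 + 2 = e.card by omega]⟩
    have hsplit : V.filter (fun z => ¬ (z ∉ g ∧ insert z g ∈ S)) ⊆ g ∪ B := by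
      intro z hz
      simp only [hB, Finset.mem_filter, Finset.mem_union] at hz ⊢
      tauto
    have := (Finset.card_le_card hsplit).trans (Finset.card_union_le _ _)
    omega
  by_contra! hcon
  have hcover : V ⊆ V.filter (fun z => ¬ (z ∉ f ∧ insert z f ∈ S)) ∪
      V.filter (fun z => ¬ (z ∉ f' ∧ insert z f' ∈ S)) := by
    intro z hz
    have := hcon z
    simp only [Finset.mem_union, Finset.mem_filter]
    tauto
  have h1 := (Finset.card_le_card hcover).trans (Finset.card_union_le _ _)
  have h2 := key f hf
  have h3 := key f' hf'
  omega

/-- In an extremal family shifted towards `v`, the link of `v` is extremal. -/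
lemma IsShiftedTo.card_link {τ : ℕ → ℕ} (hτ : StrictMono τ) {n k : ℕ}
    (hn : τ (k + 1) + k + 2 ≤ n) {S : Finset (Finset α)}
    (hS : (S : Set (Finset α)).Sized (k + 2)) {v : α} (hv : IsShiftedTo v S)
    (h1 : S.card = faceCount τ (n + 1) (k + 2)) (h2 : (∂ S).card = faceCount τ (n + 1) (k + 1)) :
    (S.memberSubfamily v).card = faceCount τ n (k + 1) ∧
      (∂ (S.memberSubfamily v)).card = faceCount τ n k := by
  have hτk := hτ (show k < k + 1 by omega)
  have hsplit := Finset.card_memberSubfamily_add_card_nonMemberSubfamily v S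
  have hp1 := faceCount_pascal hτ (n := n) (j := k + 1) (by omega)
  have hp2 := faceCount_pascal hτ (n := n) (j := k) (by omega)
  have hge : faceCount τ n (k + 1) ≤ (S.memberSubfamily v).card := by
    by_contra! hlt
    have hS0 : (S.nonMemberSubfamily v : Set (Finset α)).Sized (k + 2) := by
      intro t ht
      exact hS (Finset.mem_nonMemberSubfamily.1 (Finset.mem_coe.1 ht)).1
    have h3 := faceCount_le_card_shadow hτ (n := n) (k := k + 1) (by omega) hS0 (by
      show faceCount τ n (k + 1 + 1) ≤ _
      have : faceCount τ (n + 1) (k + 2) = faceCount τ (n + 1) (k + 1 + 1) := rfl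
      omega)
    have h4 := Finset.card_le_card hv
    omega
  have hge' := faceCount_le_card_shadow hτ (n := n) (k := k) (by omega)
    (Set.Sized.memberSubfamily (k := k + 1) hS v) hge
  have h3 := hv.card_shadow
  omega

/-- **Iterated shadows of extremal families are extremal.**  If `S` has the prescribed size and
the least possible shadow, then all its iterated shadows have the least possible size. -/
theorem card_faces_eq_faceCount {τ : ℕ → ℕ} (hτ : StrictMono τ) (k : ℕ) :
    ∀ (n : ℕ), 2 * τ (k + 1) + 2 * k + 3 ≤ n → ∀ S : Finset (Finset α),
      (S : Set (Finset α)).Sized (k + 1) → S.card = faceCount τ n (k + 1) →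
      (∂ S).card = faceCount τ n k → ∀ j ≤ k + 1, (faces S j).card = faceCount τ n j := by
  induction k with
  | zero =>
    intro n hn S hS h1 h2 j hj
    rcases Nat.lt_or_ge j 1 with h | h
    · rw [show j = 0 by omega, faces_eq_shadow hS, h2]
    · rw [show j = 0 + 1 by omega, faces_of_sized hS, h1]
  | succ k ih =>
    intro n hn S hS h1 h2
    have hτk1 := hτ (show k < k + 1 by omega)
    have hτk := hτ (show k + 1 < k + 1 + 1 by omega)
    -- It suffices to treat the second shadow, as then `∂ S` is extremal again.
    suffices h3 : (∂ (∂ S)).card = faceCount τ n k by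
      intro j hj
      rcases Nat.lt_or_ge j (k + 2) with h | h
      · rw [← faces_shadow hS (by omega)]
        exact ih n (by omega) (∂ S) hS.shadow h2 h3 j (by omega)
      · rw [show j = k + 1 + 1 by omega, faces_of_sized hS, h1]
    rcases k with _ | k
    · have hne : (∂ S).Nonempty := by
        rw [← Finset.card_pos, h2]
        exact faceCount_pos _ _ _
      have hs1 : (∂ S : Set (Finset α)).Sized 1 := hS.shadow
      rw [faceCount_zero, Finset.card_eq_one]
      refine ⟨∅, ?_⟩
      ext t
      rw [Finset.mem_singleton]
      constructor
      · intro ht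
        have := hs1.shadow ht
        simpa using this
      · rintro rfl
        obtain ⟨e, he⟩ := hne
        exact mem_shadow_of_subset (r := 0) hs1 he (Finset.empty_subset _) rfl
    obtain ⟨v⟩ : Nonempty α := by
      have hne : S.Nonempty := by
        rw [← Finset.card_pos, h1]
        exact faceCount_pos _ _ _
      obtain ⟨s, hs⟩ := hne
      have : s.Nonempty := by
        rw [← Finset.card_pos, hS hs]
        omega
      exact ⟨this.choose⟩
    -- Compress towards `v`, by induction on how far the degree of `v` can still grow.
    induction hm : S.card - (S.memberSubfamily v).card using Nat.strong_induction_on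
      generalizing S with
    | _ m ihm =>
      by_cases hst : ∀ w, w ≠ v → UV.compression {v} {w} S = S
      · have hsh := isShiftedTo_of_compression_eq hst
        obtain ⟨n, rfl⟩ : ∃ n', n = n' + 1 := ⟨n - 1, by omega⟩
        obtain ⟨h4, h5⟩ := hsh.card_link hτ (n := n) (k := k + 1) (by omega) hS h1 h2
        have h6 := ih n (by omega) (S.memberSubfamily v)
          (Set.Sized.memberSubfamily (k := k + 2) hS v) h4 h5 k (by omega)
        have hs1 : (S.memberSubfamily v : Set (Finset α)).Sized (k + 1 + 1) :=
          Set.Sized.memberSubfamily (k := k + 2) hS v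
        rw [← faces_shadow hs1 (by omega), faces_eq_shadow hs1.shadow] at h6
        rw [hsh.shadow.card_shadow, memberSubfamily_shadow, h6, h5,
          faceCount_pascal hτ (n := n) (j := k) (by have := hτ (show k < k + 1 by omega); omega)]
        ring
      · push Not at hst
        obtain ⟨w, hwv, hw⟩ := hst
        set S' := UV.compression {v} {w} S with hS'
        have hS'k : (S' : Set (Finset α)).Sized (k + 1 + 1 + 1) := hS.uvCompression (by simp)
        have hS'c : S'.card = S.card := UV.card_compression _ _ _
        have hlt := card_memberSubfamily_lt_of_compression_ne (Ne.symm hwv) hw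
        rw [← hS'] at hlt
        have hle : (S'.memberSubfamily v).card ≤ S'.card := by
          have := Finset.card_memberSubfamily_add_card_nonMemberSubfamily v S'
          omega
        have hS'1 := faceCount_le_card_shadow hτ (n := n) (k := k + 1 + 1) (by omega) hS'k
          (by omega)
        have hS'2 := card_shadow_compression_singleton_le v w S
        rw [← hS'] at hS'2
        have hS'3 : (∂ S').card = faceCount τ n (k + 1 + 1) := le_antisymm (by omega) hS'1
        have h4 := ihm _ (by rw [← hm]; omega) S' hS'k (by omega) hS'3 rfl
        have hfaces : ∀ j ≤ k + 1 + 1 + 1, (faces S' j).card = faceCount τ n j := by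
          intro j hj
          rcases Nat.lt_or_ge j (k + 3) with h | h
          · rw [← faces_shadow hS'k (by omega)]
            exact ih n (by omega) (∂ S') hS'k.shadow hS'3 h4 j (by omega)
          · rw [show j = k + 1 + 1 + 1 by omega, faces_of_sized hS'k, hS'c, h1]
        refine le_antisymm ?_ (faceCount_le_card_shadow hτ (n := n) (k := k + 1) (by omega)
          hS.shadow h2.ge)
        rw [← h4]
        exact card_shadow_shadow_le_of_compression (Ne.symm hwv) hS (by rw [hS'3, h2])
          (fun f hf f' hf' => exists_common_extension hτ (n := n) (k := k + 1 + 1) (by omega) hS'k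
            hfaces hf hf')

end IteratedShadow

/-! ### Counting the vertices of the hyperedges -/

section Overlap

variable {α β : Type*} [DecidableEq α] [DecidableEq β]

/-- Sets `e` of size `j` are added one at a time to a vertex set `V`, each contributing at most
`2 + σ e` vertices outside `V`; to each `e` belongs a set `A e`, where `A e` and `A e'` share
at most one point, and none unless `e` and `e'` share `j - 1` points.  A set sharing `j - 1` points
with an earlier one brings only one new vertex, so every excess in the number of vertices is paid
for by pairs (counted by `x`) that do not reduce the size of `⋃ e, A e`. -/
lemma exists_overlap_deficit (Q : Finset (Finset α)) (V : Finset α) (A : Finset α → Finset β)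
    (σ : Finset α → ℕ) (j : ℕ) (hj : ∀ e ∈ Q, e.card = j) (hν : ∀ e ∈ Q, (e \ V).card ≤ 2 + σ e)
    (hA1 : ∀ e ∈ Q, ∀ e' ∈ Q, e ≠ e' → (A e ∩ A e').card ≤ 1)
    (hA0 : ∀ e ∈ Q, ∀ e' ∈ Q, e ≠ e' → (e ∩ e').card + 1 ≠ j → (A e ∩ A e').card = 0) :
    ∃ x : ℕ, (V ∪ Q.biUnion id).card ≤ V.card + Q.card + 1 + ∑ e ∈ Q, σ e + x ∧
      ∑ e ∈ Q, (A e).card + x ≤ (Q.biUnion A).card + Q.card.choose 2 ∧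
      (x = 0 → ∀ e ∈ Q, ∀ e' ∈ Q, e ≠ e' → (e ∩ e').card + 1 = j) := by
  induction Q using Finset.induction_on with
  | empty => exact ⟨0, by simp⟩
  | insert e Q he ih =>
    obtain ⟨x, h1, h2, h3⟩ := ih (fun e' h => hj e' (Finset.mem_insert_of_mem h))
      (fun e' h => hν e' (Finset.mem_insert_of_mem h))
      (fun e' h e'' h' => hA1 e' (Finset.mem_insert_of_mem h) e'' (Finset.mem_insert_of_mem h'))
      (fun e' h e'' h' => hA0 e' (Finset.mem_insert_of_mem h) e'' (Finset.mem_insert_of_mem h'))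
    have heQ : ∀ e' ∈ Q, e ≠ e' := fun e' h h' => he (h' ▸ h)
    set N := Q.filter (fun e' => (e ∩ e').card + 1 ≠ j) with hN
    have hNQ : (Q.filter (fun e' => (e ∩ e').card + 1 = j)).card + N.card = Q.card :=
      Finset.card_filter_add_card_filter_not _
    refine ⟨x + N.card, ?_, ?_, ?_⟩
    · rw [Finset.biUnion_insert, Finset.card_insert_of_notMem he, Finset.sum_insert he]
      have hrw : V ∪ (id e ∪ Q.biUnion id) = (e \ (V ∪ Q.biUnion id)) ∪ (V ∪ Q.biUnion id) := by
        ext y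
        simp only [Finset.mem_union, Finset.mem_sdiff, id]
        tauto
      rw [hrw]
      have hle := Finset.card_union_le (e \ (V ∪ Q.biUnion id)) (V ∪ Q.biUnion id)
      by_cases hadj : ∃ e' ∈ Q, (e ∩ e').card + 1 = j
      · obtain ⟨e', he', hadj⟩ := hadj
        have hsub : e \ (V ∪ Q.biUnion id) ⊆ e \ e' := by
          refine Finset.sdiff_subset_sdiff Finset.Subset.rfl ?_
          exact (Finset.subset_biUnion_of_mem id he').trans Finset.subset_union_right
        have hc := Finset.card_le_card hsub
        have hc' := Finset.card_sdiff_add_card_inter e e'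
        rw [hj e (Finset.mem_insert_self _ _)] at hc'
        omega
      · push Not at hadj
        have hc : (e \ (V ∪ Q.biUnion id)).card ≤ 2 + σ e :=
          (Finset.card_le_card (Finset.sdiff_subset_sdiff Finset.Subset.rfl
            Finset.subset_union_left)).trans (hν e (Finset.mem_insert_self _ _))
        rcases Finset.eq_empty_or_nonempty Q with rfl | hQ
        · have hcV : (e \ V).card ≤ 2 + σ e := hν e (Finset.mem_insert_self _ _)
          simp only [Finset.biUnion_empty, Finset.union_empty, Finset.card_empty,
            Finset.sum_empty] at hle ⊢
          omega
        · have hNe : N = Q := Finset.filter_true_of_mem hadj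
          have := hQ.card_pos
          rw [hNe]
          omega
    · rw [Finset.biUnion_insert, Finset.card_insert_of_notMem he, Finset.sum_insert he,
        succ_choose_two]
      have hu := Finset.card_union_add_card_inter (A e) (Q.biUnion A)
      have hi : (A e ∩ Q.biUnion A).card ≤ (Q.filter (fun e' => (e ∩ e').card + 1 = j)).card := by
        rw [Finset.inter_biUnion]
        refine Finset.card_biUnion_le.trans ?_
        rw [Finset.card_filter]
        refine Finset.sum_le_sum fun e' he' => ?_
        split_ifs with h
        · exact hA1 e (Finset.mem_insert_self _ _) e' (Finset.mem_insert_of_mem he') (heQ e' he')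
        · exact (hA0 e (Finset.mem_insert_self _ _) e' (Finset.mem_insert_of_mem he')
            (heQ e' he') h).le
      omega
    · intro hx
      have hx0 : x = 0 := by omega
      have hN0 : N = ∅ := Finset.card_eq_zero.1 (by omega)
      have hadj : ∀ e' ∈ Q, (e ∩ e').card + 1 = j := by
        intro e' he'
        by_contra h
        have : e' ∈ N := Finset.mem_filter.2 ⟨he', h⟩
        simp [hN0] at this
      intro e₁ h₁ e₂ h₂ hne
      rcases Finset.mem_insert.1 h₁ with h₁' | h₁' <;> rcases Finset.mem_insert.1 h₂ with h₂' | h₂'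
      · exact absurd (h₁'.trans h₂'.symm) hne
      · exact h₁' ▸ hadj e₂ h₂'
      · rw [Finset.inter_comm]
        exact h₂' ▸ hadj e₁ h₁'
      · exact h3 hx0 e₁ h₁' e₂ h₂' hne

end Overlap

lemma choose_two_add_add (b m : ℕ) :
    (b + 1 + m).choose 2 + m.choose 2 = b.choose 2 + (m + 1) * b + m * m := by
  have hsq : ∀ p : ℕ, 2 * (p.choose 2) + p = p * p := by
    intro p
    induction p with
    | zero => rfl
    | succ p ih =>
      rw [succ_choose_two]
      linarith
  have h1 := hsq (b + 1 + m)
  have h2 := hsq m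
  have h3 := hsq b
  linarith

section Hyperedges

variable {α : Type*} [DecidableEq α] [Fintype α]

/-- The minimal nonfaces of size less than `j`. -/
def lowNonfaces (S : Finset (Finset α)) (j : ℕ) : Finset (Finset α) :=
  (Finset.range j).biUnion (minNonfaces S)

/-- The vertices lying in some minimal nonface of size less than `j`. -/
def lowVertices (S : Finset (Finset α)) (j : ℕ) : Finset α := (lowNonfaces S j).biUnion id

/-- How far the number of hyperedges of size `i + 2` falls short of `τ (i + 1) - τ i`, its value for
an initial segment of the colex order. -/
def loss (τ : ℕ → ℕ) (S : Finset (Finset α)) (i : ℕ) : ℕ :=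
  τ (i + 1) - τ i - (minNonfaces S (i + 2)).card

/-- For a hyperedge `e` of size `i + 2`: the losses in smaller sizes, plus the number of smaller
hyperedges that are not contained in `e` up to a single point.  It bounds from below the number of
additional `(i+3)`-sets that `e` destroys, compared with the colex order. -/
def excess (τ : ℕ → ℕ) (S : Finset (Finset α)) (i : ℕ) (e : Finset α) : ℕ :=
  ∑ r ∈ Finset.range i,
    (loss τ S r + ((minNonfaces S (r + 2)).filter (fun g => (g \ e).card ≠ 1)).card)

lemma mem_lowNonfaces {S : Finset (Finset α)} {j : ℕ} {g : Finset α} :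
    g ∈ lowNonfaces S j ↔ g.card < j ∧ g ∈ minNonfaces S g.card := by
  simp only [lowNonfaces, Finset.mem_biUnion, Finset.mem_range]
  constructor
  · rintro ⟨i, hi, hg⟩
    have := (mem_minNonfaces.1 hg).1
    subst this
    exact ⟨hi, hg⟩
  · exact fun h => ⟨_, h.1, h.2⟩

lemma lowVertices_succ (S : Finset (Finset α)) (j : ℕ) :
    lowVertices S (j + 1) = lowVertices S j ∪ (minNonfaces S j).biUnion id := by
  unfold lowVertices lowNonfaces
  rw [Finset.range_add_one, Finset.biUnion_insert, Finset.union_comm, Finset.union_biUnion]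

lemma subset_lowVertices {S : Finset (Finset α)} {i j : ℕ} (hij : i < j) {g : Finset α}
    (hg : g ∈ minNonfaces S i) : g ⊆ lowVertices S j := by
  refine Finset.subset_biUnion_of_mem id ?_
  have := (mem_minNonfaces.1 hg).1
  subst this
  exact mem_lowNonfaces.2 ⟨hij, hg⟩

lemma card_lowNonfaces (S : Finset (Finset α)) (j : ℕ) :
    (lowNonfaces S j).card = ∑ i ∈ Finset.range j, (minNonfaces S i).card := by
  refine Finset.card_biUnion fun i _ i' _ h => ?_
  rw [Function.onFun, Finset.disjoint_left]
  intro e he he'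
  exact h ((mem_minNonfaces.1 he).1.symm.trans (mem_minNonfaces.1 he').1)

/-- The standing assumption: all faces of size at most `K` have the prescribed number, where the
parameter `n` is the size of the ground set. -/
structure IsFaceExtremal (τ : ℕ → ℕ) (S : Finset (Finset α)) (K : ℕ) : Prop where
  strictMono : StrictMono τ
  large : 2 * τ K + 2 * K + 3 ≤ Fintype.card α
  card_faces : ∀ j ≤ K, (faces S j).card = faceCount τ (Fintype.card α) j

namespace IsFaceExtremal

variable {τ : ℕ → ℕ} {S : Finset (Finset α)} {K : ℕ}

lemma tau_le (h : IsFaceExtremal τ S K) {i : ℕ} (hi : i ≤ K) :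
    τ i + i + 3 ≤ Fintype.card α := by
  have := h.strictMono.monotone hi
  have := h.large
  omega

lemma isFace_empty (h : IsFaceExtremal τ S K) : IsFace S ∅ := by
  have h0 := h.card_faces 0 (Nat.zero_le _)
  rw [faceCount_zero] at h0
  obtain ⟨e, he⟩ := Finset.card_pos.1 (by omega : 0 < (faces S 0).card)
  exact (mem_faces.1 he).2.mono (Finset.empty_subset _)

lemma minNonfaces_zero (h : IsFaceExtremal τ S K) : minNonfaces S 0 = ∅ := by
  rw [Finset.eq_empty_iff_forall_notMem]
  intro e he
  obtain ⟨h0, -, h2⟩ := mem_minNonfaces.1 he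
  rw [Finset.card_eq_zero.1 h0] at h2
  exact h2 h.isFace_empty

lemma card_minNonfaces_one (h : IsFaceExtremal τ S K) (hK : 1 ≤ K) :
    (minNonfaces S 1).card = τ 0 := by
  have h1 := card_faces_add_card_minNonfaces S 1
  have h2 := h.tau_le (Nat.zero_le K)
  have h3 : (cliques S 1).card = Fintype.card α := by
    have himg : cliques S 1 = (Finset.univ : Finset α).image singleton := by
      ext e
      simp only [mem_cliques, Finset.mem_image, Finset.mem_univ, true_and, Finset.card_eq_one]
      constructor
      · rintro ⟨⟨y, rfl⟩, -⟩
        exact ⟨y, rfl⟩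
      · rintro ⟨y, rfl⟩
        refine ⟨⟨y, rfl⟩, fun x hx => h.isFace_empty.mono ?_⟩
        rw [Finset.mem_singleton.1 hx]
        simp
    rw [himg, Finset.card_image_of_injective _ Finset.singleton_injective, Finset.card_univ]
  rw [h.card_faces 1 hK, faceCount_one (by omega), h3] at h1
  omega

lemma card_add_loss (h : IsFaceExtremal τ S K) {i : ℕ} (hi : i + 2 ≤ K) :
    (minNonfaces S (i + 2)).card + loss τ S i + τ i = τ (i + 1) := by
  have := card_minNonfaces_le h.strictMono (n := Fintype.card α) (i := i)
    (by have := h.tau_le (i := i + 1) (by omega); omega)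
    (h.card_faces _ (by omega)) (h.card_faces _ (by omega))
  unfold loss
  omega

lemma card_lowNonfaces_add (h : IsFaceExtremal τ S K) {i : ℕ} (hi : i + 1 ≤ K) :
    (lowNonfaces S (i + 2)).card + ∑ r ∈ Finset.range i, loss τ S r = τ i := by
  rw [card_lowNonfaces]
  induction i with
  | zero =>
    rw [Finset.sum_range_succ, Finset.sum_range_one, h.minNonfaces_zero,
      h.card_minNonfaces_one (by omega)]
    simp
  | succ i ih =>
    rw [Finset.sum_range_succ, Finset.sum_range_succ (loss τ S)]
    have := ih (by omega)
    have := h.card_add_loss (i := i) (by omega)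
    omega

/-- Each smaller hyperedge either is counted in `excess` or blocks at most one extension. -/
lemma card_filter_lowNonfaces_add_excess (h : IsFaceExtremal τ S K) {i : ℕ} (hi : i + 1 ≤ K)
    (e : Finset α) :
    ((lowNonfaces S (i + 2)).filter (fun g => (g \ e).card = 1)).card + excess τ S i e ≤ τ i := by
  have h1 := Finset.card_filter_add_card_filter_not (s := lowNonfaces S (i + 2))
    (fun g => (g \ e).card = 1)
  have h2 := h.card_lowNonfaces_add hi
  have h3 : ∑ r ∈ Finset.range i,
      ((minNonfaces S (r + 2)).filter (fun g => (g \ e).card ≠ 1)).card ≤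
      ((lowNonfaces S (i + 2)).filter (fun g => ¬ (g \ e).card = 1)).card := by
    rw [← Finset.card_biUnion]
    · refine Finset.card_le_card ?_
      intro g hg
      simp only [Finset.mem_biUnion, Finset.mem_range, Finset.mem_filter] at hg ⊢
      obtain ⟨r, hr, hg, hg'⟩ := hg
      have := (mem_minNonfaces.1 hg).1
      exact ⟨mem_lowNonfaces.2 ⟨by omega, by rwa [this]⟩, hg'⟩
    · intro r _ r' _ hrr
      rw [Function.onFun, Finset.disjoint_left]
      intro g hg hg'
      have h4 := (mem_minNonfaces.1 (Finset.mem_filter.1 hg).1).1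
      have h5 := (mem_minNonfaces.1 (Finset.mem_filter.1 hg').1).1
      omega
  unfold excess
  rw [Finset.sum_add_distrib]
  omega

/-- A hyperedge of size `i + 2` meets the smaller hyperedges in all but `2 + excess` points: a size
that contributes nothing to the excess has a hyperedge lying in `e` up to a single point. -/
lemma card_sdiff_lowVertices_le (h : IsFaceExtremal τ S K) {i : ℕ} (hi : i + 1 ≤ K)
    {e : Finset α} (he : e.card = i + 2) :
    (e \ lowVertices S (i + 2)).card ≤ 2 + excess τ S i e := by
  have key : ∀ m ≤ i, ∃ s ≤ m, s ≤ (e ∩ lowVertices S (i + 2)).card ∧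
      m ≤ s + excess τ S m e := by
    intro m
    induction m with
    | zero => exact fun _ => ⟨0, le_rfl, Nat.zero_le _, by omega⟩
    | succ m ih =>
      intro hm
      obtain ⟨s, hs1, hs2, hs3⟩ := ih (by omega)
      by_cases hz : loss τ S m +
          ((minNonfaces S (m + 2)).filter (fun g => (g \ e).card ≠ 1)).card = 0
      · have h1 := h.card_add_loss (i := m) (by omega)
        have h2 := h.strictMono (show m < m + 1 by omega)
        obtain ⟨g, hg⟩ := Finset.card_pos.1 (by omega : 0 < (minNonfaces S (m + 2)).card)
        have hge : (g \ e).card = 1 := by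
          by_contra hne
          have : g ∈ (minNonfaces S (m + 2)).filter (fun g => (g \ e).card ≠ 1) :=
            Finset.mem_filter.2 ⟨hg, hne⟩
          have := Finset.card_pos.2 ⟨g, this⟩
          omega
        have h3 := Finset.card_sdiff_add_card_inter g e
        rw [(mem_minNonfaces.1 hg).1] at h3
        refine ⟨m + 1, le_rfl, ?_, by omega⟩
        have h4 : g ∩ e ⊆ e ∩ lowVertices S (i + 2) := by
          intro y hy
          rw [Finset.mem_inter] at hy ⊢
          exact ⟨hy.2, subset_lowVertices (by omega) hg hy.1⟩
        have := Finset.card_le_card h4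
        omega
      · refine ⟨s, by omega, hs2, ?_⟩
        have : excess τ S (m + 1) e = excess τ S m e + (loss τ S m +
          ((minNonfaces S (m + 2)).filter (fun g => (g \ e).card ≠ 1)).card) :=
            Finset.sum_range_succ _ _
        omega
  obtain ⟨s, -, hs2, hs3⟩ := key i le_rfl
  have := Finset.card_sdiff_add_card_inter e (lowVertices S (i + 2))
  omega

end IsFaceExtremal

/-- The sets of size `i + 3` containing no minimal nonface of size less than `i + 2`. -/
def doubleCliques (S : Finset (Finset α)) (i : ℕ) : Finset (Finset α) :=
  Finset.univ.filter (fun e => e.card = i + 3 ∧ ∀ g ∈ e.powerset, g.card ≤ i + 1 → IsFace S g)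

lemma mem_doubleCliques {S : Finset (Finset α)} {i : ℕ} {e : Finset α} :
    e ∈ doubleCliques S i ↔ e.card = i + 3 ∧ ∀ g ⊆ e, g.card ≤ i + 1 → IsFace S g := by
  simp [doubleCliques]

lemma shadow_doubleCliques_subset (S : Finset (Finset α)) (i : ℕ) :
    ∂ (doubleCliques S i) ⊆ cliques S (i + 2) := by
  intro t ht
  obtain ⟨e, he, x, hx, rfl⟩ := Finset.mem_shadow_iff.1 ht
  obtain ⟨h1, h2⟩ := mem_doubleCliques.1 he
  have hc : (e.erase x).card = i + 2 := by
    rw [Finset.card_erase_of_mem hx, h1]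
    rfl
  refine mem_cliques.2 ⟨hc, fun y hy => h2 _ ?_ ?_⟩
  · exact (Finset.erase_subset _ _).trans (Finset.erase_subset _ _)
  · rw [Finset.card_erase_of_mem hy, hc]
    rfl

namespace IsFaceExtremal

variable {τ : ℕ → ℕ} {S : Finset (Finset α)} {K : ℕ}

lemma card_doubleCliques_le (h : IsFaceExtremal τ S K) {i : ℕ} (hi : i + 2 ≤ K) :
    (doubleCliques S i).card ≤
      ∑ r ∈ Finset.range (i + 1), (coeff τ (Fintype.card α) r).choose (i + 3 - r) +
        (coeff τ (Fintype.card α) (i + 1) + 1 + (minNonfaces S (i + 2)).card).choose 2 := by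
  set n := Fintype.card α with hn
  set m := (minNonfaces S (i + 2)).card with hm
  have hml := h.card_add_loss hi
  have hlt : ∀ a b, a < b → b ≤ i + 1 → coeff τ n b + 1 < coeff τ n a := fun a b hab hb =>
    coeff_lt_coeff h.strictMono hab (by have := h.tau_le (i := b) (by omega); omega)
  have hstep : coeff τ n i + τ i = coeff τ n (i + 1) + τ (i + 1) + 1 := by
    have := h.tau_le (i := i + 1) (by omega)
    have := h.strictMono (show i < i + 1 by omega)
    unfold coeff
    omega
  have hsh : ∀ c : ℕ → ℕ, (∀ r s, r < s → s < i + 2 + 1 → c s < c r) →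
      cascade c (i + 3) ≤ (doubleCliques S i).card →
      cascade c (i + 2) ≤ faceCount τ n (i + 2) + m := by
    intro c hc hle
    have h1 := cascade_le_card_shadow (k := i + 2) (S := doubleCliques S i)
      (fun e he => (mem_doubleCliques.1 he).1) hc hle
    have h2 := Finset.card_le_card (shadow_doubleCliques_subset S i)
    rw [← card_faces_add_card_minNonfaces, h.card_faces _ hi] at h2
    exact h1.trans h2
  by_contra! hcon
  rw [faceCount, cascade, Finset.sum_range_succ, show i + 2 - (i + 1) = 1 by omega,
    Nat.choose_one_right] at hsh
  rcases Nat.eq_zero_or_pos (loss τ S i) with hl | hl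
  · -- Here the colex segment of size `|cliques|` is that of `coeff i + 1` in position `i`.
    let c : ℕ → ℕ := fun r => if r < i then coeff τ n r else
      if r = i then coeff τ n i + 1 else if r = i + 1 then 1 else 0
    have hci : 2 ≤ coeff τ n i := by
      have := hlt i (i + 1) (by omega) le_rfl
      omega
    have hc : ∀ r s, r < s → s < i + 2 + 1 → c s < c r := by
      intro r s hrs hs
      simp only [c]
      by_cases hr : r < i
      · have h1 := hlt r i hr (by omega)
        by_cases hs' : s < i
        · have := hlt r s hrs (by omega)
          simp [hr, hs']
          omega
        · simp only [hr, hs', if_true, if_false]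
          split_ifs <;> omega
      · simp only [hr, show ¬ s < i by omega, if_false]
        split_ifs <;> omega
    have hsum : ∀ p, ∑ r ∈ Finset.range i, (c r).choose (p - r) =
        ∑ r ∈ Finset.range i, (coeff τ n r).choose (p - r) := fun p =>
      Finset.sum_congr rfl fun r hr => by simp [c, Finset.mem_range.1 hr]
    have h2 := hsh c hc (by
      rw [cascade, Finset.sum_range_succ, Finset.sum_range_succ, Finset.sum_range_succ, hsum]
      rw [Finset.sum_range_succ] at hcon
      have e1 : (coeff τ n i + 1).choose 3 = (coeff τ n i).choose 2 + (coeff τ n i).choose 3 :=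
        Nat.choose_succ_succ' _ 2
      have e2 : coeff τ n (i + 1) + 1 + m = coeff τ n i := by omega
      rw [e2, show i + 3 - i = 3 by omega] at hcon
      simp [c, e1, show i + 3 - i = 3 by omega, show i + 3 - (i + 1) = 2 by omega,
        show i + 3 - (i + 2) = 1 by omega]
      omega)
    rw [cascade, Finset.sum_range_succ, Finset.sum_range_succ, hsum, Finset.sum_range_succ] at h2
    have e1 := succ_choose_two (coeff τ n i)
    simp [c, e1, show i + 2 - i = 2 by omega, show i + 2 - (i + 1) = 1 by omega] at h2
    omega
  · let c : ℕ → ℕ := fun r => if r < i + 1 then coeff τ n r else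
      if r = i + 1 then coeff τ n (i + 1) + 1 + m else 0
    have hc : ∀ r s, r < s → s < i + 2 + 1 → c s < c r := by
      intro r s hrs hs
      simp only [c]
      by_cases hr : r < i + 1
      · by_cases hs' : s < i + 1
        · have := hlt r s hrs (by omega)
          simp [hr, hs']
          omega
        · have h1 : coeff τ n i ≤ coeff τ n r := by
            rcases Nat.lt_or_ge r i with hri | hri
            · have := hlt r i hri (by omega)
              omega
            · rw [show r = i by omega]
          simp only [hr, hs', if_true, if_false]
          split_ifs <;> omega
      · simp only [hr, show ¬ s < i + 1 by omega, if_false]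
        split_ifs <;> omega
    have hsum : ∀ p, ∑ r ∈ Finset.range (i + 1), (c r).choose (p - r) =
        ∑ r ∈ Finset.range (i + 1), (coeff τ n r).choose (p - r) := fun p =>
      Finset.sum_congr rfl fun r hr => by simp only [c, Finset.mem_range.1 hr, if_true]
    have h2 := hsh c hc (by
      rw [cascade, Finset.sum_range_succ, Finset.sum_range_succ, hsum]
      simp [c, show i + 3 - (i + 1) = 2 by omega, show i + 3 - (i + 2) = 1 by omega]
      omega)
    rw [cascade, Finset.sum_range_succ, hsum] at h2
    simp [c, show i + 2 - (i + 1) = 1 by omega] at h2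
    omega

/-- The members of `doubleCliques` that contain the hyperedge `e`, the sets destroyed by `e`. -/
lemma card_filter_doubleCliques_ge (h : IsFaceExtremal τ S K) {i : ℕ} (hi : i + 2 ≤ K)
    {e : Finset α} (he : e ∈ minNonfaces S (i + 2)) :
    Fintype.card α + excess τ S i e ≤
      ((doubleCliques S i).filter (fun f => e ⊆ f)).card + (i + 2) + τ i := by
  have hec := (mem_minNonfaces.1 he).1
  have h1 := h.card_filter_lowNonfaces_add_excess (i := i) (by omega) e
  set G := Finset.univ.filter (fun y => y ∉ e ∧ insert y e ∈ doubleCliques S i) with hG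
  set B := Finset.univ.filter (fun y => y ∉ e ∧ insert y e ∉ doubleCliques S i) with hB
  have h2 : Fintype.card α ≤ G.card + B.card + (i + 2) := by
    have hsub : (Finset.univ : Finset α) ⊆ G ∪ B ∪ e := by
      intro y _
      simp only [hG, hB, Finset.mem_union, Finset.mem_filter, Finset.mem_univ, true_and]
      tauto
    have := (Finset.card_le_card hsub).trans (Finset.card_union_le _ _)
    have := Finset.card_union_le G B
    rw [Finset.card_univ] at *
    omega
  have h3 : G.card ≤ ((doubleCliques S i).filter (fun f => e ⊆ f)).card := by
    refine Finset.card_le_card_of_injOn (fun y => insert y e) ?_ ?_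
    · intro y hy
      simp only [hG, Finset.coe_filter, Finset.mem_univ, true_and, Set.mem_ofPred_eq] at hy ⊢
      exact ⟨hy.2, Finset.subset_insert _ _⟩
    · intro y hy z hz hyz
      simp only [hG, Finset.coe_filter, Finset.mem_univ, true_and, Set.mem_ofPred_eq] at hy hz
      have : y ∈ insert z e := by
        simp only at hyz
        rw [← hyz]
        exact Finset.mem_insert_self _ _
      exact (Finset.mem_insert.1 this).resolve_right hy.1
  have h4 : B.card ≤ ((lowNonfaces S (i + 2)).filter (fun g => (g \ e).card = 1)).card := by
    refine card_le_card_filter_sdiff ?_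
    intro y hy
    simp only [hB, Finset.mem_filter, Finset.mem_univ, true_and] at hy
    obtain ⟨hye, hyD⟩ := hy
    have hc : (insert y e).card = i + 3 := by rw [Finset.card_insert_of_notMem hye, hec]
    rw [mem_doubleCliques] at hyD
    push Not at hyD
    obtain ⟨g, hg, hgc, hgF⟩ := hyD hc
    obtain ⟨g', hg', hgm⟩ := exists_minNonface_subset hgF
    have hc' : g'.card < i + 2 := by
      have := Finset.card_le_card hg'
      omega
    refine ⟨g', mem_lowNonfaces.2 ⟨hc', hgm⟩, ?_⟩
    have hyg : y ∈ g' := by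
      by_contra hyg
      refine (mem_minNonfaces.1 hgm).2.2 (isFace_of_ssubset_minNonface he ?_)
      refine Finset.ssubset_iff_subset_ne.2 ⟨fun x hx => ?_, fun heq => ?_⟩
      · exact Finset.mem_of_mem_insert_of_ne (hg (hg' hx)) (fun hxy => hyg (hxy ▸ hx))
      · rw [heq, hec] at hc'
        exact lt_irrefl _ hc'
    ext x
    simp only [Finset.mem_sdiff, Finset.mem_singleton]
    constructor
    · rintro ⟨hx, hx'⟩
      exact (Finset.mem_insert.1 (hg (hg' hx))).resolve_right hx'
    · rintro rfl
      exact ⟨hyg, hye⟩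
  omega

/-- The key inequalities: the vertices brought in by the hyperedges of size `i + 2` beyond
one each, up to one more, are paid for by the loss of hyperedges of size `i + 3`. -/
lemma exists_level_bound (h : IsFaceExtremal τ S K) {i : ℕ} (hi : i + 3 ≤ K) :
    ∃ x : ℕ, (lowVertices S (i + 3)).card ≤ (lowVertices S (i + 2)).card +
        (minNonfaces S (i + 2)).card + 1 + ∑ e ∈ minNonfaces S (i + 2), excess τ S i e + x ∧
      (minNonfaces S (i + 2)).card * loss τ S i + ∑ e ∈ minNonfaces S (i + 2), excess τ S i e + x ≤
        loss τ S (i + 1) ∧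
      (x = 0 → ∀ e ∈ minNonfaces S (i + 2), ∀ e' ∈ minNonfaces S (i + 2), e ≠ e' →
        (e ∩ e').card + 1 = i + 2) := by
  set D := doubleCliques S i with hD
  set H := minNonfaces S (i + 2) with hH
  set A : Finset α → Finset (Finset α) := fun e => D.filter (fun f => e ⊆ f) with hA
  have hHc : ∀ e ∈ H, e.card = i + 2 := fun e he => (mem_minNonfaces.1 he).1
  have hinter : ∀ e ∈ H, ∀ e' ∈ H, e ≠ e' → ∀ f ∈ A e ∩ A e',
      f = e ∪ e' ∧ (e ∩ e').card + 1 = i + 2 := by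
    intro e he e' he' hne f hf
    simp only [hA, Finset.mem_inter, Finset.mem_filter] at hf
    have hfc := (mem_doubleCliques.1 hf.1.1).1
    have hsub : e ∪ e' ⊆ f := Finset.union_subset hf.1.2 hf.2.2
    have h1 := Finset.card_union_add_card_inter e e'
    have h2 := Finset.card_le_card hsub
    have h3 : (e ∩ e').card < i + 2 := by
      by_contra! hge
      have h4 : e ∩ e' = e :=
        Finset.eq_of_subset_of_card_le Finset.inter_subset_left (by rw [hHc e he]; exact hge)
      have h5 : e ∩ e' = e' :=
        Finset.eq_of_subset_of_card_le Finset.inter_subset_right (by rw [hHc e' he']; exact hge)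
      exact hne (h4.symm.trans h5)
    rw [hHc e he, hHc e' he'] at h1
    refine ⟨(Finset.eq_of_subset_of_card_le hsub (by omega)).symm, by omega⟩
  obtain ⟨x, hx1, hx2, hx3⟩ := exists_overlap_deficit H (lowVertices S (i + 2)) A
    (excess τ S i) (i + 2) hHc
    (fun e he => h.card_sdiff_lowVertices_le (by omega) (hHc e he))
    (fun e he e' he' hne => Finset.card_le_one.2 fun f hf f' hf' =>
      (hinter e he e' he' hne f hf).1.trans (hinter e he e' he' hne f' hf').1.symm)
    (fun e he e' he' hne hn => by
      rw [Finset.card_eq_zero, Finset.eq_empty_iff_forall_notMem]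
      exact fun f hf => hn (hinter e he e' he' hne f hf).2)
  refine ⟨x, ?_, ?_, hx3⟩
  · rw [show i + 3 = (i + 2) + 1 by rfl, lowVertices_succ]
    exact hx1
  -- Count `doubleCliques`: faces, hyperedges of size `i + 3`, and sets destroyed by `H`.
  have hDle := h.card_doubleCliques_le (i := i) (by omega)
  have hsplit : (H.biUnion A).card + (cliques S (i + 3)).card ≤ D.card := by
    rw [← Finset.card_union_of_disjoint]
    · refine Finset.card_le_card (Finset.union_subset ?_ ?_)
      · exact Finset.biUnion_subset.2 fun e _ => Finset.filter_subset _ _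
      · intro f hf
        obtain ⟨hf1, hf2⟩ := mem_cliques.1 hf
        refine mem_doubleCliques.2 ⟨hf1, fun g hg hgc => ?_⟩
        obtain ⟨x, hx, hxg⟩ := Finset.exists_mem_notMem_of_card_lt_card
          (show g.card < f.card by omega)
        exact (hf2 x hx).mono fun y hy => Finset.mem_erase.2 ⟨fun h => hxg (h ▸ hy), hg hy⟩
    · rw [Finset.disjoint_left]
      intro f hf hf'
      obtain ⟨e, he, hef⟩ := Finset.mem_biUnion.1 hf
      have hef' := (Finset.mem_filter.1 hef).2
      obtain ⟨hf1, hf2⟩ := mem_cliques.1 hf'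
      obtain ⟨x, hx, hxe⟩ := Finset.exists_mem_notMem_of_card_lt_card
        (show e.card < f.card by rw [hHc e he, hf1]; omega)
      exact (mem_minNonfaces.1 he).2.2 ((hf2 x hx).mono fun y hy =>
        Finset.mem_erase.2 ⟨fun h => hxe (h ▸ hy), hef' hy⟩)
  have hsum : H.card * Fintype.card α + ∑ e ∈ H, excess τ S i e ≤
      ∑ e ∈ H, (A e).card + H.card * (i + 2 + τ i) := by
    have : ∑ e ∈ H, (Fintype.card α + excess τ S i e) ≤ ∑ e ∈ H, ((A e).card + (i + 2 + τ i)) :=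
      Finset.sum_le_sum fun e he => by
        have : Fintype.card α + excess τ S i e ≤ (A e).card + (i + 2) + τ i :=
          h.card_filter_doubleCliques_ge (i := i) (by omega) he
        omega
    simpa [Finset.sum_add_distrib] using this
  rw [← card_faces_add_card_minNonfaces, h.card_faces _ hi, faceCount, cascade,
    Finset.sum_range_succ, Finset.sum_range_succ, show i + 3 - (i + 1) = 2 by omega,
    show i + 3 - (i + 2) = 1 by omega, Nat.choose_one_right] at hsplit
  have hl1 := h.card_add_loss (i := i) (by omega)
  have hl2 := h.card_add_loss (i := i + 1) (by omega)
  have hb1 : coeff τ (Fintype.card α) (i + 1) + τ (i + 1) + (i + 2) = Fintype.card α := by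
    have := h.tau_le (i := i + 1) (by omega)
    unfold coeff
    omega
  have hb2 : coeff τ (Fintype.card α) (i + 2) + τ (i + 2) + (i + 3) = Fintype.card α := by
    have := h.tau_le (i := i + 2) (by omega)
    unfold coeff
    omega
  have hch := choose_two_add_add (coeff τ (Fintype.card α) (i + 1)) H.card
  rw [show i + 1 + 2 = i + 3 by ring, show i + 1 + 1 = i + 2 by ring] at hl2
  rw [← hH] at hl1 hDle
  rw [← hD] at hDle
  have hprod1 : H.card * H.card + H.card * loss τ S i + H.card * τ i = H.card * τ (i + 1) := by
    rw [← hl1]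
    ring
  have hprod2 : H.card * coeff τ (Fintype.card α) (i + 1) + H.card * τ (i + 1) +
      H.card * (i + 2) = H.card * Fintype.card α := by
    conv_rhs => rw [← hb1]
    ring
  rw [show i + 1 + 1 = i + 2 by ring] at hsplit
  rw [mul_add] at hsum
  rw [add_mul, one_mul] at hch
  omega

/-- A vertex bound: `n` enters the number of choices of the hyperedges of size at most `i + 1`
with an exponent of at most `τ i + i + loss i`. -/
lemma card_lowVertices_le (h : IsFaceExtremal τ S K) {i : ℕ} (hi : i + 2 ≤ K) :
    (lowVertices S (i + 2)).card ≤ τ i + i + loss τ S i := by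
  induction i with
  | zero =>
    have h1 : (lowVertices S 2).card ≤ (minNonfaces S 1).card := by
      rw [show 2 = 1 + 1 by rfl, lowVertices_succ, show 1 = 0 + 1 by rfl, lowVertices_succ,
        h.minNonfaces_zero]
      have h0 : lowVertices S 0 = ∅ := by simp [lowVertices, lowNonfaces]
      rw [h0]
      simp only [Finset.biUnion_empty, Finset.empty_union, zero_add]
      refine Finset.card_biUnion_le.trans ?_
      rw [Finset.card_eq_sum_ones]
      exact Finset.sum_le_sum fun e he => (mem_minNonfaces.1 he).1.le
    rw [h.card_minNonfaces_one (by omega)] at h1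
    simp only [zero_add]
    omega
  | succ i ih =>
    obtain ⟨x, h1, h2, -⟩ := h.exists_level_bound (i := i) (by omega)
    have h3 := ih (by omega)
    have h4 := h.card_add_loss (i := i) (by omega)
    rw [show i + 1 + 2 = i + 3 by ring]
    omega

/-- If the vertex bound is attained without loss at the top, then it is so in all sizes. -/
lemma tight_of_succ (h : IsFaceExtremal τ S K) {i : ℕ} (hi : i + 3 ≤ K)
    (hl : loss τ S (i + 1) = 0) (hv : (lowVertices S (i + 3)).card = τ (i + 1) + (i + 1)) :
    loss τ S i = 0 ∧ (lowVertices S (i + 2)).card = τ i + i ∧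
      (∀ e ∈ minNonfaces S (i + 2), excess τ S i e = 0) ∧
      ∀ e ∈ minNonfaces S (i + 2), ∀ e' ∈ minNonfaces S (i + 2), e ≠ e' →
        (e ∩ e').card + 1 = i + 2 := by
  obtain ⟨x, h1, h2, h3⟩ := h.exists_level_bound (i := i) (by omega)
  rw [hl] at h2
  have h4 := h.card_lowVertices_le (i := i) (by omega)
  have h5 := h.card_add_loss (i := i) (by omega)
  have hE : ∑ e ∈ minNonfaces S (i + 2), excess τ S i e = 0 := by omega
  have hx : x = 0 := by omega
  have hloss : loss τ S i = 0 := by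
    have hm : (minNonfaces S (i + 2)).card * loss τ S i = 0 := by omega
    rcases Nat.mul_eq_zero.1 hm with hm | hm
    · rw [show i + 3 = (i + 2) + 1 by rfl, lowVertices_succ, Finset.card_eq_zero.1 hm] at hv
      simp only [Finset.biUnion_empty, Finset.union_empty] at hv
      omega
    · exact hm
  exact ⟨hloss, by omega, Finset.sum_eq_zero_iff.1 hE, h3 hx⟩

end IsFaceExtremal

end Hyperedges

/-! ### The case of equality: initial segments of the colex order -/

section Tight

variable {α : Type*} [DecidableEq α]

lemma card_union_biUnion_le {H Q : Finset (Finset α)} {V : Finset α} {j : ℕ}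
    (hj : ∀ e ∈ H, e.card = j)
    (hadj : ∀ e ∈ H, ∀ e' ∈ H, e ≠ e' → (e ∩ e').card + 1 = j) (hQH : Q ⊆ H)
    (hQ : Q.Nonempty) :
    (V ∪ H.biUnion id).card + Q.card ≤ (V ∪ Q.biUnion id).card + H.card := by
  obtain ⟨e₁, he₁⟩ := hQ
  have hsub : V ∪ H.biUnion id ⊆ (V ∪ Q.biUnion id) ∪ (H \ Q).biUnion (fun e => e \ e₁) := by
    intro y hy
    simp only [Finset.mem_union, Finset.mem_biUnion, id, Finset.mem_sdiff] at hy ⊢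
    rcases hy with hy | ⟨e, he, hye⟩
    · exact Or.inl (Or.inl hy)
    by_cases heQ : e ∈ Q
    · exact Or.inl (Or.inr ⟨e, heQ, hye⟩)
    by_cases hy1 : y ∈ e₁
    · exact Or.inl (Or.inr ⟨e₁, he₁, hy1⟩)
    · exact Or.inr ⟨e, ⟨he, heQ⟩, hye, hy1⟩
  have h1 : ((H \ Q).biUnion (fun e => e \ e₁)).card ≤ (H \ Q).card := by
    refine Finset.card_biUnion_le.trans ?_
    rw [Finset.card_eq_sum_ones]
    refine Finset.sum_le_sum fun e he => ?_
    obtain ⟨heH, heQ⟩ := Finset.mem_sdiff.1 he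
    have h2 := hadj e heH e₁ (hQH he₁) (fun h => heQ (h ▸ he₁))
    have h3 := Finset.card_sdiff_add_card_inter e e₁
    rw [hj e heH] at h3
    omega
  have h2 := (Finset.card_le_card hsub).trans (Finset.card_union_le _ _)
  have h3 := Finset.card_sdiff_add_card_eq_card hQH
  omega

variable [Fintype α]

/-- The hyperedges of size `r + 2` in a complex attaining the vertex bound. -/
structure IsTightLevel (S : Finset (Finset α)) (r : ℕ) : Prop where
  nonempty : (minNonfaces S (r + 2)).Nonempty
  card_inter : ∀ e ∈ minNonfaces S (r + 2), (e ∩ lowVertices S (r + 2)).card = r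
  card_inter_low : ∀ s < r, ∀ g ∈ minNonfaces S (s + 2), ∀ e ∈ minNonfaces S (r + 2),
    (g ∩ e).card = s + 1
  adjacent : ∀ e ∈ minNonfaces S (r + 2), ∀ e' ∈ minNonfaces S (r + 2), e ≠ e' →
    (e ∩ e').card + 1 = r + 2
  spread : ∀ Q ⊆ minNonfaces S (r + 2), Q.Nonempty →
    (lowVertices S (r + 2)).card + Q.card + 1 ≤ (lowVertices S (r + 2) ∪ Q.biUnion id).card

lemma IsFaceExtremal.isTightLevel {τ : ℕ → ℕ} {S : Finset (Finset α)} {K : ℕ}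
    (h : IsFaceExtremal τ S K) {i : ℕ} (hi : i + 2 ≤ K) (hl : loss τ S i = 0)
    (hv : (lowVertices S (i + 2)).card = τ i + i) : ∀ r < i, IsTightLevel S r := by
  have hall : ∀ m ≤ i, loss τ S (i - m) = 0 ∧
      (lowVertices S (i - m + 2)).card = τ (i - m) + (i - m) := by
    intro m
    induction m with
    | zero => exact fun _ => ⟨hl, hv⟩
    | succ m ih =>
      intro hm
      obtain ⟨h1, h2⟩ := ih (by omega)
      obtain ⟨j, hj⟩ : ∃ j, i - m = j + 1 := ⟨i - m - 1, by omega⟩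
      rw [show i - (m + 1) = j by omega]
      rw [hj] at h1 h2
      obtain ⟨h3, h4, -⟩ := h.tight_of_succ (i := j) (by omega) h1 h2
      exact ⟨h3, h4⟩
  have hall' : ∀ r ≤ i, loss τ S r = 0 ∧ (lowVertices S (r + 2)).card = τ r + r := by
    intro r hr
    have := hall (i - r) (by omega)
    rwa [show i - (i - r) = r by omega] at this
  intro r hr
  obtain ⟨hr1, hr2⟩ := hall' r hr.le
  obtain ⟨hr3, hr4⟩ := hall' (r + 1) hr
  obtain ⟨-, -, hex, hadj⟩ := h.tight_of_succ (i := r) (by omega) hr3 hr4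
  have hcard := h.card_add_loss (i := r) (by omega)
  have hτ := h.strictMono (show r < r + 1 by omega)
  have hHc : ∀ e ∈ minNonfaces S (r + 2), e.card = r + 2 := fun e he => (mem_minNonfaces.1 he).1
  have hspread : ∀ Q ⊆ minNonfaces S (r + 2), Q.Nonempty →
      (lowVertices S (r + 2)).card + Q.card + 1 ≤
        (lowVertices S (r + 2) ∪ Q.biUnion id).card := by
    intro Q hQ hQn
    have h1 := card_union_biUnion_le (V := lowVertices S (r + 2)) hHc hadj hQ hQn
    rw [← lowVertices_succ] at h1
    rw [show r + 1 + 2 = r + 2 + 1 by ring] at hr4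
    omega
  refine ⟨Finset.card_pos.1 (by omega), ?_, ?_, hadj, hspread⟩
  · intro e he
    have h1 := hspread {e} (by simpa using he) (by simp)
    have h2 := h.card_sdiff_lowVertices_le (i := r) (by omega) (hHc e he)
    rw [hex e he] at h2
    have h3 := Finset.card_sdiff_add_card_inter e (lowVertices S (r + 2))
    rw [hHc e he] at h3
    have h4 : (lowVertices S (r + 2) ∪ e).card =
        (e \ lowVertices S (r + 2)).card + (lowVertices S (r + 2)).card := by
      rw [Finset.union_comm, Finset.card_sdiff_add_card]
    simp only [Finset.singleton_biUnion, id, Finset.card_singleton] at h1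
    omega
  · intro s hs g hg e he
    have h1 := Finset.sum_eq_zero_iff.1 (hex e he) s (Finset.mem_range.2 hs)
    have h2 : ((minNonfaces S (s + 2)).filter (fun g => (g \ e).card ≠ 1)) = ∅ :=
      Finset.card_eq_zero.1 (by omega)
    have h3 : (g \ e).card = 1 := by
      by_contra hne
      have : g ∈ (minNonfaces S (s + 2)).filter (fun g => (g \ e).card ≠ 1) :=
        Finset.mem_filter.2 ⟨hg, hne⟩
      simp [h2] at this
    have h4 := Finset.card_sdiff_add_card_inter g e
    rw [(mem_minNonfaces.1 hg).1] at h4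
    omega

lemma lowVertices_mono (S : Finset (Finset α)) {i j : ℕ} (h : i ≤ j) :
    lowVertices S i ⊆ lowVertices S j := by
  induction j, h using Nat.le_induction with
  | base => exact Finset.Subset.rfl
  | succ j _ ih =>
    rw [lowVertices_succ]
    exact ih.trans Finset.subset_union_left

/-- The hyperedges of every size `r + 2` with `r < m` have the vertices `v 0, …, v r` in common,
where `v r` lies in no smaller hyperedge, and the same holds for size `m + 2` without `v m`. -/
structure IsSpine (S : Finset (Finset α)) (i m : ℕ) (v : ℕ → α) : Prop where
  notMem : ∀ r < m, v r ∉ lowVertices S (r + 2)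
  mem : ∀ r < m, ∀ e ∈ minNonfaces S (r + 2), v r ∈ e
  inter_eq : ∀ r ≤ m, r < i → ∀ e ∈ minNonfaces S (r + 2),
    e ∩ lowVertices S (r + 2) = (Finset.range r).image v

namespace IsSpine

variable {S : Finset (Finset α)} {i m : ℕ} {v : ℕ → α}

lemma mem_lowVertices (h : IsSpine S i m v) (ht : ∀ r < i, IsTightLevel S r) (hm : m ≤ i)
    {r j : ℕ} (hr : r < m) (hj : r + 3 ≤ j) : v r ∈ lowVertices S j := by
  obtain ⟨e, he⟩ := (ht r (by omega)).nonempty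
  exact subset_lowVertices (by omega) he (h.mem r hr e he)

lemma card_image (h : IsSpine S i m v) (ht : ∀ r < i, IsTightLevel S r) (hm : m ≤ i)
    {r : ℕ} (hr : r ≤ m) : ((Finset.range r).image v).card = r := by
  rw [Finset.card_image_of_injOn, Finset.card_range]
  have key : ∀ a b, a < b → b < r → v a ≠ v b := fun a b hab hb heq =>
    h.notMem b (by omega) (heq ▸ h.mem_lowVertices ht hm (by omega) (by omega))
  intro a ha b hb hab
  simp only [Finset.coe_range, Set.mem_Iio] at ha hb
  rcases lt_trichotomy a b with hlt | heq | hlt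
  · exact absurd hab (key a b hlt hb)
  · exact heq
  · exact absurd hab.symm (key b a hlt ha)

/-- A spine extends by one vertex.  Below the last level the new vertex is read off from the
next larger hyperedges, as the present level may consist of a single hyperedge, in which the spine
vertex cannot be told from the other new one. -/
lemma extend (h : IsSpine S i m v) (ht : ∀ r < i, IsTightLevel S r) (hm : m < i) :
    ∃ v', IsSpine S i (m + 1) v' := by
  have hHc : ∀ {j}, ∀ e ∈ minNonfaces S j, e.card = j := fun e he => (mem_minNonfaces.1 he).1
  have hcm := h.card_image ht hm.le le_rfl
  set C₀ := (Finset.range m).image v with hC₀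
  -- It suffices to find the new vertex `p`.
  suffices hp : ∃ p, p ∉ lowVertices S (m + 2) ∧ (∀ e ∈ minNonfaces S (m + 2), p ∈ e) ∧
      (m + 1 < i → ∀ e ∈ minNonfaces S (m + 3), e ∩ lowVertices S (m + 3) = insert p C₀) by
    obtain ⟨p, hp1, hp2, hp3⟩ := hp
    have himg : ∀ r ≤ m, (Finset.range r).image (Function.update v m p) =
        (Finset.range r).image v := by
      intro r hr
      refine Finset.image_congr fun a ha => ?_
      have : a < r := by simpa using ha
      exact Function.update_of_ne (by omega) _ _
    refine ⟨Function.update v m p, ?_, ?_, ?_⟩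
    · intro r hr
      rcases Nat.lt_or_ge r m with hrm | hrm
      · rw [Function.update_of_ne (by omega)]
        exact h.notMem r hrm
      · rw [show r = m by omega, Function.update_self]
        exact hp1
    · intro r hr e he
      rcases Nat.lt_or_ge r m with hrm | hrm
      · rw [Function.update_of_ne (by omega)]
        exact h.mem r hrm e he
      · obtain rfl : r = m := by omega
        rw [Function.update_self]
        exact hp2 e he
    · intro r hr hri e he
      rcases Nat.lt_or_ge m r with hrm | hrm
      · obtain rfl : r = m + 1 := by omega
        rw [Finset.range_add_one, Finset.image_insert, himg m le_rfl, Function.update_self]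
        exact hp3 hri e he
      · rw [himg r hrm]
        exact h.inter_eq r hrm hri e he
  obtain ⟨g₀, hg₀⟩ := (ht m hm).nonempty
  by_cases hlast : m + 1 < i
  · obtain ⟨e₀, he₀⟩ := (ht (m + 1) hlast).nonempty
    have hcV : ∀ e ∈ minNonfaces S (m + 3), (e ∩ lowVertices S (m + 3)).card = m + 1 :=
      (ht (m + 1) hlast).card_inter
    have hsub : ∀ g ∈ minNonfaces S (m + 2), e₀ ∩ lowVertices S (m + 3) ⊆ g := by
      intro g hg
      have h1 : g ∩ e₀ ⊆ e₀ ∩ lowVertices S (m + 3) := by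
        intro y hy
        rw [Finset.mem_inter] at hy ⊢
        exact ⟨hy.2, subset_lowVertices (by omega) hg hy.1⟩
      have h2 := Finset.eq_of_subset_of_card_le h1 (by
        rw [hcV e₀ he₀, (ht (m + 1) hlast).card_inter_low m (by omega) g hg e₀ he₀])
      rw [← h2]
      exact Finset.inter_subset_left
    -- The earlier spine vertices lie in `e₀`, by counting its intersections with smaller edges.
    have hspine : C₀ ⊆ e₀ ∩ lowVertices S (m + 3) := by
      intro y hy
      obtain ⟨s, hs, rfl⟩ := Finset.mem_image.1 hy
      have hs : s < m := Finset.mem_range.1 hs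
      obtain ⟨g', hg'⟩ := (ht s (by omega)).nonempty
      have hg'V : g' ⊆ lowVertices S (m + 2) := subset_lowVertices (by omega) hg'
      have h1 : g' ∩ e₀ ⊆ (Finset.range (s + 1)).image v := by
        intro y hy
        rw [Finset.mem_inter] at hy
        have h2 : y ∈ g₀ := hsub g₀ hg₀ (Finset.mem_inter.2
          ⟨hy.2, lowVertices_mono S (by omega) (hg'V hy.1)⟩)
        have h3 : y ∈ g₀ ∩ lowVertices S (m + 2) := Finset.mem_inter.2 ⟨h2, hg'V hy.1⟩
        rw [h.inter_eq m le_rfl hm g₀ hg₀] at h3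
        obtain ⟨a, ha, rfl⟩ := Finset.mem_image.1 h3
        have ha : a < m := Finset.mem_range.1 ha
        refine Finset.mem_image_of_mem v (Finset.mem_range.2 ?_)
        by_contra! hcon
        exact h.notMem a ha (lowVertices_mono S (by omega)
          (subset_lowVertices (i := s + 2) (j := s + 3) (by omega) hg' hy.1))
      have h2 := Finset.eq_of_subset_of_card_le h1 (by
        rw [h.card_image ht hm.le (by omega),
          (ht (m + 1) hlast).card_inter_low s (by omega) g' hg' e₀ he₀])
      have h3 : v s ∈ g' ∩ e₀ := by
        rw [h2]
        exact Finset.mem_image_of_mem v (Finset.mem_range.2 (by omega))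
      rw [Finset.mem_inter] at h3 ⊢
      exact ⟨h3.2, lowVertices_mono S (by omega) (hg'V h3.1)⟩
    obtain ⟨p, hp, hpC⟩ := Finset.exists_mem_notMem_of_card_lt_card
      (show C₀.card < (e₀ ∩ lowVertices S (m + 3)).card by rw [hcV e₀ he₀, hcm]; omega)
    have hC : e₀ ∩ lowVertices S (m + 3) = insert p C₀ := by
      refine (Finset.eq_of_subset_of_card_le (Finset.insert_subset hp hspine) ?_).symm
      rw [Finset.card_insert_of_notMem hpC, hcm, hcV e₀ he₀]
    refine ⟨p, ?_, fun g hg => hsub g hg hp, fun _ e he => ?_⟩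
    · intro hpV
      apply hpC
      rw [hC₀, ← h.inter_eq m le_rfl hm g₀ hg₀]
      exact Finset.mem_inter.2 ⟨hsub g₀ hg₀ hp, hpV⟩
    · by_cases hee : e = e₀
      · rw [hee, hC]
      rw [← hC]
      have h1 := (ht (m + 1) hlast).adjacent e he e₀ he₀ hee
      have h2 := (ht (m + 1) hlast).spread {e, e₀} (by
        intro y hy
        rcases Finset.mem_insert.1 hy with rfl | hy
        · exact he
        · rw [Finset.mem_singleton.1 hy]
          exact he₀) (by simp)
      rw [Finset.card_pair hee] at h2
      simp only [Finset.biUnion_insert, Finset.singleton_biUnion, id] at h2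
      set V := lowVertices S (m + 3) with hV
      have h3 : (V ∪ (e ∪ e₀)).card = V.card + ((e ∪ e₀) \ V).card := by
        rw [Finset.union_comm, ← Finset.card_sdiff_add_card, Nat.add_comm]
      have h4 := Finset.card_union_add_card_inter (e \ V) (e₀ \ V)
      rw [← Finset.union_sdiff_distrib] at h4
      have h5 := Finset.card_sdiff_add_card_inter e V
      have h6 := Finset.card_sdiff_add_card_inter e₀ V
      have h7 := Finset.card_sdiff_add_card_inter (e ∩ e₀) V
      have h8 : (e ∩ e₀) \ V = (e \ V) ∩ (e₀ \ V) := by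
        ext y
        simp only [Finset.mem_inter, Finset.mem_sdiff]
        tauto
      have h9 : (e ∩ e₀) ∩ V = (e ∩ V) ∩ (e₀ ∩ V) := by
        ext y
        simp only [Finset.mem_inter]
        tauto
      rw [h8, h9] at h7
      have h10 := hcV e he
      have h11 := hcV e₀ he₀
      have h12 := hHc e he
      have h13 := hHc e₀ he₀
      rw [show m + 1 + 2 = m + 3 by ring] at *
      have h14 : (e ∩ V) ∩ (e₀ ∩ V) = e ∩ V :=
        Finset.eq_of_subset_of_card_le Finset.inter_subset_left (by omega)
      have h15 : (e ∩ V) ∩ (e₀ ∩ V) = e₀ ∩ V :=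
        Finset.eq_of_subset_of_card_le Finset.inter_subset_right (by omega)
      exact h14.symm.trans h15
  · -- At the last level the new parts of the hyperedges are pairwise intersecting pairs that
    -- do not form a triangle.
    set V := lowVertices S (m + 2) with hV
    have hnew : ∀ g ∈ minNonfaces S (m + 2), (g \ V).card = 2 := by
      intro g hg
      have h1 := Finset.card_sdiff_add_card_inter g V
      have h2 := (ht m hm).card_inter g hg
      rw [← hV] at h2
      rw [hHc g hg] at h1
      omega
    have hpair : ∀ g ∈ minNonfaces S (m + 2), ∀ g' ∈ minNonfaces S (m + 2), g ≠ g' →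
        ((g \ V) ∩ (g' \ V)).card = 1 := by
      intro g hg g' hg' hne
      have h1 := (ht m hm).adjacent g hg g' hg' hne
      have h2 := Finset.card_sdiff_add_card_inter (g ∩ g') V
      have h3 : (g ∩ g') \ V = (g \ V) ∩ (g' \ V) := by
        ext y
        simp only [Finset.mem_inter, Finset.mem_sdiff]
        tauto
      have h4 : (g ∩ g') ∩ V = C₀ := by
        have h5 := h.inter_eq m le_rfl hm g hg
        have h6 := h.inter_eq m le_rfl hm g' hg'
        ext y
        have h7 := Finset.ext_iff.1 h5 y
        have h8 := Finset.ext_iff.1 h6 y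
        simp only [Finset.mem_inter] at h7 h8 ⊢
        tauto
      rw [h3, h4, hcm] at h2
      omega
    have hgoal : ∃ p, ∀ g ∈ minNonfaces S (m + 2), p ∈ g \ V := by
      by_cases h1 : ∀ g ∈ minNonfaces S (m + 2), g = g₀
      · obtain ⟨p, hp⟩ := Finset.card_pos.1 (show 0 < (g₀ \ V).card by rw [hnew g₀ hg₀]; omega)
        exact ⟨p, fun g hg => by rwa [h1 g hg]⟩
      push Not at h1
      obtain ⟨g₁, hg₁, hne⟩ := h1
      obtain ⟨p, hp⟩ := Finset.card_eq_one.1 (hpair g₁ hg₁ g₀ hg₀ hne)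
      have hp' : p ∈ (g₁ \ V) ∩ (g₀ \ V) := by simp [hp]
      rw [Finset.mem_inter] at hp'
      refine ⟨p, fun g hg => ?_⟩
      by_contra hpg
      have hg1 : g ≠ g₁ := fun heq => hpg (heq ▸ hp'.1)
      have hg0 : g ≠ g₀ := fun heq => hpg (heq ▸ hp'.2)
      have h2 := (ht m hm).spread {g, g₁, g₀} (by
        intro y hy
        simp only [Finset.mem_insert, Finset.mem_singleton] at hy
        rcases hy with rfl | rfl | rfl
        · exact hg
        · exact hg₁
        · exact hg₀) (by simp)
      rw [Finset.card_eq_three.2 ⟨g, g₁, g₀, hg1, hg0, hne, rfl⟩] at h2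
      simp only [Finset.biUnion_insert, Finset.singleton_biUnion, id] at h2
      rw [← hV] at h2
      obtain ⟨q₁, hq₁⟩ := Finset.card_eq_one.1 (hpair g hg g₁ hg₁ hg1)
      obtain ⟨q₀, hq₀⟩ := Finset.card_eq_one.1 (hpair g hg g₀ hg₀ hg0)
      have hq₁' : q₁ ∈ (g \ V) ∩ (g₁ \ V) := by simp [hq₁]
      have hq₀' : q₀ ∈ (g \ V) ∩ (g₀ \ V) := by simp [hq₀]
      rw [Finset.mem_inter] at hq₁' hq₀'
      have hqne : q₁ ≠ q₀ := by
        rintro rfl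
        have : q₁ ∈ (g₁ \ V) ∩ (g₀ \ V) := Finset.mem_inter.2 ⟨hq₁'.2, hq₀'.2⟩
        rw [hp, Finset.mem_singleton] at this
        exact hpg (this ▸ hq₁'.1)
      have h3 : g \ V = {q₁, q₀} := by
        refine (Finset.eq_of_subset_of_card_le ?_ ?_).symm
        · intro y hy
          rcases Finset.mem_insert.1 hy with rfl | hy
          · exact hq₁'.1
          · rw [Finset.mem_singleton.1 hy]
            exact hq₀'.1
        · rw [hnew g hg, Finset.card_pair hqne]
      have h4 : V ∪ (g ∪ (g₁ ∪ g₀)) ⊆ ((g₁ \ V) ∪ (g₀ \ V)) ∪ V := by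
        intro y hy
        by_cases hyV : y ∈ V
        · exact Finset.mem_union_right _ hyV
        simp only [Finset.mem_union, Finset.mem_sdiff] at hy ⊢
        rcases hy with hy | hy | hy | hy
        · exact absurd hy hyV
        · have : y ∈ g \ V := Finset.mem_sdiff.2 ⟨hy, hyV⟩
          rw [h3, Finset.mem_insert, Finset.mem_singleton] at this
          rcases this with rfl | rfl
          · exact Or.inl (Or.inl (Finset.mem_sdiff.1 hq₁'.2))
          · exact Or.inl (Or.inr (Finset.mem_sdiff.1 hq₀'.2))
        · exact Or.inl (Or.inl ⟨hy, hyV⟩)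
        · exact Or.inl (Or.inr ⟨hy, hyV⟩)
      have h5 := (Finset.card_le_card h4).trans (Finset.card_union_le _ _)
      have h6 := Finset.card_union_add_card_inter (g₁ \ V) (g₀ \ V)
      rw [hpair g₁ hg₁ g₀ hg₀ hne, hnew g₁ hg₁, hnew g₀ hg₀] at h6
      omega
    obtain ⟨p, hp⟩ := hgoal
    exact ⟨p, (Finset.mem_sdiff.1 (hp g₀ hg₀)).2, fun g hg => (Finset.mem_sdiff.1 (hp g hg)).1,
      fun hcon => absurd hcon hlast⟩

end IsSpine

lemma exists_isSpine [Nonempty α] {S : Finset (Finset α)} {i : ℕ}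
    (ht : ∀ r < i, IsTightLevel S r) : ∀ m ≤ i, ∃ v, IsSpine S i m v := by
  intro m
  induction m with
  | zero =>
    refine fun _ => ⟨fun _ => Classical.arbitrary α, fun r hr => by omega, fun r hr => by omega, ?_⟩
    intro r hr hri e he
    obtain rfl : r = 0 := by omega
    simpa using (ht 0 hri).card_inter e he
  | succ m ih =>
    intro hm
    obtain ⟨v, hv⟩ := ih (by omega)
    exact hv.extend ht hm

end Tight

/-- A family is an initial segment of the colex order up to a permutation if it is closed under
passing to sets that are smaller in the preorder defined by a weight on the points. -/
lemma isColexSegment_of_key {n k : ℕ} {I : Finset (Finset (Fin n))}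
    (hI : (I : Set (Finset (Fin n))).Sized k) (key : Fin n → ℕ)
    (h : ∀ s ∈ I, ∀ t : Finset (Fin n), t.card = k →
      (∃ z ∈ s, z ∉ t ∧ ∀ y ∈ t, y ∉ s → key y ≤ key z) → t ∈ I) : IsColexSegment n k I := by
  set σ : Equiv.Perm (Fin n) := (Tuple.sort key).symm with hσ
  have hmono : ∀ a b, σ a ≤ σ b → key a ≤ key b := by
    intro a b hab
    have := Tuple.monotone_sort key hab
    simpa [hσ] using this
  refine ⟨σ, ?_, ?_⟩
  · intro t ht
    obtain ⟨s, hs, rfl⟩ := Finset.mem_image.1 (Finset.mem_coe.1 ht)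
    rw [Finset.card_image_of_injective _ σ.injective]
    exact hI hs
  · rintro s' t' hs' ⟨hlt, hc⟩
    obtain ⟨s, hs, rfl⟩ := Finset.mem_image.1 hs'
    have ht' : t' = (t'.image σ.symm).image σ := by
      rw [Finset.image_image]
      simp
    refine Finset.mem_image.2 ⟨t'.image σ.symm, h s hs _ ?_ ?_, ht'.symm⟩
    · rw [Finset.card_image_of_injective _ σ.symm.injective, hc]
    · obtain ⟨a, ha, hat, hlt⟩ := Finset.Colex.toColex_lt_toColex_iff_exists_forall_lt.1 hlt
      obtain ⟨z, hz, rfl⟩ := Finset.mem_image.1 ha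
      have hmem : ∀ y, y ∈ t'.image σ.symm ↔ σ y ∈ t' := by
        intro y
        simp only [Finset.mem_image]
        constructor
        · rintro ⟨b, hb, rfl⟩
          simpa using hb
        · exact fun hy => ⟨σ y, hy, by simp⟩
      refine ⟨z, hz, fun hzt => hat ((hmem z).1 hzt), fun y hy hys => hmono y z ?_⟩
      refine (hlt (σ y) ((hmem y).1 hy) ?_).le
      simpa using hys

/-- If the vertex bound is attained without loss, the cliques form a colex segment. -/
theorem isColexSegment_cliques {n : ℕ} {τ : ℕ → ℕ} {S : Finset (Finset (Fin n))} {K i : ℕ}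
    (h : IsFaceExtremal τ S K) (hi : i + 2 ≤ K) (hl : loss τ S i = 0)
    (hv : (lowVertices S (i + 2)).card = τ i + i) :
    IsColexSegment n (i + 2) (cliques S (i + 2)) := by
  have ht := h.isTightLevel hi hl hv
  have hpos : 0 < n := by
    have := h.large
    rw [Fintype.card_fin] at this
    omega
  have : Nonempty (Fin n) := ⟨⟨0, hpos⟩⟩
  obtain ⟨v, hs⟩ := exists_isSpine ht i le_rfl
  set V := lowVertices S with hV
  -- The weight: earlier levels first, and spine vertices before the others of their level.
  let key : Fin n → ℕ := fun y => ∑ r ∈ Finset.range (i + 1), (if y ∈ V (r + 2) then 2 else 0) +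
    if ∃ r < i, v r = y then 1 else 0
  have hkey_ge : ∀ {y r}, r ≤ i → y ∈ V (r + 2) → 2 * (i + 1 - r) ≤
      ∑ r ∈ Finset.range (i + 1), (if y ∈ V (r + 2) then 2 else 0) := by
    intro y r hr hy
    calc 2 * (i + 1 - r) = ∑ _a ∈ Finset.Ico r (i + 1), 2 := by simp [mul_comm]
      _ = ∑ a ∈ Finset.Ico r (i + 1), (if y ∈ V (a + 2) then 2 else 0) := by
        refine Finset.sum_congr rfl fun a ha => ?_
        rw [Finset.mem_Ico] at ha
        rw [if_pos (lowVertices_mono S (by omega) hy)]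
      _ ≤ _ := Finset.sum_le_sum_of_subset fun a ha => by
        rw [Finset.mem_Ico] at ha
        exact Finset.mem_range.2 ha.2
  have hkey_le : ∀ {y r}, r ≤ i + 1 → y ∉ V (r + 1) →
      ∑ r ∈ Finset.range (i + 1), (if y ∈ V (r + 2) then 2 else 0) ≤ 2 * (i + 1 - r) := by
    intro y r hr hy
    calc ∑ r ∈ Finset.range (i + 1), (if y ∈ V (r + 2) then 2 else 0)
        = ∑ a ∈ Finset.Ico r (i + 1), (if y ∈ V (a + 2) then 2 else 0) := by
          refine (Finset.sum_subset (fun a ha => ?_) fun a ha ha' => ?_).symm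
          · rw [Finset.mem_Ico] at ha
            exact Finset.mem_range.2 ha.2
          · rw [Finset.mem_Ico, not_and] at ha'
            rw [Finset.mem_range] at ha
            rw [if_neg fun hcon => hy (lowVertices_mono S (by omega) hcon)]
      _ ≤ ∑ _a ∈ Finset.Ico r (i + 1), 2 :=
        Finset.sum_le_sum fun a _ => by split_ifs <;> omega
      _ = 2 * (i + 1 - r) := by simp [mul_comm]
  have hV2 : ∀ z ∈ V 2, {z} ∈ minNonfaces S 1 := by
    intro z hz
    obtain ⟨g, hg, hzg⟩ := Finset.mem_biUnion.1 hz
    obtain ⟨hg1, hg2⟩ := mem_lowNonfaces.1 hg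
    replace hzg : z ∈ g := hzg
    have hgc : 0 < g.card := Finset.card_pos.2 ⟨z, hzg⟩
    have hg3 : g = {z} := by
      refine (Finset.eq_of_subset_of_card_le (Finset.singleton_subset_iff.2 hzg) ?_).symm
      rw [Finset.card_singleton]
      omega
    rw [hg3, Finset.card_singleton] at hg2
    exact hg2
  refine isColexSegment_of_key (sized_cliques S _) key ?_
  rintro s hsI t htc ⟨z, hzs, hzt, hlt⟩
  have hno : ∀ {j g}, j < i + 2 → g ∈ minNonfaces S j → g ⊆ s → False := by
    intro j g hj hg hgs
    obtain ⟨hs1, hs2⟩ := mem_cliques.1 hsI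
    have hgc := (mem_minNonfaces.1 hg).1
    obtain ⟨x, hx, hxg⟩ := Finset.exists_mem_notMem_of_card_lt_card
      (show g.card < s.card by omega)
    exact (mem_minNonfaces.1 hg).2.2 ((hs2 x hx).mono fun y hy =>
      Finset.mem_erase.2 ⟨fun h => hxg (h ▸ hy), hgs hy⟩)
  refine mem_cliques.2 ⟨htc, fun x hx => ?_⟩
  by_contra hxF
  obtain ⟨e, het, he⟩ := exists_minNonface_subset hxF
  have hec : e.card < i + 2 := by
    have h1 := Finset.card_le_card het
    rw [Finset.card_erase_of_mem hx, htc] at h1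
    omega
  replace het : e ⊆ t := het.trans (Finset.erase_subset _ _)
  -- A vertex of the hyperedge `e ⊆ t` outside `s`; it weighs at most as much as `z`.
  obtain ⟨y, hye, hys⟩ : ∃ y ∈ e, y ∉ s := by
    by_contra! hcon
    exact hno hec he hcon
  have hyz : key y ≤ key z := hlt y (het hye) hys
  have hzV2 : z ∉ V 2 := fun hz => hno (by omega) (hV2 z hz) (Finset.singleton_subset_iff.2 hzs)
  have hspine : ∀ {r y}, y ∈ V (r + 3) → y ∉ V (r + 2) → ∀ r' < i, v r' = y → r' = r := by
    intro r y h1 h2 r' hr' hy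
    have h3 := hs.mem_lowVertices ht le_rfl (j := r' + 3) hr' le_rfl
    have h4 := hs.notMem r' hr'
    rw [hy] at h3 h4
    by_contra hne
    rcases Nat.lt_or_gt_of_ne hne with hlt | hlt
    · exact h2 (lowVertices_mono S (by omega) h3)
    · exact h4 (lowVertices_mono S (by omega) h1)
  obtain ⟨r, hr, hrec⟩ : ∃ r, r < i + 1 ∧ e.card = r + 1 := by
    refine ⟨e.card - 1, by omega, ?_⟩
    have : 0 < e.card := Finset.card_pos.2 ⟨y, hye⟩
    omega
  have hyV : y ∈ V (r + 2) := subset_lowVertices (by omega) he hye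
  have hzV : z ∈ V (r + 2) := by
    by_contra hzV
    have h1 := hkey_ge (r := r) (by omega) hyV
    have h2 := hkey_le (y := z) (r := r + 1) (by omega) hzV
    have h3 : key z ≤ 2 * (i + 1 - (r + 1)) + 1 := by
      simp only [key]
      split_ifs <;> omega
    have h4 : 2 * (i + 1 - r) ≤ key y := le_trans h1 (Nat.le_add_right _ _)
    omega
  -- The level `a + 2` of the first hyperedge through `z`.
  obtain ⟨a, har, haz, haz'⟩ : ∃ a < r, z ∈ V (a + 3) ∧ z ∉ V (a + 2) := by
    clear_value V
    clear hyV hrec hr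
    induction r with
    | zero => exact absurd hzV hzV2
    | succ r ih =>
      by_cases hz : z ∈ V (r + 2)
      · obtain ⟨a, h1, h2⟩ := ih hz
        exact ⟨a, by omega, h2⟩
      · exact ⟨r, by omega, hzV, hz⟩
  obtain ⟨r, rfl⟩ : ∃ r', r = r' + 1 := ⟨r - 1, by omega⟩
  rw [hrec] at he
  have hvt : ∀ b ≤ r, v b ∈ t := by
    intro b hb
    rcases Nat.lt_or_ge b r with hb' | hb'
    · have h1 := hs.inter_eq r (by omega) (by omega) e he
      have h2 : v b ∈ e ∩ lowVertices S (r + 2) := by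
        rw [h1]
        exact Finset.mem_image_of_mem v (Finset.mem_range.2 hb')
      exact het (Finset.mem_inter.1 h2).1
    · rw [show b = r by omega]
      exact het (hs.mem r (by omega) e he)
  have hzv : ∀ b ≤ r, z ≠ v b := fun b hb hzb => hzt (hzb ▸ hvt b hb)
  have hkz : key z ≤ 2 * (i - a) := by
    have h1 := hkey_le (y := z) (r := a + 1) (by omega) haz'
    have h2 : ¬ ∃ r < i, v r = z := by
      rintro ⟨r', hr', hz⟩
      have := hspine haz haz' r' hr' hz
      exact hzv r' (by omega) hz.symm
    simp only [key, if_neg h2]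
    omega
  have hvs : ∀ b ≤ a, v b ∈ s := by
    intro b hb
    by_contra hvb
    have h1 := hlt (v b) (hvt b (by omega)) hvb
    have h2 := hkey_ge (y := v b) (r := b + 1) (by omega)
      (hs.mem_lowVertices ht le_rfl (by omega) (by omega))
    have h3 : ∃ r < i, v r = v b := ⟨b, by omega, rfl⟩
    have h4 : key (v b) = ∑ r ∈ Finset.range (i + 1), (if v b ∈ V (r + 2) then 2 else 0) + 1 := by
      simp only [key, if_pos h3]
    omega
  rw [hV, show a + 3 = (a + 2) + 1 by rfl, lowVertices_succ, Finset.mem_union,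
    Finset.mem_biUnion] at haz
  obtain ⟨f, hf, hzf⟩ := haz.resolve_left haz'
  simp only [id] at hzf
  refine hno (by omega) hf fun x hxf => ?_
  by_cases hxV : x ∈ V (a + 2)
  · have h1 : x ∈ f ∩ lowVertices S (a + 2) := Finset.mem_inter.2 ⟨hxf, hxV⟩
    rw [hs.inter_eq a (by omega) (by omega) f hf] at h1
    obtain ⟨b, hb, rfl⟩ := Finset.mem_image.1 h1
    exact hvs b (Finset.mem_range.1 hb).le
  · have h1 := Finset.card_sdiff_add_card_inter f (V (a + 2))
    rw [(mem_minNonfaces.1 hf).1, (ht a (by omega)).card_inter f hf] at h1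
    have h2 : f \ V (a + 2) = {v a, z} := by
      refine (Finset.eq_of_subset_of_card_le ?_ ?_).symm
      · intro x hx
        rcases Finset.mem_insert.1 hx with rfl | hx
        · exact Finset.mem_sdiff.2 ⟨hs.mem a (by omega) f hf, hs.notMem a (by omega)⟩
        · rw [Finset.mem_singleton.1 hx]
          exact Finset.mem_sdiff.2 ⟨hzf, haz'⟩
      · rw [Finset.card_pair (hzv a (by omega)).symm]
        omega
    have h3 : x ∈ f \ V (a + 2) := Finset.mem_sdiff.2 ⟨hxf, hxV⟩
    rw [h2, Finset.mem_insert, Finset.mem_singleton] at h3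
    rcases h3 with rfl | rfl
    · exact hvs a le_rfl
    · exact hzs

/-! ### An upper bound for the number of extremal families not obtained from a colex segment -/

/-- The families of `k`-subsets of `Fin n` with the prescribed size and the prescribed size of the
shadow. -/
def extremalSet (τ : ℕ → ℕ) (n k : ℕ) : Set (Finset (Finset (Fin n))) :=
  {S | (S : Set (Finset (Fin n))).Sized k ∧ S.card = faceCount τ n k ∧
    (∂ S).card = faceCount τ n (k - 1)}

lemma mem_shadow_iterate_iff_isFace {α : Type*} [DecidableEq α] {S : Finset (Finset α)} {k : ℕ}
    (hS : (S : Set (Finset α)).Sized k) {e : Finset α} (he : e.card ≤ k) :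
    e ∈ ∂^[k - e.card] S ↔ IsFace S e := by
  rw [Finset.mem_shadow_iterate_iff_exists_mem_card_add]
  constructor
  · rintro ⟨s, hs, hes, -⟩
    exact ⟨s, hs, hes⟩
  · rintro ⟨s, hs, hes⟩
    exact ⟨s, hs, hes, by rw [hS hs]; omega⟩

/-- Sets all of whose maximal proper subsets are faces, but which do not belong to the family
themselves, are hyperedges. -/
lemma isHyperedge_of_mem_cliques {n k : ℕ} (hk : 0 < k) {S : Finset (Finset (Fin n))}
    (hS : (S : Set (Finset (Fin n))).Sized k) {x : Finset (Fin n)} (hx : x ∈ cliques S k)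
    (hxS : x ∉ S) : IsHyperedge n k S x := by
  obtain ⟨hxk, hx'⟩ := mem_cliques.1 hx
  refine ⟨⟨by omega, hxk.le, ?_⟩, ?_⟩
  · rw [hxk, Nat.sub_self]
    exact hxS
  · rintro y ⟨-, hy2, hy3⟩ hyx
    rw [mem_shadow_iterate_iff_isFace hS hy2] at hy3
    by_contra hxy
    obtain ⟨a, ha, hay⟩ := Finset.not_subset.1 hxy
    exact hy3 ((hx' a ha).mono fun b hb => Finset.mem_erase.2 ⟨fun h => hay (h ▸ hb), hyx hb⟩)

lemma isColexMinusEdges_of_cliques {n k : ℕ} (hk : 0 < k) {S : Finset (Finset (Fin n))}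
    (hS : (S : Set (Finset (Fin n))).Sized k) (h : IsColexSegment n k (cliques S k)) :
    IsColexMinusEdges n k S := by
  refine ⟨cliques S k, h, fun s hs => mem_cliques.2 ⟨hS hs, fun x _ => ?_⟩, fun x hx => ?_⟩
  · exact ⟨s, hs, Finset.erase_subset _ _⟩
  · rw [Finset.mem_sdiff] at hx
    exact isHyperedge_of_mem_cliques hk hS hx.1 hx.2

/-- A family is determined by its hyperedges. -/
lemma mem_iff_forall_hyperedge {α : Type*} [DecidableEq α] [Fintype α] {S : Finset (Finset α)}
    {k : ℕ} (hS : (S : Set (Finset α)).Sized k) (s : Finset α) :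
    s ∈ S ↔ s.card = k ∧ ∀ g ∈ lowNonfaces S k ∪ minNonfaces S k, ¬ g ⊆ s := by
  constructor
  · intro hs
    refine ⟨hS hs, fun g hg hgs => ?_⟩
    have hgF : ¬ IsFace S g := by
      rcases Finset.mem_union.1 hg with hg | hg
      · exact (mem_minNonfaces.1 (mem_lowNonfaces.1 hg).2).2.2
      · exact (mem_minNonfaces.1 hg).2.2
    exact hgF ⟨s, hs, hgs⟩
  · rintro ⟨hsk, hs⟩
    by_contra hsS
    have hsF : ¬ IsFace S s := fun ⟨s', hs', hss'⟩ => hsS (by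
      rwa [Finset.eq_of_subset_of_card_le hss' (by rw [hS hs', hsk])])
    obtain ⟨g, hgs, hg⟩ := exists_minNonface_subset hsF
    refine hs g ?_ hgs
    have hle := Finset.card_le_card hgs
    rcases Nat.lt_or_ge g.card k with hlt | hge
    · exact Finset.mem_union_left _ (mem_lowNonfaces.2 ⟨hlt, hg⟩)
    · rw [show g.card = k by omega] at hg
      exact Finset.mem_union_right _ hg

open Classical in
/-- The number of families with given numbers of vertices of hyperedges of size less than `k`, and
of hyperedges of size `k`. -/
lemma card_filter_families_le (n k w h : ℕ) :
    (Finset.univ.filter (fun S : Finset (Finset (Fin n)) =>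
      (S : Set (Finset (Fin n))).Sized k ∧ (lowVertices S k).card = w ∧
        (minNonfaces S k).card = h)).card ≤ 2 ^ 2 ^ w * n ^ (w + k * h) := by
  let T : Finset (Σ _ : Finset (Fin n), Finset (Finset (Fin n)) × Finset (Finset (Fin n))) :=
    (Finset.univ.powersetCard w).sigma fun W => W.powerset.powerset ×ˢ
      ((Finset.univ.powersetCard k : Finset (Finset (Fin n))).powersetCard h)
  have h1 : T.card = n.choose w * (2 ^ 2 ^ w * (n.choose k).choose h) := by
    rw [Finset.card_sigma]
    rw [Finset.sum_congr rfl (g := fun _ => 2 ^ 2 ^ w * (n.choose k).choose h)]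
    · simp
    · intro W hW
      rw [Finset.card_product, Finset.card_powerset, Finset.card_powerset,
        Finset.card_powersetCard, Finset.card_powersetCard, (Finset.mem_powersetCard.1 hW).2]
      simp
  calc _ ≤ T.card := by
        refine Finset.card_le_card_of_injOn
          (fun S => ⟨lowVertices S k, lowNonfaces S k, minNonfaces S k⟩) ?_ ?_
        · intro S hS
          simp only [Finset.coe_filter, Finset.mem_univ, true_and, Set.mem_ofPred_eq] at hS
          simp only [T, Finset.mem_coe, Finset.mem_sigma, Finset.mem_product,
            Finset.mem_powersetCard, Finset.mem_powerset]
          refine ⟨⟨Finset.subset_univ _, hS.2.1⟩, fun g hg => ?_, fun g hg => ?_, hS.2.2⟩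
          · exact Finset.mem_powerset.2 (Finset.subset_biUnion_of_mem id hg)
          · exact Finset.mem_powersetCard.2 ⟨Finset.subset_univ _, (mem_minNonfaces.1 hg).1⟩
        · intro S hS S' hS' hSS'
          simp only [Finset.coe_filter, Finset.mem_univ, true_and, Set.mem_ofPred_eq] at hS hS'
          simp only [Sigma.mk.injEq, heq_eq_eq, Prod.mk.injEq] at hSS'
          ext s
          rw [mem_iff_forall_hyperedge hS.1, mem_iff_forall_hyperedge hS'.1, hSS'.2.1, hSS'.2.2]
    _ = 2 ^ 2 ^ w * (n.choose w * (n.choose k).choose h) := by rw [h1]; ring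
    _ ≤ 2 ^ 2 ^ w * (n ^ w * (n ^ k) ^ h) := by
        refine Nat.mul_le_mul_left _ (Nat.mul_le_mul (Nat.choose_le_pow _ _) ?_)
        exact (Nat.choose_le_pow _ _).trans (Nat.pow_le_pow_left (Nat.choose_le_pow _ _) _)
    _ = _ := by rw [← pow_mul, ← pow_add]

/-- The exponent of `n` in the number of extremal families: a colex segment whose size has the
coefficients with indices at most `i` is determined by `τ i + i` vertices, and
`τ (i + 1) - τ i` sets of size `i + 2` are removed from it. -/
def growthExponent (τ : ℕ → ℕ) (i : ℕ) : ℕ := τ i + i + (i + 2) * (τ (i + 1) - τ i)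

lemma isFaceExtremal_of_mem {τ : ℕ → ℕ} (hτ : StrictMono τ) {n i : ℕ}
    (hn : 2 * τ (i + 2) + 2 * (i + 2) + 3 ≤ n) {S : Finset (Finset (Fin n))}
    (hS : S ∈ extremalSet τ n (i + 2)) : IsFaceExtremal τ S (i + 2) := by
  refine ⟨hτ, by rwa [Fintype.card_fin], fun j hj => ?_⟩
  rw [Fintype.card_fin]
  exact card_faces_eq_faceCount hτ (i + 1) n (by
    have h : i + 1 + 1 = i + 2 := rfl
    rw [h]
    omega) S hS.1 hS.2.1 hS.2.2 j hj

/-- An extremal family that does not come from a colex segment has strictly fewer degrees of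
freedom. -/
lemma card_lowVertices_add_lt {τ : ℕ → ℕ} (hτ : StrictMono τ) {n i : ℕ}
    (hn : 2 * τ (i + 2) + 2 * (i + 2) + 3 ≤ n) {S : Finset (Finset (Fin n))}
    (hS : S ∈ extremalSet τ n (i + 2)) (hS' : ¬ IsColexMinusEdges n (i + 2) S) :
    (lowVertices S (i + 2)).card + (i + 2) * (minNonfaces S (i + 2)).card <
      growthExponent τ i := by
  have hF := isFaceExtremal_of_mem hτ hn hS
  have h1 := hF.card_lowVertices_le (i := i) le_rfl
  have h2 := hF.card_add_loss (i := i) le_rfl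
  have h3 : τ (i + 1) - τ i = (minNonfaces S (i + 2)).card + loss τ S i := by omega
  unfold growthExponent
  rw [h3, mul_add]
  rcases Nat.eq_zero_or_pos (loss τ S i) with hl | hl
  · have h4 : (lowVertices S (i + 2)).card ≠ τ i + i := fun hv =>
      hS' (isColexMinusEdges_of_cliques (by omega) hS.1 (isColexSegment_cliques hF le_rfl hl hv))
    omega
  · have h4 : 2 * loss τ S i ≤ (i + 2) * loss τ S i := Nat.mul_le_mul_right _ (by omega)
    omega

/-- The families not coming from a colex segment number `O(n ^ (growthExponent - 1))`. -/
lemma mul_ncard_not_isColexMinusEdges_le {τ : ℕ → ℕ} (hτ : StrictMono τ) {n i : ℕ}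
    (hn : 2 * τ (i + 2) + 2 * (i + 2) + 3 ≤ n) :
    n * {S ∈ extremalSet τ n (i + 2) | ¬ IsColexMinusEdges n (i + 2) S}.ncard ≤
      growthExponent τ i * growthExponent τ i * 2 ^ 2 ^ growthExponent τ i *
        n ^ growthExponent τ i := by
  classical
  set X := growthExponent τ i with hX
  let P : Finset (ℕ × ℕ) := (Finset.range X ×ˢ Finset.range X).filter
    (fun p => p.1 + (i + 2) * p.2 < X)
  let F : ℕ × ℕ → Finset (Finset (Finset (Fin n))) := fun p =>
    Finset.univ.filter (fun S : Finset (Finset (Fin n)) =>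
      (S : Set (Finset (Fin n))).Sized (i + 2) ∧ (lowVertices S (i + 2)).card = p.1 ∧
        (minNonfaces S (i + 2)).card = p.2)
  have hsub : {S ∈ extremalSet τ n (i + 2) | ¬ IsColexMinusEdges n (i + 2) S} ⊆
      (P.biUnion F : Set (Finset (Finset (Fin n)))) := by
    rintro S ⟨hS, hS'⟩
    have hlt := card_lowVertices_add_lt hτ hn hS hS'
    rw [← hX] at hlt
    have hle : (minNonfaces S (i + 2)).card ≤ (i + 2) * (minNonfaces S (i + 2)).card :=
      Nat.le_mul_of_pos_left _ (by omega)
    rw [Finset.mem_coe, Finset.mem_biUnion]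
    refine ⟨((lowVertices S (i + 2)).card, (minNonfaces S (i + 2)).card), ?_, ?_⟩
    · simp only [P, Finset.mem_filter, Finset.mem_product, Finset.mem_range]
      omega
    · simp only [F, Finset.mem_filter, Finset.mem_univ, true_and, and_self, and_true]
      exact hS.1
  have h1 := Set.ncard_le_ncard hsub (Finset.finite_toSet _)
  rw [Set.ncard_coe_finset] at h1
  have hn0 : 0 < n := by omega
  calc n * _ ≤ n * (P.biUnion F).card := Nat.mul_le_mul_left _ h1
    _ ≤ n * ∑ p ∈ P, (F p).card := Nat.mul_le_mul_left _ Finset.card_biUnion_le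
    _ = ∑ p ∈ P, n * (F p).card := Finset.mul_sum _ _ _
    _ ≤ ∑ _p ∈ P, 2 ^ 2 ^ X * n ^ X := by
        refine Finset.sum_le_sum fun p hp => ?_
        have hp' : p.1 + (i + 2) * p.2 < X := (Finset.mem_filter.1 hp).2
        calc n * (F p).card ≤ n * (2 ^ 2 ^ p.1 * n ^ (p.1 + (i + 2) * p.2)) :=
              Nat.mul_le_mul_left _ (card_filter_families_le n (i + 2) p.1 p.2)
          _ = 2 ^ 2 ^ p.1 * n ^ (p.1 + (i + 2) * p.2 + 1) := by ring
          _ ≤ 2 ^ 2 ^ X * n ^ X := by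
              refine Nat.mul_le_mul ?_ (Nat.pow_le_pow_right hn0 hp')
              exact Nat.pow_le_pow_right (by omega) (Nat.pow_le_pow_right (by omega) (by omega))
    _ = P.card * (2 ^ 2 ^ X * n ^ X) := by rw [Finset.sum_const, smul_eq_mul]
    _ ≤ (X * X) * (2 ^ 2 ^ X * n ^ X) := by
        refine Nat.mul_le_mul_right _ ((Finset.card_filter_le _ _).trans ?_)
        rw [Finset.card_product, Finset.card_range]
    _ = _ := by ring

/-! ### A lower bound for the number of extremal families obtained from a colex segment -/

section Segment

variable {M : ℕ} {c : ℕ → ℕ}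

lemma notMem_cascadeSet {m : ℕ} (hM : c m < M) (hc : ∀ a b, a < b → b ≤ m → c b < c a) :
    (⟨c m, hM⟩ : Fin M) ∉ cascadeSet M c m := by
  rw [mem_cascadeSet]
  rintro ⟨a, ha, h⟩
  exact absurd h (hc a m ha le_rfl).ne'

lemma cascadeSet_succ {m : ℕ} (hM : c m < M) :
    cascadeSet M c (m + 1) = insert ⟨c m, hM⟩ (cascadeSet M c m) := by
  ext x
  simp only [mem_cascadeSet, Finset.mem_insert]
  constructor
  · rintro ⟨a, ha, h⟩
    rcases Nat.lt_or_ge a m with h' | h'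
    · exact Or.inr ⟨a, h', h⟩
    · left
      rw [Fin.ext_iff, ← h, show a = m by omega]
  · rintro (rfl | ⟨a, ha, h⟩)
    · exact ⟨m, by omega, rfl⟩
    · exact ⟨a, by omega, h⟩

/-- Adding a point up to `c m` to a set of an initial segment stays in the next one. -/
lemma insert_mem_initSeg {m : ℕ} (hM : ∀ a ≤ m, c a < M)
    (hc : ∀ a b, a < b → b ≤ m → c b < c a) {f : Finset (Fin M)} {x : Fin M}
    (hf : f ∈ Finset.Colex.initSeg (cascadeSet M c m)) (hx : (x : ℕ) ≤ c m) (hxf : x ∉ f) :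
    insert x f ∈ Finset.Colex.initSeg (cascadeSet M c (m + 1)) := by
  have hcm := notMem_cascadeSet (hM m le_rfl) hc
  rw [Finset.Colex.mem_initSeg] at hf ⊢
  rw [cascadeSet_succ (hM m le_rfl), Finset.card_insert_of_notMem hcm,
    Finset.card_insert_of_notMem hxf, hf.1]
  refine ⟨rfl, ?_⟩
  rcases hf.2.eq_or_lt with heq | hlt
  · rw [toColex_inj] at heq
    subst heq
    exact (Finset.Colex.insert_le_insert hxf hcm).2 hx
  · obtain ⟨z, hz, hzf, hlt⟩ := Finset.Colex.toColex_lt_toColex_iff_exists_forall_lt.1 hlt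
    have hxz : x < z := by
      obtain ⟨a, ha, h⟩ := mem_cascadeSet.1 hz
      rw [Fin.lt_def, ← h]
      exact lt_of_le_of_lt hx (hc a m ha le_rfl)
    refine (Finset.Colex.toColex_lt_toColex_iff_exists_forall_lt.2
      ⟨z, Finset.mem_insert_of_mem hz, ?_, fun b hb hb' => ?_⟩).le
    · rw [Finset.mem_insert, not_or]
      exact ⟨hxz.ne', hzf⟩
    · rcases Finset.mem_insert.1 hb with rfl | hb
      · exact hxz
      · exact hlt b hb fun h => hb' (Finset.mem_insert_of_mem h)

/-- The points that cannot be added to every member of the shadow of `G` within `G`. -/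
def nonConePoints {α : Type*} [DecidableEq α] [Fintype α] (G : Finset (Finset α)) : Finset α :=
  Finset.univ.filter (fun x => ∃ f ∈ ∂ G, x ∉ f ∧ insert x f ∉ G)

lemma nonConePoints_image {α : Type*} [DecidableEq α] [Fintype α] (G : Finset (Finset α))
    (σ : Equiv.Perm α) :
    nonConePoints (G.image (fun s => s.image σ)) = (nonConePoints G).image σ := by
  have hinj : Function.Injective (fun s : Finset α => s.image σ) :=
    Finset.image_injective σ.injective
  ext x
  obtain ⟨x, rfl⟩ := σ.surjective x
  simp only [nonConePoints, Finset.mem_filter, Finset.mem_univ, true_and,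
    shadow_image_image σ.injective, Finset.mem_image, σ.injective.eq_iff, exists_eq_right]
  constructor
  · rintro ⟨_, ⟨f, hf, rfl⟩, hx, hxG⟩
    refine ⟨f, hf, fun h => hx (Finset.mem_image_of_mem σ h), fun h => hxG ⟨_, h, ?_⟩⟩
    rw [Finset.image_insert]
  · rintro ⟨f, hf, hx, hxG⟩
    refine ⟨_, ⟨f, hf, rfl⟩, fun h => hx ?_, ?_⟩
    · obtain ⟨y, hy, h⟩ := Finset.mem_image.1 h
      rwa [← σ.injective h]
    · rintro ⟨s, hs, h⟩
      rw [← Finset.image_insert] at h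
      rw [hinj h] at hs
      exact hxG hs

lemma nonConePoints_initSeg {m : ℕ} (hM : ∀ a ≤ m, c a < M)
    (hc : ∀ a b, a < b → b ≤ m → c b + 1 < c a) :
    nonConePoints (Finset.Colex.initSeg (cascadeSet M c (m + 1))) =
      Finset.univ.filter (fun x : Fin M => c m < x) := by
  have hc' : ∀ a b, a < b → b ≤ m → c b < c a := fun a b hab hb => by
    have := hc a b hab hb
    omega
  ext x
  simp only [nonConePoints, Finset.mem_filter, Finset.mem_univ, true_and]
  rw [shadow_initSeg_cascadeSet (fun a ha => hM a (by omega))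
    (fun a b hab hb => hc' a b hab (by omega))]
  constructor
  · rintro ⟨f, hf, hx, hxG⟩
    by_contra! hcon
    exact hxG (insert_mem_initSeg hM hc' hf hcon hx)
  · intro hx
    have hcm := notMem_cascadeSet (hM m le_rfl) hc'
    by_cases hxc : x ∈ cascadeSet M c m
    · -- Replace the point `x = c a` by `c a - 1`.
      obtain ⟨a, ha, hax⟩ := mem_cascadeSet.1 hxc
      have hy : c a - 1 < M := by
        have := hM a ha.le
        omega
      have hgap := hc a m ha le_rfl
      set y : Fin M := ⟨c a - 1, hy⟩ with hydef
      have hyc : y ∉ cascadeSet M c m := by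
        rw [mem_cascadeSet]
        rintro ⟨b, hb, h⟩
        simp only [hydef] at h
        rcases lt_trichotomy a b with hab | rfl | hab
        · have := hc a b hab hb.le
          omega
        · omega
        · have := hc b a hab ha.le
          omega
      have hyx : y < x := by
        rw [Fin.lt_def, ← hax]
        simp only [hydef]
        omega
      set f := insert y ((cascadeSet M c m).erase x) with hf
      have hye : y ∉ (cascadeSet M c m).erase x := fun h => hyc (Finset.mem_of_mem_erase h)
      refine ⟨f, ?_, ?_, ?_⟩
      · rw [Finset.Colex.mem_initSeg]
        constructor
        · rw [hf, Finset.card_insert_of_notMem hye, Finset.card_erase_add_one hxc]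
        · have h := (Finset.Colex.insert_le_insert hye (Finset.notMem_erase x _)).2 hyx.le
          rwa [Finset.insert_erase hxc] at h
      · rw [hf, Finset.mem_insert, not_or]
        exact ⟨hyx.ne', Finset.notMem_erase _ _⟩
      · rw [Finset.Colex.mem_initSeg, hf, Finset.insert_comm, Finset.insert_erase hxc,
          cascadeSet_succ (hM m le_rfl)]
        rintro ⟨-, h⟩
        have h1 := (Finset.Colex.insert_le_insert hyc hcm).1 h
        rw [Fin.le_def] at h1
        simp only [hydef] at h1
        omega
    · refine ⟨cascadeSet M c m, Finset.Colex.mem_initSeg_self, hxc, ?_⟩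
      rw [Finset.Colex.mem_initSeg, cascadeSet_succ (hM m le_rfl)]
      rintro ⟨-, h⟩
      have h1 := (Finset.Colex.insert_le_insert hxc hcm).1 h
      rw [Fin.le_def] at h1
      simp only at h1
      omega

end Segment

lemma exists_perm_image_eq {α : Type*} [DecidableEq α] [Fintype α] {T W : Finset α}
    (h : T.card = W.card) : ∃ σ : Equiv.Perm α, T.image σ = W := by
  let e : {x // x ∈ T} ≃ {x // x ∈ W} := Finset.equivOfCardEq h
  refine ⟨e.extendSubtype, Finset.eq_of_subset_of_card_le ?_ ?_⟩
  · intro y hy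
    obtain ⟨x, hx, rfl⟩ := Finset.mem_image.1 hy
    exact e.extendSubtype_mem x hx
  · rw [Finset.card_image_of_injective _ (Equiv.injective _), h]

/-- The coefficients of the colex segment from which the extremal families arise by deletions. -/
def segmentCoeff (τ : ℕ → ℕ) (n i r : ℕ) : ℕ :=
  if r ≤ i then coeff τ n r else coeff τ n i - 1

/-- The standard colex segment from which extremal families arise by deletions. -/
def stdSegment (τ : ℕ → ℕ) (n i : ℕ) : Finset (Finset (Fin n)) :=
  Finset.Colex.initSeg (cascadeSet n (segmentCoeff τ n i) (i + 2))

section StdSegment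

variable {τ : ℕ → ℕ} {n i : ℕ}

lemma coeff_gap (hτ : StrictMono τ) (hn : 2 * τ (i + 2) + 2 * (i + 2) + 3 ≤ n) {a b : ℕ}
    (hab : a < b) (hb : b ≤ i + 2) : coeff τ n b + 1 < coeff τ n a :=
  coeff_lt_coeff hτ hab (by have := hτ.monotone hb; omega)

lemma coeff_lt (hn : 2 * τ (i + 2) + 2 * (i + 2) + 3 ≤ n) (a : ℕ) : coeff τ n a < n := by
  unfold coeff
  omega

lemma segmentCoeff_lt (hn : 2 * τ (i + 2) + 2 * (i + 2) + 3 ≤ n) (a : ℕ) :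
    segmentCoeff τ n i a < n := by
  have h1 := coeff_lt (τ := τ) hn a
  have h2 := coeff_lt (τ := τ) hn i
  unfold segmentCoeff
  split_ifs <;> omega

lemma segmentCoeff_anti (hτ : StrictMono τ) (hn : 2 * τ (i + 2) + 2 * (i + 2) + 3 ≤ n) {a b : ℕ}
    (hab : a < b) (hb : b < i + 2) : segmentCoeff τ n i b < segmentCoeff τ n i a := by
  have h0 := coeff_gap hτ hn (show i < i + 1 by omega) (by omega)
  unfold segmentCoeff
  split_ifs with h1 h2
  · have := coeff_gap hτ hn hab (by omega)
    omega
  · omega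
  · rcases Nat.lt_or_ge a i with h | h
    · have := coeff_gap hτ hn h (by omega)
      omega
    · rw [show a = i by omega]
      omega
  · omega

lemma cascadeSet_segmentCoeff {m : ℕ} (hm : m ≤ i + 1) :
    cascadeSet n (segmentCoeff τ n i) m = cascadeSet n (coeff τ n) m := by
  ext x
  simp only [mem_cascadeSet]
  refine exists_congr fun a => and_congr_right fun ha => ?_
  rw [segmentCoeff, if_pos (by omega)]

lemma shadow_stdSegment (hτ : StrictMono τ) (hn : 2 * τ (i + 2) + 2 * (i + 2) + 3 ≤ n) :
    ∂ (stdSegment τ n i) = Finset.Colex.initSeg (cascadeSet n (coeff τ n) (i + 1)) := by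
  rw [stdSegment, shadow_initSeg_cascadeSet (k := i + 1) (fun a _ => segmentCoeff_lt hn a)
    (fun a b hab hb => segmentCoeff_anti hτ hn hab hb), cascadeSet_segmentCoeff le_rfl]

lemma card_shadow_stdSegment (hτ : StrictMono τ) (hn : 2 * τ (i + 2) + 2 * (i + 2) + 3 ≤ n) :
    (∂ (stdSegment τ n i)).card = faceCount τ n (i + 1) := by
  rw [shadow_stdSegment hτ hn, card_initSeg_cascadeSet (fun a _ => coeff_lt hn a), faceCount]
  intro a b hab hb
  have := coeff_gap hτ hn hab (by omega)
  omega

lemma card_stdSegment (hτ : StrictMono τ) (hn : 2 * τ (i + 2) + 2 * (i + 2) + 3 ≤ n) :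
    (stdSegment τ n i).card = faceCount τ n (i + 2) + (τ (i + 1) - τ i) := by
  rw [stdSegment, card_initSeg_cascadeSet (fun a _ => segmentCoeff_lt hn a)
    (fun a b hab hb => segmentCoeff_anti hτ hn hab hb), faceCount, cascade, cascade,
    Finset.sum_range_succ, Finset.sum_range_succ (fun r => (coeff τ n r).choose (i + 2 - r))]
  have h1 : ∑ r ∈ Finset.range (i + 1), (segmentCoeff τ n i r).choose (i + 2 - r) =
      ∑ r ∈ Finset.range (i + 1), (coeff τ n r).choose (i + 2 - r) := by
    refine Finset.sum_congr rfl fun r hr => ?_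
    have := Finset.mem_range.1 hr
    rw [segmentCoeff, if_pos (by omega)]
  rw [h1, show i + 2 - (i + 1) = 1 by omega, Nat.choose_one_right, Nat.choose_one_right,
    segmentCoeff, if_neg (by omega)]
  have h2 := hτ (show i < i + 1 by omega)
  have h3 := hτ (show i + 1 < i + 2 by omega)
  unfold coeff
  omega

lemma sized_stdSegment (hτ : StrictMono τ) (hn : 2 * τ (i + 2) + 2 * (i + 2) + 3 ≤ n) :
    (stdSegment τ n i : Set (Finset (Fin n))).Sized (i + 2) := by
  intro s hs
  rw [← (Finset.Colex.mem_initSeg.1 (Finset.mem_coe.1 hs)).1]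
  exact card_cascadeSet (fun a _ => segmentCoeff_lt hn a)
    (fun a b hab hb => segmentCoeff_anti hτ hn hab hb)

/-- Every member of the shadow lies in too many members of the segment for a bounded number of
deletions to remove it from the shadow. -/
lemma shadow_stdSegment_sdiff (hτ : StrictMono τ) (hn : 2 * τ (i + 2) + 2 * (i + 2) + 3 ≤ n)
    {J : Finset (Finset (Fin n))} (hJ : J.card = τ (i + 1) - τ i) :
    ∂ (stdSegment τ n i \ J) = ∂ (stdSegment τ n i) := by
  refine Finset.Subset.antisymm (Finset.shadow_mono Finset.sdiff_subset) ?_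
  intro f hf
  have hfc : f.card = i + 1 := (sized_stdSegment hτ hn).shadow hf
  rw [shadow_stdSegment hτ hn] at hf
  set Y : Finset (Fin n) := Finset.univ.filter (fun y => (y : ℕ) < coeff τ n i ∧ y ∉ f) with hY
  have hYc : coeff τ n i ≤ Y.card + (i + 1) := by
    have h1 : (Finset.univ.filter (fun y : Fin n => (y : ℕ) < coeff τ n i)).card =
        coeff τ n i := by
      rw [Fin.card_filter_val_lt]
      exact min_eq_right (coeff_lt hn i).le
    have h2 : Finset.univ.filter (fun y : Fin n => (y : ℕ) < coeff τ n i) ⊆ Y ∪ f := by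
      intro y hy
      simp only [hY, Finset.mem_union, Finset.mem_filter, Finset.mem_univ, true_and] at hy ⊢
      tauto
    have h3 := (Finset.card_le_card h2).trans (Finset.card_union_le _ _)
    omega
  have hYI : ∀ y ∈ Y, insert y f ∈ stdSegment τ n i := by
    intro y hy
    simp only [hY, Finset.mem_filter, Finset.mem_univ, true_and] at hy
    refine insert_mem_initSeg (m := i + 1) (fun a _ => segmentCoeff_lt hn a)
      (fun a b hab hb => segmentCoeff_anti hτ hn hab (by omega)) ?_ ?_ hy.2
    · rwa [cascadeSet_segmentCoeff le_rfl]
    · rw [segmentCoeff, if_neg (by omega)]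
      omega
  have hlt : J.card < (Y.image (fun y => insert y f)).card := by
    rw [Finset.card_image_of_injOn, hJ]
    · have h2 := hτ (show i < i + 1 by omega)
      have h3 := hτ (show i + 1 < i + 2 by omega)
      unfold coeff at hYc
      omega
    · intro y hy z hz hyz
      have hy : y ∉ f := by
        have := (Finset.mem_filter.1 (Finset.mem_coe.1 hy)).2
        exact this.2
      have : y ∈ insert z f := by
        simp only at hyz
        rw [← hyz]
        exact Finset.mem_insert_self _ _
      exact (Finset.mem_insert.1 this).resolve_right hy
  obtain ⟨s, hs, hsJ⟩ := Finset.exists_mem_notMem_of_card_lt_card hlt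
  obtain ⟨y, hy, rfl⟩ := Finset.mem_image.1 hs
  have hyf : y ∉ f := ((Finset.mem_filter.1 hy).2).2
  exact Finset.mem_shadow_iff_insert_mem.2 ⟨y, hyf, Finset.mem_sdiff.2 ⟨hYI y hy, hsJ⟩⟩

/-- The vertices lying in hyperedges of the standard segment of size less than `i + 2`. -/
def topPoints (τ : ℕ → ℕ) (n i : ℕ) : Finset (Fin n) :=
  Finset.univ.filter (fun x : Fin n => coeff τ n i < x)

lemma card_topPoints (hτ : StrictMono τ) (hn : 2 * τ (i + 2) + 2 * (i + 2) + 3 ≤ n) :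
    (topPoints τ n i).card = τ i + i := by
  have h1 := Finset.card_filter_add_card_filter_not (s := (Finset.univ : Finset (Fin n)))
    (fun x : Fin n => coeff τ n i < x)
  have h2 : Finset.univ.filter (fun x : Fin n => ¬ coeff τ n i < x) =
      Finset.univ.filter (fun x : Fin n => (x : ℕ) < coeff τ n i + 1) := by
    ext x
    simp only [Finset.mem_filter, Finset.mem_univ, true_and]
    omega
  rw [h2, Fin.card_filter_val_lt, Finset.card_univ, Fintype.card_fin,
    min_eq_right (coeff_lt hn i)] at h1
  have h3 := hτ (show i < i + 2 by omega)
  unfold topPoints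
  unfold coeff at *
  omega

/-- The family obtained from the standard segment by deleting `J` and relabelling is an extremal
family that comes from a colex segment. -/
lemma image_stdSegment_mem (hτ : StrictMono τ) (hn : 2 * τ (i + 2) + 2 * (i + 2) + 3 ≤ n)
    {J : Finset (Finset (Fin n))} (hJI : J ⊆ stdSegment τ n i) (hJ : J.card = τ (i + 1) - τ i)
    (σ : Equiv.Perm (Fin n)) :
    (stdSegment τ n i \ J).image (fun s => s.image σ) ∈ extremalSet τ n (i + 2) ∧
      IsColexMinusEdges n (i + 2) ((stdSegment τ n i \ J).image (fun s => s.image σ)) := by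
  have hinj : Function.Injective (fun s : Finset (Fin n) => s.image σ) :=
    Finset.image_injective σ.injective
  have hsz : ∀ T ⊆ stdSegment τ n i,
      ((T.image (fun s => s.image σ) : Finset (Finset (Fin n))) : Set (Finset (Fin n))).Sized
        (i + 2) := by
    intro T hT t ht
    obtain ⟨s, hs, rfl⟩ := Finset.mem_image.1 (Finset.mem_coe.1 ht)
    rw [Finset.card_image_of_injective _ σ.injective]
    exact sized_stdSegment hτ hn (hT hs)
  have hsh : ∂ ((stdSegment τ n i \ J).image (fun s => s.image σ)) =
      ∂ ((stdSegment τ n i).image (fun s => s.image σ)) := by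
    rw [shadow_image_image σ.injective, shadow_image_image σ.injective,
      shadow_stdSegment_sdiff hτ hn hJ]
  refine ⟨⟨hsz _ Finset.sdiff_subset, ?_, ?_⟩, ?_⟩
  · rw [Finset.card_image_of_injective _ hinj, Finset.card_sdiff_of_subset hJI,
      card_stdSegment hτ hn, hJ]
    omega
  · rw [hsh, shadow_image_image σ.injective, Finset.card_image_of_injective _ hinj,
      card_shadow_stdSegment hτ hn]
    rfl
  · refine ⟨(stdSegment τ n i).image (fun s => s.image σ), ⟨σ⁻¹, ?_⟩,
      Finset.image_subset_image Finset.sdiff_subset, fun x hx => ?_⟩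
    · rw [Finset.image_image]
      have : (fun s : Finset (Fin n) => s.image (σ⁻¹ : Equiv.Perm (Fin n))) ∘
          (fun s => s.image σ) = id := by
        funext s
        simp [Finset.image_image, Function.comp_def]
      rw [this, Finset.image_id]
      have h1 := Finset.Colex.isInitSeg_initSeg (s := cascadeSet n (segmentCoeff τ n i) (i + 2))
      rwa [card_cascadeSet (fun a _ => segmentCoeff_lt hn a)
        (fun a b hab hb => segmentCoeff_anti hτ hn hab hb)] at h1
    · rw [Finset.mem_sdiff] at hx
      refine isHyperedge_of_mem_cliques (by omega) (hsz _ Finset.sdiff_subset) ?_ hx.2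
      refine mem_cliques.2 ⟨hsz _ Finset.Subset.rfl hx.1, fun a ha => ?_⟩
      have h1 := Finset.erase_mem_shadow hx.1 ha
      rw [← hsh] at h1
      obtain ⟨s, hs, hsub⟩ := Finset.exists_subset_of_mem_shadow h1
      exact ⟨s, hs, hsub⟩

lemma choose_mul_choose_le_ncard (hτ : StrictMono τ)
    (hn : 2 * τ (i + 2) + 2 * (i + 2) + 3 ≤ n) :
    n.choose (τ i + i) * (stdSegment τ n i).card.choose (τ (i + 1) - τ i) ≤
      {S ∈ extremalSet τ n (i + 2) | IsColexMinusEdges n (i + 2) S}.ncard := by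
  classical
  have hperm : ∀ W ∈ (Finset.univ : Finset (Fin n)).powersetCard (τ i + i),
      ∃ σ : Equiv.Perm (Fin n), (topPoints τ n i).image σ = W := fun W hW =>
    exists_perm_image_eq ((card_topPoints hτ hn).trans (Finset.mem_powersetCard.1 hW).2.symm)
  choose! σ hσ using hperm
  let D := (Finset.univ : Finset (Fin n)).powersetCard (τ i + i) ×ˢ
    (stdSegment τ n i).powersetCard (τ (i + 1) - τ i)
  let Φ : Finset (Fin n) × Finset (Finset (Fin n)) → Finset (Finset (Fin n)) := fun p =>
    (stdSegment τ n i \ p.2).image (fun s => s.image (σ p.1))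
  have hcard : D.card =
      n.choose (τ i + i) * (stdSegment τ n i).card.choose (τ (i + 1) - τ i) := by
    simp [D, Finset.card_product]
  -- The labelled vertex set is recovered from the shadow, and then so are the deleted sets.
  have hrec : ∀ p ∈ D, nonConePoints (∂ (Φ p)) = p.1 := by
    intro p hp
    obtain ⟨hp1, hp2⟩ := Finset.mem_product.1 hp
    simp only [Φ]
    rw [shadow_image_image (σ p.1).injective, nonConePoints_image,
      shadow_stdSegment_sdiff hτ hn (Finset.mem_powersetCard.1 hp2).2, shadow_stdSegment hτ hn,
      nonConePoints_initSeg (fun a _ => coeff_lt hn a)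
        (fun a b hab hb => coeff_gap hτ hn hab (by omega))]
    exact hσ p.1 hp1
  have hinj : Set.InjOn Φ D := by
    intro p hp q hq hpq
    have h1 : p.1 = q.1 := by rw [← hrec p hp, ← hrec q hq, hpq]
    refine Prod.ext h1 ?_
    simp only [Φ, h1] at hpq
    have h2 := Finset.image_injective (Finset.image_injective (σ q.1).injective) hpq
    rw [← Finset.sdiff_sdiff_eq_self
        (Finset.mem_powersetCard.1 (Finset.mem_product.1 hp).2).1, h2,
      Finset.sdiff_sdiff_eq_self (Finset.mem_powersetCard.1 (Finset.mem_product.1 hq).2).1]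
  rw [← hcard, ← Finset.card_image_of_injOn hinj, ← Set.ncard_coe_finset]
  refine Set.ncard_le_ncard ?_ (Set.toFinite _)
  intro S hS
  obtain ⟨p, hp, rfl⟩ := Finset.mem_image.1 (Finset.mem_coe.1 hS)
  obtain ⟨-, hp2⟩ := Finset.mem_product.1 hp
  obtain ⟨h1, h2⟩ := Finset.mem_powersetCard.1 hp2
  exact image_stdSegment_mem hτ hn h1 h2 _

end StdSegment

lemma pow_le_mul_choose {m r : ℕ} (h : 2 * r ≤ m) : m ^ r ≤ 2 ^ r * r.factorial * m.choose r := by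
  have h1 : (m + 1 - r) ^ r ≤ r.factorial * m.choose r := by
    rw [← Nat.descFactorial_eq_factorial_mul_choose]
    exact Nat.pow_sub_le_descFactorial m r
  calc m ^ r ≤ (2 * (m + 1 - r)) ^ r := Nat.pow_le_pow_left (by omega) _
    _ = 2 ^ r * (m + 1 - r) ^ r := Nat.mul_pow _ _ _
    _ ≤ 2 ^ r * (r.factorial * m.choose r) := Nat.mul_le_mul_left _ h1
    _ = _ := by ring

/-- The number of extremal families from colex segments is at least of order
`n ^ growthExponent`. -/
lemma exists_pow_le_mul_ncard {τ : ℕ → ℕ} (hτ : StrictMono τ) (i : ℕ) :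
    ∃ C : ℕ, ∀ᶠ n in atTop, n ^ growthExponent τ i ≤
      C * {S ∈ extremalSet τ n (i + 2) | IsColexMinusEdges n (i + 2) S}.ncard := by
  set w := τ i + i with hw
  set d := τ (i + 1) - τ i with hd
  set A := 2 ^ (i + 2) * (2 ^ (i + 2) * (i + 2).factorial) with hA
  refine ⟨2 ^ w * w.factorial * (A ^ d * (2 ^ d * d.factorial)), ?_⟩
  filter_upwards [eventually_ge_atTop (2 * τ (i + 2) + 2 * (i + 2) + 3 + 2 * w +
    (2 * τ 0 + 2 + 4 * (i + 2)) + A * (2 * d))] with n hn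
  have hn' : 2 * τ (i + 2) + 2 * (i + 2) + 3 ≤ n := by omega
  set I := (stdSegment τ n i).card with hI
  have h1 : n ^ w ≤ 2 ^ w * w.factorial * n.choose w := pow_le_mul_choose (by omega)
  have h2 : n ^ (i + 2) ≤ A * I := by
    have h3 : (coeff τ n 0).choose (i + 2) ≤ I := by
      rw [hI, card_stdSegment hτ hn', faceCount, show i + 2 = i + 1 + 1 from rfl, cascade_succ']
      omega
    have h4 : n ≤ 2 * coeff τ n 0 := by
      unfold coeff
      omega
    calc n ^ (i + 2) ≤ (2 * coeff τ n 0) ^ (i + 2) := Nat.pow_le_pow_left h4 _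
      _ = 2 ^ (i + 2) * coeff τ n 0 ^ (i + 2) := Nat.mul_pow _ _ _
      _ ≤ 2 ^ (i + 2) * (2 ^ (i + 2) * (i + 2).factorial * (coeff τ n 0).choose (i + 2)) :=
          Nat.mul_le_mul_left _ (pow_le_mul_choose (by unfold coeff; omega))
      _ ≤ 2 ^ (i + 2) * (2 ^ (i + 2) * (i + 2).factorial * I) := by gcongr
      _ = A * I := by rw [hA]; ring
  have h3 : 2 * d ≤ I := by
    have h4 : A * (2 * d) ≤ A * I :=
      calc A * (2 * d) ≤ n := by omega
        _ = n ^ 1 := (pow_one n).symm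
        _ ≤ n ^ (i + 2) := Nat.pow_le_pow_right (by omega) (by omega)
        _ ≤ A * I := h2
    exact Nat.le_of_mul_le_mul_left h4 (by positivity)
  calc n ^ growthExponent τ i = n ^ w * (n ^ (i + 2)) ^ d := by
        rw [growthExponent, pow_add, pow_mul]
    _ ≤ (2 ^ w * w.factorial * n.choose w) * (A ^ d * (2 ^ d * d.factorial * I.choose d)) := by
        refine Nat.mul_le_mul h1 ?_
        calc (n ^ (i + 2)) ^ d ≤ (A * I) ^ d := Nat.pow_le_pow_left h2 _
          _ = A ^ d * I ^ d := Nat.mul_pow _ _ _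
          _ ≤ _ := Nat.mul_le_mul_left _ (pow_le_mul_choose h3)
    _ = 2 ^ w * w.factorial * (A ^ d * (2 ^ d * d.factorial)) * (n.choose w * I.choose d) := by
        ring
    _ ≤ _ := Nat.mul_le_mul_left _ (choose_mul_choose_le_ncard hτ hn')

/-! ### Binomial decompositions -/

lemma sum_choose_lt {ℓ : ℕ} : ∀ {k M : ℕ} {a : Fin ℓ → ℕ}, ℓ ≤ k → StrictAnti a →
    (∀ i : Fin ℓ, k - (i : ℕ) ≤ a i) → (∀ i, a i < M) → k ≤ M →
    ∑ i : Fin ℓ, (a i).choose (k - (i : ℕ)) < M.choose k := by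
  induction ℓ with
  | zero =>
    intro k M a _ _ _ _ hkM
    simpa using Nat.choose_pos hkM
  | succ ℓ ih =>
    intro k M a hℓ ha hka haM _
    obtain ⟨k, rfl⟩ : ∃ k', k = k' + 1 := ⟨k - 1, by omega⟩
    have h0 : k + 1 ≤ a 0 := by simpa using hka 0
    have h1 := ih (k := k) (M := a 0) (a := fun i => a i.succ) (by omega)
      (fun i j hij => ha (Fin.succ_lt_succ_iff.2 hij))
      (fun i => by simpa using hka i.succ) (fun i => ha (Fin.succ_pos i)) (by omega)
    rw [Fin.sum_univ_succ]
    simp only [Fin.val_zero, Nat.sub_zero, Fin.val_succ, Nat.add_sub_add_right]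
    calc _ < (a 0).choose (k + 1) + (a 0).choose k := by omega
      _ = (a 0 + 1).choose (k + 1) := by rw [Nat.choose_succ_succ]; ring
      _ ≤ M.choose (k + 1) := Nat.choose_le_choose _ (haM 0)

/-- Uniqueness of the binomial decomposition, in the form needed here: the Kruskal-Katona bound
depends on the size of the family only. -/
lemma sum_choose_pred_eq {ℓ : ℕ} : ∀ {ℓ' k : ℕ} {a : Fin ℓ → ℕ} {a' : Fin ℓ' → ℕ}, ℓ ≤ k → ℓ' ≤ k →
    StrictAnti a → StrictAnti a' → (∀ i : Fin ℓ, k - (i : ℕ) ≤ a i) →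
    (∀ i : Fin ℓ', k - (i : ℕ) ≤ a' i) →
    ∑ i : Fin ℓ, (a i).choose (k - (i : ℕ)) = ∑ i : Fin ℓ', (a' i).choose (k - (i : ℕ)) →
    ∑ i : Fin ℓ, (a i).choose (k - (i : ℕ) - 1) =
      ∑ i : Fin ℓ', (a' i).choose (k - (i : ℕ) - 1) := by
  have hpos : ∀ {ℓ k : ℕ} {a : Fin (ℓ + 1) → ℕ}, (∀ i : Fin (ℓ + 1), k - (i : ℕ) ≤ a i) →
      0 < ∑ i : Fin (ℓ + 1), (a i).choose (k - (i : ℕ)) := fun h =>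
    Finset.sum_pos (fun i _ => Nat.choose_pos (h i)) Finset.univ_nonempty
  have hlt : ∀ {ℓ ℓ' k : ℕ} {a : Fin (ℓ + 1) → ℕ} {a' : Fin (ℓ' + 1) → ℕ}, ℓ + 1 ≤ k →
      StrictAnti a → (∀ i : Fin (ℓ + 1), k - (i : ℕ) ≤ a i) → a 0 < a' 0 →
      ∑ i : Fin (ℓ + 1), (a i).choose (k - (i : ℕ)) <
        ∑ i : Fin (ℓ' + 1), (a' i).choose (k - (i : ℕ)) := by
    intro ℓ ℓ' k a a' hℓ ha hka h
    have h0 : k ≤ a 0 := by simpa using hka 0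
    refine (sum_choose_lt hℓ ha hka (M := a' 0)
      (fun i => (ha.antitone (Fin.zero_le i)).trans_lt h) (by omega)).trans_le ?_
    rw [Fin.sum_univ_succ]
    simp
  induction ℓ with
  | zero =>
    intro ℓ' k a a' _ _ _ _ _ ha' h
    cases ℓ' with
    | zero => simp
    | succ ℓ' =>
      have := hpos ha'
      rw [← h] at this
      simp at this
  | succ ℓ ih =>
    intro ℓ' k a a' hℓ hℓ' ha ha' hka hka' h
    cases ℓ' with
    | zero =>
      have := hpos hka
      rw [h] at this
      simp at this
    | succ ℓ' =>
      obtain ⟨k, rfl⟩ : ∃ k', k = k' + 1 := ⟨k - 1, by omega⟩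
      have h0 : a 0 = a' 0 := by
        rcases lt_trichotomy (a 0) (a' 0) with h0 | h0 | h0
        · exact absurd h (hlt hℓ ha hka h0).ne
        · exact h0
        · exact absurd h (hlt hℓ' ha' hka' h0).ne'
      rw [Fin.sum_univ_succ, Fin.sum_univ_succ (n := ℓ')] at h ⊢
      simp only [Fin.val_zero, Nat.sub_zero, Fin.val_succ, Nat.add_sub_add_right, h0] at h ⊢
      rw [ih (a' := fun i : Fin ℓ' => a' i.succ) (by omega) (by omega)
        (fun i j hij => ha (Fin.succ_lt_succ_iff.2 hij))
        (fun i j hij => ha' (Fin.succ_lt_succ_iff.2 hij))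
        (fun i => by simpa using hka i.succ) (fun i => by simpa using hka' i.succ)
        (by omega)]

section Prescribed

variable {τ : ℕ → ℕ} {k n : ℕ} {t : Fin k → ℕ}

lemma prescribedCoeff_of_lt (ht : ∀ i, t i = τ i) {i : Fin k} (hi : (i : ℕ) + 1 < k) :
    prescribedCoeff n k t i = coeff τ n i := by
  rw [prescribedCoeff, if_pos hi, ht, coeff]

lemma prescribedCoeff_last (ht : ∀ i, t i = τ i) (hn : 2 * τ k + 2 * k + 3 ≤ n) (hτ : StrictMono τ)
    {i : Fin k} (hi : (i : ℕ) + 1 = k) : prescribedCoeff n k t i = coeff τ n i + 1 := by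
  have := hτ i.2
  rw [prescribedCoeff, if_neg (by omega), ht, coeff]
  omega

lemma isBinomialDecomposition_prescribedCoeff (hk : 0 < k) (ht : ∀ i, t i = τ i)
    (hτ : StrictMono τ) (hn : 2 * τ k + 2 * k + 3 ≤ n) :
    IsBinomialDecomposition k (∑ i : Fin k, (prescribedCoeff n k t i).choose (k - (i : ℕ))) k
      (prescribedCoeff n k t) := by
  refine ⟨hk, le_rfl, fun i j hij => ?_, fun i => ?_, rfl⟩
  · have h1 := hτ hij
    have h2 := hτ j.2
    have h3 : (i : ℕ) < j := hij
    have h4 := j.2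
    unfold prescribedCoeff
    rw [ht, ht, if_pos (show (i : ℕ) + 1 < k by omega)]
    split_ifs <;> omega
  · have h1 := hτ i.2
    have h2 := i.2
    unfold prescribedCoeff
    rw [ht]
    split_ifs <;> omega

lemma sum_choose_prescribedCoeff (hk : 0 < k) (ht : ∀ i, t i = τ i)
    (hτ : StrictMono τ) (hn : 2 * τ k + 2 * k + 3 ≤ n) :
    ∑ i : Fin k, (prescribedCoeff n k t i).choose (k - (i : ℕ)) = faceCount τ n k := by
  obtain ⟨k, rfl⟩ : ∃ k', k = k' + 1 := ⟨k - 1, by omega⟩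
  rw [Fin.sum_univ_castSucc, faceCount, cascade, Finset.sum_range_succ, ← Fin.sum_univ_eq_sum_range
    (fun i => (coeff τ n i).choose (k + 1 - i)), prescribedCoeff_last ht hn hτ (by simp)]
  simp only [Fin.val_last, Nat.add_sub_cancel_left, Nat.choose_one_right, add_assoc]
  congr 1
  refine Finset.sum_congr rfl fun i _ => ?_
  rw [prescribedCoeff_of_lt ht (by simp)]
  simp

lemma sum_choose_pred_prescribedCoeff (hk : 0 < k) (ht : ∀ i, t i = τ i) :
    ∑ i : Fin k, (prescribedCoeff n k t i).choose (k - (i : ℕ) - 1) = faceCount τ n (k - 1) := by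
  obtain ⟨k, rfl⟩ : ∃ k', k = k' + 1 := ⟨k - 1, by omega⟩
  rw [Fin.sum_univ_castSucc, faceCount, cascade, Nat.add_sub_cancel, ← Fin.sum_univ_eq_sum_range
    (fun i => (coeff τ n i).choose (k - i))]
  congr 1
  · refine Finset.sum_congr rfl fun i _ => ?_
    rw [prescribedCoeff_of_lt ht (by simp)]
    simp only [Fin.val_castSucc]
    congr 1
    omega
  · simp

lemma extremalFamilies_eq (hk : 0 < k) (ht : ∀ i, t i = τ i) (hτ : StrictMono τ)
    (hn : 2 * τ k + 2 * k + 3 ≤ n) : extremalFamilies n k t = extremalSet τ n k := by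
  have hdec := isBinomialDecomposition_prescribedCoeff hk ht hτ hn
  have hsum := sum_choose_prescribedCoeff hk ht hτ hn
  have hsum' := sum_choose_pred_prescribedCoeff (n := n) hk ht
  rw [hsum] at hdec
  ext S
  constructor
  · rintro ⟨⟨-, hS, ℓ, a, ⟨-, hℓ, ha, hka, hm⟩, hsh⟩, h⟩
    refine ⟨hS, h.2.2.2.2.trans hsum, ?_⟩
    rw [hsh, ← hsum']
    exact sum_choose_pred_eq hℓ le_rfl ha h.2.2.1 hka h.2.2.2.1 (hm.symm.trans h.2.2.2.2)
  · rintro ⟨hS, hc, hsh⟩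
    rw [← hc] at hdec
    refine ⟨⟨?_, hS, k, _, hdec, hsh.trans hsum'.symm⟩, hdec⟩
    rw [← Finset.card_pos, hc]
    exact faceCount_pos τ n k

end Prescribed

/-! ### The ratio -/

/-- For `k = 1` every extremal family is obtained from the segment of all singletons. -/
lemma isColexMinusEdges_one {n : ℕ} {S : Finset (Finset (Fin n))}
    (hS : (S : Set (Finset (Fin n))).Sized 1) (hne : S.Nonempty) : IsColexMinusEdges n 1 S := by
  refine isColexMinusEdges_of_cliques one_pos hS ⟨1, ?_⟩
  have h1 : (cliques S 1).image (fun s => s.image (1 : Equiv.Perm (Fin n))) = cliques S 1 := by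
    simp
  rw [h1]
  refine ⟨sized_cliques S 1, fun _ t _ ht => mem_cliques.2 ⟨ht.2, fun x hx => ?_⟩⟩
  obtain ⟨s, hs⟩ := hne
  refine ⟨s, hs, ?_⟩
  rw [Finset.card_eq_zero.1 (by simp [Finset.card_erase_of_mem hx, ht.2] : (t.erase x).card = 0)]
  exact Finset.empty_subset _

lemma extremalSet_one_nonempty {τ : ℕ → ℕ} {n : ℕ} (hn : τ 0 + 1 ≤ n) :
    (extremalSet τ n 1).Nonempty := by
  obtain ⟨T, hT⟩ := Finset.exists_subset_card_eq (s := (Finset.univ : Finset (Fin n)))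
    (n := n - τ 0) (by simp)
  have hmem : ∀ s ∈ T.image (fun x : Fin n => ({x} : Finset (Fin n))), s.card = 1 := by
    intro s hs
    obtain ⟨x, -, rfl⟩ := Finset.mem_image.1 hs
    exact Finset.card_singleton x
  refine ⟨T.image fun x => {x}, fun s hs => hmem s hs, ?_, ?_⟩
  · rw [Finset.card_image_of_injective _ Finset.singleton_injective, hT.2, faceCount_one hn]
  · rw [Nat.sub_self, faceCount_zero, Finset.card_eq_one]
    refine ⟨∅, Finset.eq_singleton_iff_unique_mem.2 ⟨?_, fun e he => ?_⟩⟩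
    · obtain ⟨x, hx⟩ : T.Nonempty := by
        rw [← Finset.card_pos, hT.2]
        omega
      exact Finset.mem_shadow_iff.2 ⟨{x}, Finset.mem_image_of_mem _ hx, x, by simp, by simp⟩
    · obtain ⟨s, hs, x, hx, rfl⟩ := Finset.mem_shadow_iff.1 he
      rw [← Finset.card_eq_zero, Finset.card_erase_of_mem hx, hmem s hs]

/-- For `k ≥ 2` the families not obtained from a colex segment are fewer by a factor of
order `n`. -/
lemma tendsto_ncard_div_of_two_le {τ : ℕ → ℕ} (hτ : StrictMono τ) (i : ℕ) :
    Tendsto (fun n : ℕ => ((extremalSet τ n (i + 2)).ncard : ℝ) /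
      ({S ∈ extremalSet τ n (i + 2) | IsColexMinusEdges n (i + 2) S}.ncard : ℝ)) atTop (𝓝 1) := by
  obtain ⟨C, hC⟩ := exists_pow_le_mul_ncard hτ i
  set X := growthExponent τ i with hX
  set A := X * X * 2 ^ 2 ^ X with hA
  have hlim : Tendsto (fun n : ℕ => 1 + ((A * C : ℕ) : ℝ) / n) atTop (𝓝 1) := by
    simpa using (tendsto_const_div_atTop_nhds_zero_nat ((A * C : ℕ) : ℝ)).const_add 1
  have hev : ∀ᶠ n : ℕ in atTop,
      1 ≤ ((extremalSet τ n (i + 2)).ncard : ℝ) /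
        ({S ∈ extremalSet τ n (i + 2) | IsColexMinusEdges n (i + 2) S}.ncard : ℝ) ∧
      ((extremalSet τ n (i + 2)).ncard : ℝ) /
        ({S ∈ extremalSet τ n (i + 2) | IsColexMinusEdges n (i + 2) S}.ncard : ℝ) ≤
        1 + ((A * C : ℕ) : ℝ) / n := by
    filter_upwards [hC, eventually_ge_atTop (2 * τ (i + 2) + 2 * (i + 2) + 3)] with n hn hn'
    have hup := mul_ncard_not_isColexMinusEdges_le hτ hn'
    rw [← hX, ← hA] at hup
    have hadd : {S ∈ extremalSet τ n (i + 2) | IsColexMinusEdges n (i + 2) S}.ncard +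
        {S ∈ extremalSet τ n (i + 2) | ¬ IsColexMinusEdges n (i + 2) S}.ncard =
        (extremalSet τ n (i + 2)).ncard :=
      Set.ncard_inter_add_ncard_sdiff_eq_ncard _ {S | IsColexMinusEdges n (i + 2) S}
        (Set.toFinite _)
    rw [← hadd]
    generalize {S ∈ extremalSet τ n (i + 2) | IsColexMinusEdges n (i + 2) S}.ncard = p at hn
    generalize {S ∈ extremalSet τ n (i + 2) | ¬ IsColexMinusEdges n (i + 2) S}.ncard = q at hup
    have hn0 : 0 < n := by omega
    have hp : 0 < p := by
      rcases Nat.eq_zero_or_pos p with rfl | h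
      · have := pow_pos hn0 X
        omega
      · exact h
    have hqp : n * q ≤ A * C * p := by
      calc n * q ≤ A * n ^ X := hup
        _ ≤ A * (C * p) := Nat.mul_le_mul_left _ hn
        _ = A * C * p := by ring
    have hp' : (0 : ℝ) < p := by exact_mod_cast hp
    have hn0' : (0 : ℝ) < n := by exact_mod_cast hn0
    have hqp' : (n : ℝ) * q ≤ (A * C : ℕ) * p := by exact_mod_cast hqp
    have hsplit : ((p + q : ℕ) : ℝ) / p = 1 + q / p := by
      rw [Nat.cast_add, add_div, div_self hp'.ne']
    rw [hsplit]
    refine ⟨by simp only [le_add_iff_nonneg_right]; positivity, ?_⟩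
    gcongr 1 + ?_
    rw [div_le_div_iff₀ hp' hn0', mul_comm]
    exact hqp'
  exact tendsto_of_tendsto_of_tendsto_of_le_of_le' tendsto_const_nhds hlim
    (hev.mono fun _ h => h.1) (hev.mono fun _ h => h.2)

/-- A strictly increasing tuple extends to a strictly increasing sequence. -/
lemma exists_strictMono_extension {k : ℕ} (hk : 0 < k) {t : Fin k → ℕ} (ht : StrictMono t) :
    ∃ τ : ℕ → ℕ, StrictMono τ ∧ ∀ i : Fin k, t i = τ i := by
  refine ⟨fun i => if h : i < k then t ⟨i, h⟩ else t ⟨k - 1, by omega⟩ + i,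
    strictMono_nat_of_lt_succ fun i => ?_, fun i => by simp⟩
  by_cases h1 : i + 1 < k
  · have h0 : i < k := by omega
    simp only [h0, h1, dite_true]
    exact ht (Fin.mk_lt_mk.2 i.lt_succ_self)
  · by_cases h0 : i < k
    · have h2 : i = k - 1 := by omega
      subst h2
      simp only [h0, h1, dite_true, dite_false]
      omega
    · simp only [h0, h1, dite_false]
      omega

theorem theorem11 (k : ℕ) (hk : 0 < k) (t : Fin k → ℕ) (ht_pos : ∀ i, 0 < t i)
    (ht_mono : StrictMono t) :
    Tendsto
      (fun n : ℕ =>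
        ((extremalFamilies n k t).ncard : ℝ) / ((extremalFamiliesFromColex n k t).ncard : ℝ))
      atTop (𝓝 1) := by
  obtain ⟨τ, hτ, ht⟩ := exists_strictMono_extension hk ht_mono
  have hev : ∀ᶠ n : ℕ in atTop, ((extremalSet τ n k).ncard : ℝ) /
        ({S ∈ extremalSet τ n k | IsColexMinusEdges n k S}.ncard : ℝ) =
      ((extremalFamilies n k t).ncard : ℝ) / ((extremalFamiliesFromColex n k t).ncard : ℝ) := by
    filter_upwards [eventually_ge_atTop (2 * τ k + 2 * k + 3)] with n hn
    rw [extremalFamiliesFromColex, extremalFamilies_eq hk ht hτ hn]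
  refine Tendsto.congr' hev ?_
  clear hev ht
  obtain rfl | ⟨i, rfl⟩ : k = 1 ∨ ∃ i, k = i + 2 := by
    rcases Nat.lt_or_ge k 2 with h | h
    · left
      omega
    · exact Or.inr ⟨k - 2, by omega⟩
  · refine tendsto_const_nhds.congr' ?_
    filter_upwards [eventually_ge_atTop (τ 0 + 1)] with n hn
    have h : {S ∈ extremalSet τ n 1 | IsColexMinusEdges n 1 S} = extremalSet τ n 1 :=
      Set.sep_eq_self_iff_mem_true.2 fun S hS => isColexMinusEdges_one hS.1 (by
        rw [← Finset.card_pos, hS.2.1]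
        exact faceCount_pos τ n 1)
    rw [h, div_self]
    have := (Set.ncard_pos (Set.toFinite _)).2 (extremalSet_one_nonempty hn)
    exact_mod_cast this.ne'
  · exact tendsto_ncard_div_of_two_le hτ i
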